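/- Let $n\ge 0$, $g=sl_n(\mathbb C)$, and let $i: sl_2(\mathbb C)\to g$ be a Lie algebra homomorphism (an $sl_2$ embedding; the trivial one $i=0$ is allowed), with $t_+=i(E_{12})$ and $t_-=i(E_{21})$. Let $n_1\ge n_2\ge\dots$ be the partition of $n$ given by the dimensions of the irreducible summands of the fundamental representation $\mathbb C^n$ under $i$, and choose a basis $(v_{l,k})_{1\le k\le n_l}$ of $\mathbb C^n$ in which, writing $E_{x,y}$ for the matrix unit sending $v_y$ to $v_x$, $$t_+=\sum_l\sum_{k=1}^{n_l-1}E_{(l,k),(l,k+1)},\qquad t_-=\sum_l\sum_{k=1}^{n_l-1}k(n_l-k)\,E_{(l,k+1),(l,k)} .$$ Every $sl_2$ embedding admits such bases; the choice is arbitrary. Let $g_+\subset g$ be the nilpotent subalgebra with basis $t_\alpha=E_{(l,k),(r,m)}$, where $\alpha=((l,k),(r,m))$ runs over all pairs with $k<m$, and let $t^\alpha=E_{(r,m),(l,k)}$ be the dual vectors with respect to the trace form. Put $\chi(J^\alpha)=1$ if $t_\alpha=E_{(l,k),(l,k+1)}$ for some $l,k$, and $\chi(J^\alpha)=0$ otherwise.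 Let $J^\alpha\in\mathcal U(g)$ be the image of $t^\alpha$ (so $J^\alpha$ is the coordinate function of $t_\alpha$, identified with an element of $g$ by the trace form), and define $f^{\alpha\beta}{}_\gamma$ by $[t^\alpha,t^\beta]=\sum_\gamma f^{\alpha\beta}{}_\gamma t^\gamma$. Let $c_\alpha,b^\alpha$ be the generators of the Clifford algebra $Cl(g_+\oplus g_+^*)$ corresponding to the basis $t_\alpha$ of $g_+$ and its dual basis, so that $b^\alpha c_\beta+c_\beta b^\alpha=\delta^\alpha_\beta$, while the $c$'s anticommute among themselves, and so do the $b$'s. Let $\Omega=\mathcal U(g)\otimes Cl(g_+\oplus g_+^*)=\bigoplus_{k\in\mathbb Z}\Omega^k$ be graded by $\deg \mathcal U(g)=0$, $\deg c_\alpha=1$, $\deg b^\alpha=-1$, with $$Q=\sum_\alpha (J^\alpha-\chi(J^\alpha))\,c_\alpha-\tfrac12\sum_{\alpha,\beta,\gamma} f^{\alpha\beta}{}_\gamma\, b^\gamma c_\alpha c_\beta,\qquad d(X)=[Q,X]=QX-(-1)^{\deg X}XQ .$$ Let $g_{lw}=\ker(\mathrm{ad}\,t_-)\subset g$. Then the BRST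 cohomology is given by the following isomorphisms of complex vector spaces: $$H^0(\Omega;d)\simeq \mathcal U(g_{lw}),\qquad H^k(\Omega;d)=0\quad\text{for all } k\neq 0 .$$ -/

import Mathlib

noncomputable section

namespace FiniteW

open LieAlgebra
open scoped TensorProduct

attribute [local instance 100] LieRing.ofAssociativeRing

/-- The boxes of a Young diagram; the box `(l, k)` lies in row `l` and column `k`, both counted
from `0`. The diagram is the partition whose parts are its row lengths. -/
abbrev Cell (μ : YoungDiagram) : Type := {x : ℕ × ℕ // x ∈ μ.cells}

/-- `y` is the right-hand neighbour of `x` in the same row. -/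
def IsNext {μ : YoungDiagram} (x y : Cell μ) : Prop :=
  y.1.1 = x.1.1 ∧ y.1.2 = x.1.2 + 1

instance {μ : YoungDiagram} (x y : Cell μ) : Decidable (IsNext x y) :=
  inferInstanceAs (Decidable (_ ∧ _))

/-- The index set of the basis of `g_+`: pairs of boxes `(x, y)` with the column of `x` strictly to
the left of the column of `y`. -/
abbrev PosIdx (μ : YoungDiagram) : Type :=
  {p : Cell μ × Cell μ // p.1.1.2 < p.2.1.2}

/-- `sl_n` over the complex numbers. -/
abbrev SL (n : ℕ) : Type := SpecialLinear.sl (Fin n) ℂ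

/-- The raising generator `E_{12}` of `sl_2`; its image under an embedding is `t_+`. -/
def sl2E : SL 2 := SpecialLinear.single 0 1 (by decide) 1

/-- The lowering generator `E_{21}` of `sl_2`; its image under an embedding is `t_-`. -/
def sl2F : SL 2 := SpecialLinear.single 1 0 (by decide) 1

section Embedding

variable {n : ℕ} {μ : YoungDiagram} (v : Module.Basis (Cell μ) ℂ (Fin n → ℂ))

/-- The matrix unit `E_{xy}` with respect to the basis `v` of `ℂ^n`: it maps `v y` to `v x` and the
other basis vectors to `0`. -/
def matUnit (x y : Cell μ) : Matrix (Fin n) (Fin n) ℂ :=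
  LinearMap.toMatrix' ((v.coord y).smulRight (v x))

theorem matUnit_mul (x y z w : Cell μ) :
    matUnit v x y * matUnit v z w = if y = z then matUnit v x w else 0 := by
  unfold matUnit
  rw [← LinearMap.toMatrix'_comp]
  split_ifs with h
  · subst h
    congr 1
    ext u
    simp
  · rw [← map_zero (LinearMap.toMatrix' (R := ℂ) (m := Fin n) (n := Fin n))]
    congr 1
    refine LinearMap.ext fun u => ?_
    simp [Ne.symm h]

theorem trace_matUnit (x y : Cell μ) : (matUnit v x y).trace = if x = y then 1 else 0 := by
  have h : (matUnit v x y).trace = LinearMap.trace ℂ _ ((v.coord y).smulRight (v x)) := by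
    rw [matUnit, ← LinearMap.toMatrix_eq_toMatrix']
    exact (LinearMap.trace_eq_matrix_trace ℂ (Pi.basisFun ℂ (Fin n)) _).symm
  rw [h, LinearMap.trace_smulRight]
  simp [Finsupp.single_apply]

theorem PosIdx.ne (α : PosIdx μ) : α.1.1 ≠ α.1.2 := fun h => by
  have := α.2
  rw [h] at this
  exact lt_irrefl _ this

/-- The basis vector `t_α = E_{xy}` of `g_+`, for `α = (x, y)`. -/
def tLow (α : PosIdx μ) : SL n :=
  ⟨matUnit v α.1.1 α.1.2, by
    change (matUnit v α.1.1 α.1.2).trace = 0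
    rw [trace_matUnit, if_neg α.ne]⟩

/-- The vector `t^α = E_{yx}`, for `α = (x, y)`: the trace-form dual of `t_α`. -/
def tUp (α : PosIdx μ) : SL n :=
  ⟨matUnit v α.1.2 α.1.1, by
    change (matUnit v α.1.2 α.1.1).trace = 0
    rw [trace_matUnit, if_neg α.ne.symm]⟩

/-- The nilpotent algebra `g_+`. -/
def gPlus : Submodule ℂ (SL n) := Submodule.span ℂ (Set.range (tLow v))

/-- The basis `v` puts the embedding `i` in standard form: each row of the diagram spans an
irreducible summand, and
`t_+ = ∑ E_{(l,k),(l,k+1)}`, `t_- = ∑ k (n_l - k) E_{(l,k+1),(l,k)}`,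
where (with columns counted from `1`) the sums run over all `l` and `1 ≤ k < n_l`. -/
def IsAdapted (i : SL 2 →ₗ⁅ℂ⁆ SL n) : Prop :=
  (i sl2E).1 =
      ∑ x : Cell μ, ∑ y : Cell μ, (if IsNext x y then matUnit v x y else 0) ∧
  (i sl2F).1 =
      ∑ x : Cell μ, ∑ y : Cell μ, (if IsNext x y then
        ((y.1.2 : ℂ) * ((μ.rowLen y.1.1 : ℂ) - (y.1.2 : ℂ))) • matUnit v y x else 0)

/-- `χ` is `1` on the matrix units that make up `t_+`, and `0` on the other ones. -/
def chi (α : PosIdx μ) : ℂ := if IsNext α.1.1 α.1.2 then 1 else 0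

/-- `f^{αβ}_γ`, the structure constants of the `t^α`. -/
def structConst (α β γ : PosIdx μ) : ℂ :=
  (⁅tUp v α, tUp v β⁆.1 * (tLow v γ).1).trace

end Embedding

/-- The kernel of `ad t` as a Lie subalgebra; for `t = t_-` this is `g_lw`. -/
def adKer {L : Type*} [LieRing L] [LieAlgebra ℂ L] (t : L) : LieSubalgebra ℂ L :=
  { LinearMap.ker (LieAlgebra.ad ℂ L t : L →ₗ[ℂ] L) with
    lie_mem' := by
      intro x y hx hy
      have hx' : ⁅t, x⁆ = 0 := hx
      have hy' : ⁅t, y⁆ = 0 := hy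
      change ⁅t, ⁅x, y⁆⁆ = 0
      rw [leibniz_lie, hx', hy']
      simp }

section Complex

variable {n : ℕ} {μ : YoungDiagram} (v : Module.Basis (Cell μ) ℂ (Fin n → ℂ))

/-- The Clifford algebra `Cl(g_+ ⊕ g_+^*)` of the evaluation pairing. -/
abbrev Ghosts : Type := CliffordAlgebra (QuadraticForm.dualProd ℂ (gPlus v))

/-- The ghost `c_α`, which is `t_α` in `g_+`. -/
def ghost (α : PosIdx μ) : Ghosts v :=
  CliffordAlgebra.ι _ (0, ⟨tLow v α, Submodule.subset_span ⟨α, rfl⟩⟩)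

/-- The coordinate function of `t_α` on `g_+`, given by `x ↦ Tr(t^α x)`. -/
def dualVec (α : PosIdx μ) : Module.Dual ℂ (gPlus v) where
  toFun x := ((tUp v α).1 * x.1.1).trace
  map_add' x y := by simp [mul_add]
  map_smul' r x := by simp

/-- The antighost `b^α`, which is the dual basis vector of `t_α` in `g_+^*`. -/
def antighost (α : PosIdx μ) : Ghosts v := CliffordAlgebra.ι _ (dualVec v α, 0)

/-- The space `Ω = U(g) ⊗ Cl(g_+ ⊕ g_+^*)`, with its product algebra structure. -/
abbrev Omega : Type := UniversalEnvelopingAlgebra ℂ (SL n) ⊗[ℂ] Ghosts v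

/-- `J^α` in `U(g)`: the coordinate function `J^α` on `g` is the element `t^α` of `g`. -/
def J (α : PosIdx μ) : UniversalEnvelopingAlgebra ℂ (SL n) :=
  UniversalEnvelopingAlgebra.ι ℂ (tUp v α)

/-- The BRST charge
`Q = (J^α - χ(J^α)) c_α - (1/2) f^{αβ}_γ b^γ c_α c_β`. -/
def Q : Omega v :=
  ∑ α : PosIdx μ, (J v α - algebraMap ℂ _ (chi α)) ⊗ₜ[ℂ] ghost v α -
    (1 / 2 : ℂ) • ∑ α : PosIdx μ, ∑ β : PosIdx μ, ∑ γ : PosIdx μ,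
      structConst v α β γ • ((1 : UniversalEnvelopingAlgebra ℂ (SL n)) ⊗ₜ[ℂ]
        (antighost v γ * ghost v α * ghost v β))

/-- A word in the ghosts (`Sum.inl`) and antighosts (`Sum.inr`). -/
def ghostWord (w : List (PosIdx μ ⊕ PosIdx μ)) : Ghosts v :=
  (w.map (Sum.elim (ghost v) (antighost v))).prod

/-- The degree of a word: each ghost counts `+1`, each antighost `-1`. -/
def wordDeg (w : List (PosIdx μ ⊕ PosIdx μ)) : ℤ :=
  (w.map (Sum.elim (fun _ => 1) (fun _ => -1))).sum

/-- The degree `k` part `Ω^k`. -/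
def OmegaDeg (k : ℤ) : Submodule ℂ (Omega v) :=
  Submodule.span ℂ {X | ∃ u w, wordDeg w = k ∧ X = u ⊗ₜ[ℂ] ghostWord v w}

/-- The sign automorphism, equal to `(-1)^k` on `Ω^k`. -/
def parity : Omega v →ₐ[ℂ] Omega v :=
  Algebra.TensorProduct.map (AlgHom.id ℂ _) CliffordAlgebra.involute

/-- The BRST differential: the graded commutator `X ↦ [Q, X] = Q X - (-1)^{deg X} X Q`. -/
def brst : Omega v →ₗ[ℂ] Omega v :=
  LinearMap.mulLeft ℂ (Q v) - (LinearMap.mulRight ℂ (Q v)).comp (parity v).toLinearMap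

theorem tLow_tUp_trace (α β : PosIdx μ) :
    ((tUp v α).1 * (tLow v β).1).trace = if α = β then 1 else 0 := by
  obtain ⟨⟨a, a'⟩, ha⟩ := α
  obtain ⟨⟨b, b'⟩, hb⟩ := β
  simp only [tUp, tLow, matUnit_mul, Subtype.mk.injEq, Prod.mk.injEq]
  by_cases h1 : a = b <;> by_cases h2 : a' = b' <;> simp [h1, h2, trace_matUnit]

theorem ghost_mul_ghost (α β : PosIdx μ) :
    ghost v α * ghost v β = -(ghost v β * ghost v α) := by
  rw [eq_neg_iff_add_eq_zero, ghost, ghost, CliffordAlgebra.ι_mul_ι_add_swap]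
  simp [QuadraticMap.polar]

theorem antighost_mul_antighost (α β : PosIdx μ) :
    antighost v α * antighost v β = -(antighost v β * antighost v α) := by
  rw [eq_neg_iff_add_eq_zero, antighost, antighost, CliffordAlgebra.ι_mul_ι_add_swap]
  simp [QuadraticMap.polar]

theorem antighost_mul_ghost (α β : PosIdx μ) :
    antighost v α * ghost v β = (if α = β then 1 else 0) - ghost v β * antighost v α := by
  rw [eq_sub_iff_add_eq, ghost, antighost, CliffordAlgebra.ι_mul_ι_add_swap]
  simp only [QuadraticMap.polar, QuadraticForm.dualProd_apply]
  have := tLow_tUp_trace v α β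
  by_cases h : α = β <;> simp_all [dualVec]

/-- The elements `t^α` span a Lie algebra with structure constants `f^{αβ}_γ`. -/
theorem tUp_bracket (α β : PosIdx μ) :
    ⁅tUp v α, tUp v β⁆ = ∑ γ, structConst v α β γ • tUp v γ := by
  obtain ⟨⟨a, a'⟩, ha⟩ := α
  obtain ⟨⟨b, b'⟩, hb⟩ := β
  have key : ∀ x y : Cell μ, ∀ h : x.1.2 < y.1.2, ∑ γ : PosIdx μ,
      (matUnit v y x * (tLow v γ).1).trace • (tUp v γ).1 = matUnit v y x := by
    intro x y h
    have h' : ∀ γ : PosIdx μ, (matUnit v y x * (tLow v γ).1).trace =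
        if ⟨(x, y), h⟩ = γ then 1 else 0 := fun γ => tLow_tUp_trace v ⟨(x, y), h⟩ γ
    simp only [h', ite_smul, one_smul, zero_smul, Finset.sum_ite_eq, Finset.mem_univ, if_true]
    rfl
  have e : ⁅tUp v ⟨(a, a'), ha⟩, tUp v ⟨(b, b'), hb⟩⁆.1 =
      (if a = b' then matUnit v a' b else 0) - (if b = a' then matUnit v b' a else 0) := by
    rw [SpecialLinear.sl_bracket]
    simp only [tUp, matUnit_mul]
  apply Subtype.ext
  have e2 : (∑ γ, structConst v ⟨(a, a'), ha⟩ ⟨(b, b'), hb⟩ γ • tUp v γ).1 =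
      ∑ γ, structConst v ⟨(a, a'), ha⟩ ⟨(b, b'), hb⟩ γ • (tUp v γ).1 := by
    simp
  rw [e2]
  simp only [structConst, e, sub_mul, Matrix.trace_sub, sub_smul, Finset.sum_sub_distrib]
  congr 1
  · split_ifs with h
    · subst h
      exact (key b a' (lt_trans hb ha)).symm
    · simp
  · split_ifs with h
    · subst h
      exact (key a b' (lt_trans ha hb)).symm
    · simp

theorem structConst_antisymm (α β γ : PosIdx μ) :
    structConst v α β γ = -structConst v β α γ := by
  have h : ⁅tUp v α, tUp v β⁆.1 = -⁅tUp v β, tUp v α⁆.1 :=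
    congrArg Subtype.val (lie_skew (tUp v α) (tUp v β)).symm
  rw [structConst, structConst, h, neg_mul, Matrix.trace_neg]

theorem structConst_comp (α μ' ν γ : PosIdx μ) :
    ∑ ρ, structConst v α ρ γ * structConst v μ' ν ρ =
      (⁅tUp v α, ⁅tUp v μ', tUp v ν⁆⁆.1 * (tLow v γ).1).trace := by
  rw [tUp_bracket v μ' ν, lie_sum]
  simp only [lie_smul, AddSubmonoidClass.coe_finsetSum, Finset.sum_mul, Matrix.trace_sum]
  refine Finset.sum_congr rfl fun ρ _ => ?_
  rw [structConst, mul_comm]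
  simp [structConst]

theorem structConst_jacobi (α β δ γ : PosIdx μ) :
    ∑ ρ, structConst v α ρ γ * structConst v β δ ρ + ∑ ρ, structConst v β ρ γ * structConst v δ α ρ +
      ∑ ρ, structConst v δ ρ γ * structConst v α β ρ = 0 := by
  simp only [structConst_comp, ← Matrix.trace_add, ← add_mul]
  have := lie_jacobi (tUp v α) (tUp v β) (tUp v δ)
  have h : ⁅tUp v α, ⁅tUp v β, tUp v δ⁆⁆.1 + ⁅tUp v β, ⁅tUp v δ, tUp v α⁆⁆.1 +
      ⁅tUp v δ, ⁅tUp v α, tUp v β⁆⁆.1 = 0 := congrArg Subtype.val this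
  rw [h, zero_mul, Matrix.trace_zero]

/-- `χ` is a character: it vanishes on brackets. -/
theorem chi_structConst (α β : PosIdx μ) :
    ∑ γ, structConst v α β γ * chi γ = 0 := by
  refine Finset.sum_eq_zero fun γ _ => ?_
  obtain ⟨⟨a, a'⟩, ha⟩ := α
  obtain ⟨⟨b, b'⟩, hb⟩ := β
  obtain ⟨⟨c, c'⟩, hc⟩ := γ
  unfold chi
  split_ifs with h
  · have h2 := h.2
    simp only [structConst, SpecialLinear.sl_bracket, tUp, tLow, sub_mul, matUnit_mul]
    rw [mul_one, Matrix.trace_sub]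
    dsimp only at ha hb hc h2
    have z1 : ((if a = b' then matUnit v a' b else 0) * matUnit v c c').trace = 0 := by
      split_ifs with k
      · rw [matUnit_mul]
        split_ifs with k2
        · rw [trace_matUnit, if_neg]
          rintro rfl
          subst k k2
          omega
        · simp
      · simp
    have z2 : ((if b = a' then matUnit v b' a else 0) * matUnit v c c').trace = 0 := by
      split_ifs with k
      · rw [matUnit_mul]
        split_ifs with k2
        · rw [trace_matUnit, if_neg]
          rintro rfl
          subst k k2
          omega
        · simp
      · simp
    rw [z1, z2, sub_zero]
  · simp

end Complex

section Square

variable {A I : Type*} [Ring A] [Algebra ℂ A] [Fintype I] [DecidableEq I]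

/-- A charge of the BRST form squares to zero. -/
theorem charge_sq (j c b : I → A) (f : I → I → I → ℂ)
    (hcc : ∀ α β, c α * c β = -(c β * c α)) (hbb : ∀ α β, b α * b β = -(b β * b α))
    (hbc : ∀ α β, b α * c β = (if α = β then 1 else 0) - c β * b α)
    (hjc : ∀ α β, j α * c β = c β * j α) (hjb : ∀ α β, j α * b β = b β * j α)
    (hj : ∀ α β, j α * j β - j β * j α = ∑ γ, f α β γ • j γ)
    (hf : ∀ α β γ, f α β γ = -f β α γ)
    (hJ : ∀ α β δ γ, ∑ ρ, f α ρ γ * f β δ ρ + ∑ ρ, f β ρ γ * f δ α ρ + ∑ ρ, f δ ρ γ * f α β ρ = 0) :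
    (∑ α, j α * c α - (1 / 2 : ℂ) • ∑ α, ∑ β, ∑ γ, f α β γ • (b γ * c α * c β)) *
    (∑ α, j α * c α - (1 / 2 : ℂ) • ∑ α, ∑ β, ∑ γ, f α β γ • (b γ * c α * c β)) = 0 := by
  set S := ∑ α, j α * c α with hS
  set T := ∑ α, ∑ β, ∑ γ, f α β γ • (b γ * c α * c β) with hT
  set R := ∑ α, ∑ β, ∑ γ, f α β γ • (j γ * c α * c β) with hR
  have hSS : (2 : ℂ) • (S * S) = R := by
    have h1 : S * S = ∑ α, ∑ β, j α * j β * (c α * c β) := by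
      rw [hS, Finset.sum_mul_sum]
      refine Finset.sum_congr rfl fun α _ => Finset.sum_congr rfl fun β _ => ?_
      rw [mul_assoc, ← mul_assoc (c α), ← hjc β α]; noncomm_ring
    have h2 : S * S = -∑ α, ∑ β, j β * j α * (c α * c β) := by
      rw [h1, Finset.sum_comm, ← Finset.sum_neg_distrib]
      refine Finset.sum_congr rfl fun α _ => ?_
      rw [← Finset.sum_neg_distrib]
      refine Finset.sum_congr rfl fun β _ => ?_
      rw [hcc β α, mul_neg]
    rw [two_smul]
    nth_rewrite 1 [h1]
    rw [h2, ← sub_eq_add_neg, ← Finset.sum_sub_distrib]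
    refine Finset.sum_congr rfl fun α _ => ?_
    rw [← Finset.sum_sub_distrib]
    refine Finset.sum_congr rfl fun β _ => ?_
    rw [← sub_mul, hj, Finset.sum_mul]
    refine Finset.sum_congr rfl fun γ _ => ?_
    rw [smul_mul_assoc, mul_assoc (j γ)]
  have hST : S * T + T * S = R := by
    have h1 : ∀ X, S * X + X * S = ∑ δ, (j δ * c δ * X + X * (j δ * c δ)) := by
      intro X
      rw [hS, Finset.sum_mul, Finset.mul_sum, Finset.sum_add_distrib]
    have h2 : ∀ α β γ, S * (b γ * c α * c β) + (b γ * c α * c β) * S = j γ * c α * c β := by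
      intro α β γ
      rw [h1]
      rw [Finset.sum_eq_single γ]
      · have e1 : c γ * b γ = 1 - b γ * c γ := by rw [hbc]; simp
        calc _ = j γ * (c γ * b γ) * c α * c β + b γ * c α * (c β * j γ) * c γ := by noncomm_ring
          _ = j γ * (c γ * b γ) * c α * c β + b γ * (c α * j γ) * c β * c γ := by
            rw [← hjc]; noncomm_ring
          _ = j γ * (c γ * b γ) * c α * c β + (b γ * j γ) * c α * (c β * c γ) := by
            rw [← hjc]; noncomm_ring
          _ = j γ * (1 - b γ * c γ) * c α * c β + (j γ * b γ) * c α * (-(c γ * c β)) := by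
            rw [e1, hcc β γ, hjb]
          _ = j γ * c α * c β - j γ * b γ * (c γ * c α) * c β - j γ * b γ * c α * c γ * c β := by
            noncomm_ring
          _ = _ := by rw [hcc γ α]; noncomm_ring
      · intro δ _ hδ
        have e1 : c δ * b γ = - (b γ * c δ) := by rw [hbc, if_neg (Ne.symm hδ)]; simp
        calc _ = j δ * (c δ * b γ) * c α * c β + b γ * c α * (c β * j δ) * c δ := by noncomm_ring
          _ = j δ * (c δ * b γ) * c α * c β + b γ * (c α * j δ) * c β * c δ := by
            rw [← hjc]; noncomm_ring
          _ = j δ * (c δ * b γ) * c α * c β + (b γ * j δ) * c α * (c β * c δ) := by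
            rw [← hjc]; noncomm_ring
          _ = j δ * (-(b γ * c δ)) * c α * c β + (j δ * b γ) * c α * (-(c δ * c β)) := by
            rw [e1, hcc β δ, hjb]
          _ = - (j δ * b γ * (c δ * c α) * c β) - j δ * b γ * c α * c δ * c β := by
            noncomm_ring
          _ = 0 := by rw [hcc δ α]; noncomm_ring
      · simp
    rw [hT, hR]
    simp only [Finset.mul_sum, Finset.sum_mul, ← Finset.sum_add_distrib]
    refine Finset.sum_congr rfl fun α _ => Finset.sum_congr rfl fun β _ =>
      Finset.sum_congr rfl fun γ _ => ?_
    rw [mul_smul_comm, smul_mul_assoc, ← smul_add, h2]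
  have hTT : T * T = 0 := by
    set C : I → A := fun γ => ∑ α, ∑ β, f α β γ • (c α * c β) with hC
    have hTC : T = ∑ γ, b γ * C γ := by
      rw [hT]
      simp only [hC, Finset.mul_sum, mul_smul_comm]
      rw [Finset.sum_comm' (t' := Finset.univ) (s' := fun _ => Finset.univ) (by simp)]
      rw [Finset.sum_congr rfl fun β _ => Finset.sum_comm, Finset.sum_comm]
      refine Finset.sum_congr rfl fun γ _ => ?_
      rw [Finset.sum_comm]
      refine Finset.sum_congr rfl fun α _ => Finset.sum_congr rfl fun β _ => ?_
      rw [mul_assoc]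
    have hccc : ∀ α μ ν, c α * (c μ * c ν) = c μ * c ν * c α := by
      intro α μ ν
      rw [← mul_assoc, hcc α μ, neg_mul, mul_assoc, hcc α ν]; noncomm_ring
    have hcC : ∀ α γ, c α * C γ = C γ * c α := by
      intro α γ
      simp only [hC, Finset.mul_sum, Finset.sum_mul, mul_smul_comm, smul_mul_assoc, hccc]
    have hCC : ∀ γ ρ, C γ * C ρ = C ρ * C γ := by
      intro γ ρ
      have h : C γ = ∑ α, ∑ β, f α β γ • (c α * c β) := rfl
      rw [h]
      simp only [Finset.mul_sum, Finset.sum_mul, mul_smul_comm, smul_mul_assoc]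
      refine Finset.sum_congr rfl fun α _ => Finset.sum_congr rfl fun β _ => ?_
      rw [mul_assoc, hcC, ← mul_assoc, hcC, mul_assoc]
    have hCb : ∀ γ ρ, C γ * b ρ = b ρ * C γ + (2 : ℂ) • ∑ α, f α ρ γ • c α := by
      intro γ ρ
      have h1 : ∀ α β, c α * c β * b ρ = b ρ * (c α * c β) +
          ((if ρ = β then c α else 0) - (if ρ = α then c β else 0)) := by
        intro α β
        have e1 : ∀ α, c α * b ρ = (if ρ = α then 1 else 0) - b ρ * c α := fun α => by
          rw [hbc]; abel
        rw [mul_assoc, e1, mul_sub, ← mul_assoc, e1, sub_mul]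
        split_ifs <;> noncomm_ring
      simp only [hC, Finset.sum_mul, Finset.mul_sum, smul_mul_assoc, h1, smul_add, mul_smul_comm,
        smul_sub, Finset.sum_add_distrib, Finset.sum_sub_distrib, smul_ite, smul_zero,
        Finset.sum_ite_eq, Finset.mem_univ, if_true]
      congr 1
      have h2 : ∑ α, ∑ β, (if ρ = α then f α β γ • c β else 0) = ∑ β, f ρ β γ • c β := by
        rw [Finset.sum_comm]
        simp
      rw [h2, two_smul, sub_eq_add_neg, ← Finset.sum_neg_distrib]
      congr 1
      refine Finset.sum_congr rfl fun α _ => ?_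
      rw [hf ρ α γ, neg_smul, neg_neg]
    have hY : ∀ γ, ∑ ρ, ∑ α, f α ρ γ • (c α * C ρ) = 0 := by
      intro γ
      let g : I → I → I → ℂ := fun α μ ν => ∑ ρ, f α ρ γ * f μ ν ρ
      set Y := ∑ α, ∑ μ, ∑ ν, g α μ ν • (c α * (c μ * c ν)) with hYd
      have h0 : ∑ ρ, ∑ α, f α ρ γ • (c α * C ρ) = Y := by
        rw [Finset.sum_comm, hYd]
        refine Finset.sum_congr rfl fun α _ => ?_
        simp only [hC, Finset.mul_sum, mul_smul_comm, Finset.smul_sum, smul_smul, g,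
          Finset.sum_smul]
        rw [Finset.sum_comm]
        refine Finset.sum_congr rfl fun μ _ => ?_
        rw [Finset.sum_comm]
      have h1 : Y = ∑ α, ∑ μ, ∑ ν, g μ ν α • (c α * (c μ * c ν)) := by
        rw [hYd, Finset.sum_congr rfl fun β _ => Finset.sum_comm, Finset.sum_comm]
        refine Finset.sum_congr rfl fun α _ => Finset.sum_congr rfl fun μ _ =>
          Finset.sum_congr rfl fun ν _ => ?_
        rw [hccc α μ ν, mul_assoc]
      have h2 : Y = ∑ α, ∑ μ, ∑ ν, g ν α μ • (c α * (c μ * c ν)) := by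
        rw [h1, Finset.sum_congr rfl fun β _ => Finset.sum_comm, Finset.sum_comm]
        refine Finset.sum_congr rfl fun α _ => Finset.sum_congr rfl fun μ _ =>
          Finset.sum_congr rfl fun ν _ => ?_
        rw [hccc α μ ν, mul_assoc]
      have h3 : Y + Y + Y = 0 := by
        nth_rewrite 1 [hYd]
        nth_rewrite 1 [h1]
        nth_rewrite 1 [h2]
        simp only [← Finset.sum_add_distrib, ← add_smul]
        refine Finset.sum_eq_zero fun α _ => Finset.sum_eq_zero fun μ _ =>
          Finset.sum_eq_zero fun ν _ => ?_
        have : g α μ ν + g μ ν α + g ν α μ = 0 := hJ α μ ν γ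
        rw [this, zero_smul]
      have h4 : (3 : ℂ) • Y = 0 := by
        rw [← h3, show (3 : ℂ) = 1 + 1 + 1 by norm_num, add_smul, add_smul, one_smul]
      rw [h0]
      exact (smul_eq_zero.mp h4).resolve_left (by norm_num)
    have hX : ∑ γ, ∑ ρ, b γ * b ρ * (C γ * C ρ) = 0 := by
      set X := ∑ γ, ∑ ρ, b γ * b ρ * (C γ * C ρ) with hXd
      have h1 : X = -X := by
        nth_rewrite 1 [hXd]
        rw [Finset.sum_comm, hXd, ← Finset.sum_neg_distrib]
        refine Finset.sum_congr rfl fun γ _ => ?_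
        rw [← Finset.sum_neg_distrib]
        refine Finset.sum_congr rfl fun ρ _ => ?_
        rw [hbb ρ γ, hCC ρ γ, neg_mul]
      have h4 : (2 : ℂ) • X = 0 := by
        rw [two_smul]
        nth_rewrite 1 [h1]
        simp
      exact (smul_eq_zero.mp h4).resolve_left (by norm_num)
    have h5 : T * T = ∑ γ, ∑ ρ, b γ * b ρ * (C γ * C ρ) +
        (2 : ℂ) • ∑ γ, b γ * ∑ ρ, ∑ α, f α ρ γ • (c α * C ρ) := by
      rw [hTC, Finset.sum_mul_sum, Finset.smul_sum, ← Finset.sum_add_distrib]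
      refine Finset.sum_congr rfl fun γ _ => ?_
      rw [show b γ * ∑ ρ, ∑ α, f α ρ γ • (c α * C ρ) = ∑ ρ, b γ * ∑ α, f α ρ γ • (c α * C ρ) from
        Finset.mul_sum _ _ _, Finset.smul_sum, ← Finset.sum_add_distrib]
      refine Finset.sum_congr rfl fun ρ _ => ?_
      rw [show b γ * C γ * (b ρ * C ρ) = b γ * (C γ * b ρ) * C ρ by noncomm_ring, hCb]
      simp only [mul_add, add_mul, mul_smul_comm, smul_mul_assoc, Finset.mul_sum, Finset.sum_mul,
        mul_assoc]
    rw [h5, hX]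
    simp only [hY, mul_zero, Finset.sum_const_zero, smul_zero, add_zero]
  have e : (S - (1 / 2 : ℂ) • T) * (S - (1 / 2 : ℂ) • T) =
      S * S - (1 / 2 : ℂ) • (S * T + T * S) + (1 / 4 : ℂ) • (T * T) := by
    simp only [sub_mul, mul_sub, smul_mul_assoc, mul_smul_comm, smul_add, smul_sub]
    module
  rw [e, hTT, hST, ← hSS, smul_smul]
  norm_num

end Square

section Differential

variable {n : ℕ} {μ : YoungDiagram} (v : Module.Basis (Cell μ) ℂ (Fin n → ℂ))

theorem Q_mul_Q : Q v * Q v = 0 := by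
  let U := UniversalEnvelopingAlgebra ℂ (SL n)
  let j : PosIdx μ → Omega v := fun α => (J v α - algebraMap ℂ U (chi α)) ⊗ₜ[ℂ] 1
  let c : PosIdx μ → Omega v := fun α => (1 : U) ⊗ₜ[ℂ] ghost v α
  let b : PosIdx μ → Omega v := fun α => (1 : U) ⊗ₜ[ℂ] antighost v α
  have hQ : Q v = ∑ α, j α * c α - (1 / 2 : ℂ) • ∑ α, ∑ β, ∑ γ, structConst v α β γ •
      (b γ * c α * c β) := by
    simp only [Q, j, c, b, Algebra.TensorProduct.tmul_mul_tmul, mul_one, one_mul, U]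
  rw [hQ]
  refine charge_sq j c b (structConst v) ?_ ?_ ?_ ?_ ?_ ?_ (structConst_antisymm v)
    (structConst_jacobi v)
  · intro α β
    simp only [c, Algebra.TensorProduct.tmul_mul_tmul, mul_one]
    rw [ghost_mul_ghost, TensorProduct.tmul_neg]
  · intro α β
    simp only [b, Algebra.TensorProduct.tmul_mul_tmul, mul_one]
    rw [antighost_mul_antighost, TensorProduct.tmul_neg]
  · intro α β
    simp only [b, c, Algebra.TensorProduct.tmul_mul_tmul, mul_one]
    rw [antighost_mul_ghost, TensorProduct.tmul_sub]
    split_ifs <;> simp [Algebra.TensorProduct.one_def]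
  · intro α β
    simp [j, c]
  · intro α β
    simp [j, b]
  · intro α β
    simp only [j, Algebra.TensorProduct.tmul_mul_tmul, mul_one]
    rw [← TensorProduct.sub_tmul]
    have h1 : (J v α - algebraMap ℂ U (chi α)) * (J v β - algebraMap ℂ U (chi β)) -
        (J v β - algebraMap ℂ U (chi β)) * (J v α - algebraMap ℂ U (chi α)) =
        J v α * J v β - J v β * J v α := by
      have e1 := Algebra.commutes (chi α) (J v β)
      have e2 := Algebra.commutes (chi β) (J v α)
      have e3 := Algebra.commutes (chi α) (algebraMap ℂ U (chi β))
      simp only [sub_mul, mul_sub, e1, e2, e3, U]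
      abel
    have h2 : J v α * J v β - J v β * J v α = ∑ γ, structConst v α β γ • J v γ := by
      have : J v α * J v β - J v β * J v α =
          UniversalEnvelopingAlgebra.ι ℂ ⁅tUp v α, tUp v β⁆ := by
        rw [LieHom.map_lie]; rfl
      rw [this, tUp_bracket]
      simp [J]
    have h3 : ∑ γ, structConst v α β γ • algebraMap ℂ U (chi γ) = 0 := by
      simp only [Algebra.smul_def, ← map_mul]
      rw [← map_sum, chi_structConst, map_zero]
    rw [h1, h2, ← sub_zero (∑ γ, structConst v α β γ • J v γ), ← h3, ← Finset.sum_sub_distrib,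
      TensorProduct.sum_tmul]
    refine Finset.sum_congr rfl fun γ _ => ?_
    rw [← smul_sub, TensorProduct.smul_tmul']

theorem OmegaDeg_mul {k l : ℤ} {X Y : Omega v} (hX : X ∈ OmegaDeg v k) (hY : Y ∈ OmegaDeg v l) :
    X * Y ∈ OmegaDeg v (k + l) := by
  have h := Submodule.mul_mem_mul hX hY
  rw [OmegaDeg, OmegaDeg, Submodule.span_mul_span] at h
  refine Submodule.span_mono ?_ h
  rintro _ ⟨_, ⟨u, w, hw, rfl⟩, _, ⟨u', w', hw', rfl⟩, rfl⟩
  refine ⟨u * u', w ++ w', ?_, ?_⟩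
  · rw [← hw, ← hw']
    simp [wordDeg]
  · simp [ghostWord, Algebra.TensorProduct.tmul_mul_tmul]

theorem Q_mem : Q v ∈ OmegaDeg v 1 := by
  refine Submodule.sub_mem _ (Submodule.sum_mem _ fun α _ => ?_) (Submodule.smul_mem _ _
    (Submodule.sum_mem _ fun α _ => Submodule.sum_mem _ fun β _ => Submodule.sum_mem _ fun γ _ =>
      Submodule.smul_mem _ _ ?_))
  · exact Submodule.subset_span ⟨J v α - algebraMap ℂ _ (chi α), [Sum.inl α], by simp [wordDeg],
      by simp [ghostWord]⟩
  · exact Submodule.subset_span ⟨1, [Sum.inr γ, Sum.inl α, Sum.inl β], by simp [wordDeg],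
      by simp [ghostWord, mul_assoc]⟩

theorem parity_of_mem {k : ℤ} {X : Omega v} (hX : X ∈ OmegaDeg v k) :
    parity v X = (Int.negOnePow k : ℤˣ) • X := by
  induction hX using Submodule.span_induction with
  | mem x h =>
    obtain ⟨u, w, rfl, rfl⟩ := h
    have h1 : CliffordAlgebra.involute (ghostWord v w) =
        (Int.negOnePow (wordDeg w) : ℤˣ) • ghostWord v w := by
      induction w with
      | nil => simp [ghostWord, wordDeg]
      | cons s w ih =>
        have e1 : ghostWord v (s :: w) = Sum.elim (ghost v) (antighost v) s * ghostWord v w := by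
          simp [ghostWord]
        have e2 : Int.negOnePow (wordDeg (s :: w)) = -Int.negOnePow (wordDeg w) := by
          have e3 : wordDeg (s :: w) = Sum.elim (fun _ => 1) (fun _ => -1) s + wordDeg w := by
            simp [wordDeg]
          rw [e3]
          rcases s with s | s <;> simp [Int.negOnePow_add]
        have e4 : CliffordAlgebra.involute (Sum.elim (ghost v) (antighost v) s) =
            -Sum.elim (ghost v) (antighost v) s := by
          rcases s with s | s <;> simp [ghost, antighost]
        rw [e1, e2, map_mul, ih, e4]
        rcases Int.units_eq_one_or (Int.negOnePow (wordDeg w)) with h | h <;>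
          simp [h, Units.smul_def]
    simp only [parity, Algebra.TensorProduct.map_tmul, AlgHom.id_apply, h1]
    rcases Int.units_eq_one_or (Int.negOnePow (wordDeg w)) with h | h <;>
      simp [h, Units.smul_def, TensorProduct.tmul_neg]
  | zero => simp
  | add x y _ _ hx hy => rw [map_add, hx, hy, smul_add]
  | smul a x _ hx =>
    rw [map_smul, hx]
    rcases Int.units_eq_one_or (Int.negOnePow k) with h | h <;> simp [h, Units.smul_def]

/-- On `Ω^k` the differential is `X ↦ Q X - (-1)^k X Q`. -/
theorem brst_of_mem {k : ℤ} {X : Omega v} (hX : X ∈ OmegaDeg v k) :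
    brst v X = Q v * X - (Int.negOnePow k : ℤˣ) • (X * Q v) := by
  change Q v * X - parity v X * Q v = _
  rw [parity_of_mem v hX]
  rcases Int.units_eq_one_or (Int.negOnePow k) with h | h <;> simp [h, Units.smul_def]

theorem brst_mem {k : ℤ} {X : Omega v} (hX : X ∈ OmegaDeg v k) :
    brst v X ∈ OmegaDeg v (k + 1) := by
  rw [brst_of_mem v hX]
  have h1 := OmegaDeg_mul v (Q_mem v) hX
  have h2 := OmegaDeg_mul v hX (Q_mem v)
  rw [add_comm] at h1
  refine Submodule.sub_mem _ h1 ?_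
  rcases Int.units_eq_one_or (Int.negOnePow k) with h | h
  · simpa [h] using h2
  · simpa [h, Units.smul_def] using h2

theorem brst_brst (X : Omega v) : brst v (brst v X) = 0 := by
  have hp : parity v (Q v) = -Q v := by
    rw [parity_of_mem v (Q_mem v)]
    simp [Units.smul_def]
  have hpp : parity v (parity v X) = X := by
    have : (parity v).comp (parity v) = AlgHom.id ℂ _ := by
      apply Algebra.TensorProduct.ext
      · ext; simp [parity]
      · ext <;> simp [parity]
    exact DFunLike.congr_fun this X
  change Q v * (Q v * X - parity v X * Q v) - parity v (Q v * X - parity v X * Q v) * Q v = 0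
  rw [map_sub, map_mul, map_mul, hp, hpp]
  have h := Q_mul_Q v
  have e : Q v * (Q v * X - parity v X * Q v) -
      (-Q v * parity v X - X * -Q v) * Q v = (Q v * Q v) * X - X * (Q v * Q v) := by
    noncomm_ring
  rw [e, h]
  simp

theorem numberOp_comm {k : ℤ} {X : Omega v} (hX : X ∈ OmegaDeg v k) :
    ((1 : UniversalEnvelopingAlgebra ℂ (SL n)) ⊗ₜ[ℂ] ∑ α, ghost v α * antighost v α) * X -
      X * ((1 : UniversalEnvelopingAlgebra ℂ (SL n)) ⊗ₜ[ℂ] ∑ α, ghost v α * antighost v α) =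
      (k : ℂ) • X := by
  set N := ∑ α, ghost v α * antighost v α with hN
  have hs : ∀ s : PosIdx μ ⊕ PosIdx μ, N * Sum.elim (ghost v) (antighost v) s -
      Sum.elim (ghost v) (antighost v) s * N = ((Sum.elim (fun _ => 1) (fun _ => -1) s : ℤ) : ℂ) •
        Sum.elim (ghost v) (antighost v) s := by
    rintro (β | β)
    · simp only [Sum.elim_inl, hN, Finset.sum_mul, Finset.mul_sum, ← Finset.sum_sub_distrib]
      have : ∀ α, ghost v α * antighost v α * ghost v β - ghost v β * (ghost v α * antighost v α) =
          if α = β then ghost v α else 0 := by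
        intro α
        rw [mul_assoc, antighost_mul_ghost, ← mul_assoc (ghost v β), ghost_mul_ghost v β α]
        split_ifs <;> noncomm_ring
      simp [this]
    · simp only [Sum.elim_inr, hN, Finset.sum_mul, Finset.mul_sum, ← Finset.sum_sub_distrib]
      have : ∀ α, ghost v α * antighost v α * antighost v β -
          antighost v β * (ghost v α * antighost v α) =
          if β = α then -antighost v α else 0 := by
        intro α
        rw [mul_assoc, antighost_mul_antighost v α β, ← mul_assoc (antighost v β),
          antighost_mul_ghost v β α]
        split_ifs <;> noncomm_ring
      simp [this]
  induction hX using Submodule.span_induction with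
  | mem x h =>
    obtain ⟨u, w, rfl, rfl⟩ := h
    have h1 : N * ghostWord v w - ghostWord v w * N = (wordDeg w : ℂ) • ghostWord v w := by
      induction w with
      | nil => simp [ghostWord, wordDeg]
      | cons s w ih =>
        have e1 : ghostWord v (s :: w) = Sum.elim (ghost v) (antighost v) s * ghostWord v w := by
          simp [ghostWord]
        have e3 : wordDeg (s :: w) = Sum.elim (fun _ => 1) (fun _ => -1) s + wordDeg w := by
          simp [wordDeg]
        rw [e1, e3, Int.cast_add, add_smul, ← smul_mul_assoc, ← mul_smul_comm, ← ih, ← hs]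
        noncomm_ring
    rw [Algebra.TensorProduct.tmul_mul_tmul, Algebra.TensorProduct.tmul_mul_tmul, one_mul, mul_one,
      ← TensorProduct.tmul_sub, h1, TensorProduct.tmul_smul]
  | zero => simp
  | add x y _ _ hx hy => rw [smul_add, ← hx, ← hy]; noncomm_ring
  | smul a x _ hx => rw [smul_comm, ← hx, mul_smul_comm, smul_mul_assoc, smul_sub]

/-- `Ω` is the direct sum of the `Ω^k`. -/
theorem OmegaDeg_isInternal : DirectSum.IsInternal (OmegaDeg v) := by
  rw [DirectSum.isInternal_submodule_iff_iSupIndep_and_iSup_eq_top]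
  constructor
  · set N := (1 : UniversalEnvelopingAlgebra ℂ (SL n)) ⊗ₜ[ℂ] ∑ α, ghost v α * antighost v α with hN
    let D : Module.End ℂ (Omega v) := LinearMap.mulLeft ℂ N - LinearMap.mulRight ℂ N
    have h1 : iSupIndep fun k : ℤ => D.eigenspace (k : ℂ) :=
      (Module.End.eigenspaces_iSupIndep D).comp Int.cast_injective
    refine h1.mono fun k X hX => ?_
    rw [Module.End.mem_eigenspace_iff]
    exact numberOp_comm v hX
  · set T := ⨆ k, OmegaDeg v k with hT
    have hmul : ∀ k (X Y : Omega v), X ∈ OmegaDeg v k → Y ∈ T → X * Y ∈ T := by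
      intro k X Y hX hY
      induction hY using Submodule.iSup_induction' with
      | mem l Y hY => exact Submodule.mem_iSup_of_mem _ (OmegaDeg_mul v hX hY)
      | zero => simp
      | add Y Z _ _ hY hZ => rw [mul_add]; exact T.add_mem hY hZ
    have hc : ∀ x : gPlus v, (1 : UniversalEnvelopingAlgebra ℂ (SL n)) ⊗ₜ[ℂ]
        (CliffordAlgebra.ι _ (0, x) : Ghosts v) ∈ OmegaDeg v 1 := by
      rintro ⟨x, hx⟩
      let F : gPlus v →ₗ[ℂ] Omega v := (TensorProduct.mk ℂ _ (Ghosts v) 1).comp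
        ((CliffordAlgebra.ι _).comp (LinearMap.inr ℂ (Module.Dual ℂ (gPlus v)) (gPlus v)))
      have hF : ∀ x hx, F ⟨x, hx⟩ ∈ OmegaDeg v 1 := by
        intro x hx
        induction hx using Submodule.span_induction with
        | mem x h =>
          obtain ⟨α, rfl⟩ := h
          exact Submodule.subset_span ⟨1, [Sum.inl α], by simp [wordDeg],
            by simp [ghostWord, F, ghost]⟩
        | zero => exact (map_zero F).symm ▸ Submodule.zero_mem _
        | add x y hx hy h1 h2 => exact (map_add F ⟨x, hx⟩ ⟨y, hy⟩).symm ▸ Submodule.add_mem _ h1 h2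
        | smul a x hx h1 => exact (map_smul F a ⟨x, hx⟩).symm ▸ Submodule.smul_mem _ a h1
      exact hF x hx
    have hb : ∀ φ : Module.Dual ℂ (gPlus v), (1 : UniversalEnvelopingAlgebra ℂ (SL n)) ⊗ₜ[ℂ]
        (CliffordAlgebra.ι _ (φ, 0) : Ghosts v) ∈ OmegaDeg v (-1) := by
      intro φ
      let t : PosIdx μ → gPlus v := fun α => ⟨tLow v α, Submodule.subset_span ⟨α, rfl⟩⟩
      have hφ : φ = ∑ α, φ (t α) • dualVec v α := by
        refine LinearMap.ext fun x => ?_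
        obtain ⟨x, hx⟩ := x
        let G : Module.Dual ℂ (gPlus v) := φ - ∑ α, φ (t α) • dualVec v α
        have hG : ∀ x hx, G ⟨x, hx⟩ = 0 := by
          intro x hx
          induction hx using Submodule.span_induction with
          | mem x h =>
            obtain ⟨α, rfl⟩ := h
            have : ∀ β, dualVec v β (t α) = if β = α then 1 else 0 :=
              fun β => tLow_tUp_trace v β α
            change G (t α) = 0
            simp [G, this]
          | zero => exact map_zero G
          | add x y hx hy h1 h2 =>
            exact (map_add G ⟨x, hx⟩ ⟨y, hy⟩).trans (by rw [h1, h2, add_zero])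
          | smul a x hx h1 => exact (map_smul G a ⟨x, hx⟩).trans (by rw [h1, smul_zero])
        exact sub_eq_zero.mp (hG x hx)
      let F : Module.Dual ℂ (gPlus v) →ₗ[ℂ] Omega v := (TensorProduct.mk ℂ _ (Ghosts v) 1).comp
        ((CliffordAlgebra.ι _).comp (LinearMap.inl ℂ (Module.Dual ℂ (gPlus v)) (gPlus v)))
      change F φ ∈ _
      rw [hφ, map_sum]
      refine Submodule.sum_mem _ fun α _ => ?_
      rw [map_smul]
      exact Submodule.smul_mem _ _ (Submodule.subset_span ⟨1, [Sum.inr α], by simp [wordDeg],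
            by simp [ghostWord, F, antighost]⟩)
    have hx : ∀ (x : Ghosts v) u, u ⊗ₜ[ℂ] x ∈ T := by
      intro x
      induction x using CliffordAlgebra.left_induction with
      | algebraMap r =>
        intro u
        refine Submodule.mem_iSup_of_mem 0 ?_
        rw [Algebra.algebraMap_eq_smul_one, TensorProduct.tmul_smul]
        exact Submodule.smul_mem _ _ (Submodule.subset_span ⟨u, [], by simp [wordDeg],
          by simp [ghostWord]⟩)
      | add x y hx hy => intro u; rw [TensorProduct.tmul_add]; exact T.add_mem (hx u) (hy u)
      | ι_mul x m hx =>
        intro u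
        obtain ⟨φ, y⟩ := m
        have e : u ⊗ₜ[ℂ] (CliffordAlgebra.ι _ (φ, y) * x) =
            ((1 : UniversalEnvelopingAlgebra ℂ (SL n)) ⊗ₜ[ℂ]
              (CliffordAlgebra.ι _ (φ, 0) : Ghosts v)) * (u ⊗ₜ[ℂ] x) +
            ((1 : UniversalEnvelopingAlgebra ℂ (SL n)) ⊗ₜ[ℂ]
              (CliffordAlgebra.ι _ (0, y) : Ghosts v)) * (u ⊗ₜ[ℂ] x) := by
          rw [← add_mul, ← TensorProduct.tmul_add, ← map_add, Algebra.TensorProduct.tmul_mul_tmul]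
          simp
        rw [e]
        exact T.add_mem (hmul _ _ _ (hb φ) (hx u)) (hmul _ _ _ (hc y) (hx u))
    rw [eq_top_iff]
    rintro X -
    induction X using TensorProduct.induction_on with
    | zero => exact T.zero_mem
    | tmul u x => exact hx x u
    | add X Y hX hY => exact T.add_mem hX hY

/-- The cocycles of degree `k`. -/
def cocycles (k : ℤ) : Submodule ℂ (Omega v) := OmegaDeg v k ⊓ LinearMap.ker (brst v)

/-- The coboundaries of degree `k`. -/
def coboundaries (k : ℤ) : Submodule ℂ (Omega v) := (OmegaDeg v (k - 1)).map (brst v)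

theorem coboundaries_le_cocycles (k : ℤ) : coboundaries v k ≤ cocycles v k := by
  rintro _ ⟨X, hX, rfl⟩
  refine ⟨?_, brst_brst v X⟩
  have := brst_mem v hX
  rwa [sub_add_cancel] at this

/-- The BRST cohomology `H^k(Ω; d)`. -/
abbrev BRSTCohomology (k : ℤ) : Type :=
  cocycles v k ⧸ (coboundaries v k).submoduleOf (cocycles v k)

end Differential

end FiniteW

end

noncomputable section

namespace FiniteW

set_option linter.unusedSectionVars false

open LieAlgebra
open scoped TensorProduct

attribute [local instance 100] LieRing.ofAssociativeRing

/-! ### Filtered algebras and ordered monomials in noncommuting letters. -/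

section Filtration

/-! Grade `sl_n` by columns: the matrix unit `E_{xy}` has as degree the column of `y` minus that of
`x`. Then `t_+` has degree `1`, the `t^α` span the negative part, the `t_α` span the positive part,
and the character in the charge is the trace against `t_+`. In place of the currents `J(x)` use the
total currents `Ĵ(x) = J(x) + ∑ b([x, t^β]) c_β`, where `b(y)` is the antighost of the negative part
of `y`. They satisfy `[Q, b^γ] = Ĵ(t^γ) - χ(t^γ)` (`charge_antighost`), while `[Q, Ĵ(x)]` is the sum
over `β` of `Ĵ` of the nonnegative part of `[t^β, x]`, plus `χ([t^β, x])`, all times `c_β`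
(`charge_totalCurrent`).

A suitable weight on the letters (`currentWeight`) makes every commutator and every quadratic term
in these formulas of lower order. What remains to leading order is `b^γ ↦ Ĵ(t^γ) ↦ 0` and `Ĵ(x) ↦ ∑
Tr(t_+ [t^β, x]) c_β`. By invariance of the trace, the latter sees only `[x, t_+]`. Bracketing with
`t_+` maps the part of nonnegative degree onto the part of positive degree
(`exists_raising_preimage`), so there is a homogeneous basis made of the `t^γ`, of vectors `x_α`
with `Ĵ(x_α) ↦ c_α ↦ 0`, and of the homogeneous elements of nonnegative degree that commute with
`t_+`, which map to `0`. The letters outside the last group cancel in pairs: the leading complex is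
a Koszul complex, contracted by the usual homotopy divided by the number of paired letters
(`exists_gradedContraction`), and only the polynomials in the centralizer variables survive, in
degree `0`.

Passing from the leading differential to the true one is homological perturbation along an
exhaustive filtration that vanishes in negative degrees (`exact_of_ne_zero`, `cohomology_zero`); it
takes the place of a spectral sequence. To carry the model over to `Ω` one needs that ordered
monomials in the total currents form a basis of `Ω` over the Clifford algebra. This follows from the
Poincaré–Birkhoff–Witt theorem (`pbwMap_injective`), since a total current is a current plus a term
in the Clifford algebra (`monomialMap_bijective`). The Clifford algebra itself is treated as an
exterior algebra by normal ordering (`ghostFermions`).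

Finally, the number of surviving variables is the dimension of the centralizer of `t_-`
(`finrank_adKer`), so that a second use of Poincaré–Birkhoff–Witt identifies the polynomial ring
with the enveloping algebra of that centralizer as a vector space. -/

/-- A linear map that is the identity up to terms of lower filtration degree is bijective. -/
theorem bijective_of_unipotent {V : Type*} [AddCommGroup V] [Module ℂ V] {F : ℤ → Submodule ℂ V}
    (hneg : F (-1) = ⊥) (htop : ∀ x, ∃ p : ℕ, x ∈ F p) (φ : V →ₗ[ℂ] V)
    (hφ : ∀ p x, x ∈ F p → φ x - x ∈ F (p - 1)) : Function.Bijective φ := by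
  constructor
  · rw [injective_iff_map_eq_zero]
    intro x hx
    have h : ∀ p : ℕ, x ∈ F ((p : ℤ) - 1) → x = 0 := by
      intro p
      induction p with
      | zero => intro h; simpa [hneg] using h
      | succ p ih =>
        intro h
        apply ih
        have := hφ _ _ h
        rw [hx, zero_sub, neg_mem_iff] at this
        convert this using 2
        push_cast
        ring
    obtain ⟨p, hp⟩ := htop x
    exact h (p + 1) (by simpa using hp)
  · have h : ∀ p : ℕ, ∀ y, y ∈ F ((p : ℤ) - 1) → ∃ x, φ x = y := by
      intro p
      induction p with
      | zero => intro y h; exact ⟨0, by simp_all⟩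
      | succ p ih =>
        intro y h
        obtain ⟨x, hx⟩ := ih (φ y - y) (by convert hφ _ _ h using 2; push_cast; ring)
        exact ⟨y - x, by rw [map_sub, hx]; abel⟩
    intro y
    obtain ⟨p, hp⟩ := htop y
    exact h (p + 1) y (by simpa using hp)

section ListMonomialDef

variable {A : Type*} [Ring A] {I : Type*}

/-- The product of the powers `x i ^ a i`, in the order of the list `l`. -/
def listMonomial (x : I → A) (l : List I) (a : I → ℕ) : A := (l.map fun i => x i ^ a i).prod

@[simp] theorem listMonomial_nil (x : I → A) (a : I → ℕ) : listMonomial x [] a = 1 := rfl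

@[simp] theorem listMonomial_cons (x : I → A) (i : I) (l : List I) (a : I → ℕ) :
    listMonomial x (i :: l) a = x i ^ a i * listMonomial x l a := by simp [listMonomial]

theorem listMonomial_congr (x : I → A) (l : List I) {a b : I → ℕ} (h : ∀ i ∈ l, a i = b i) :
    listMonomial x l a = listMonomial x l b := by
  unfold listMonomial
  congr 1
  exact List.map_congr_left fun i hi => by rw [h i hi]

/-- The ordered monomial with exponent `a`, for a fixed order of `I`. -/
def orderedMonomial [Fintype I] (x : I → A) (a : I →₀ ℕ) : A :=
  listMonomial x (Finset.univ : Finset I).toList a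

@[simp] theorem orderedMonomial_zero [Fintype I] (x : I → A) : orderedMonomial x 0 = 1 := by
  unfold orderedMonomial listMonomial
  simp

end ListMonomialDef

section ExpWeight

variable {I : Type*}

/-- The weight of the exponent `a`. -/
def expWeight [Fintype I] (w : I → ℤ) (a : I →₀ ℕ) : ℤ := ∑ i, a i * w i

theorem expWeight_add_single [Fintype I] [DecidableEq I] (w : I → ℤ) (a : I →₀ ℕ) (i : I) :
    expWeight w (a + Finsupp.single i 1) = expWeight w a + w i := by
  simp [expWeight, add_mul, Finset.sum_add_distrib, Finsupp.single_apply]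

theorem expWeight_sub_single [Fintype I] [DecidableEq I] (w : I → ℤ) {a : I →₀ ℕ} {i : I}
    (h : a i ≠ 0) : expWeight w (a - Finsupp.single i 1) = expWeight w a - w i := by
  have : a = (a - Finsupp.single i 1) + Finsupp.single i 1 := by
    rw [tsub_add_cancel_of_le]
    simpa using Nat.one_le_iff_ne_zero.mpr h
  nth_rewrite 2 [this]
  rw [expWeight_add_single]
  ring

theorem sum_toList_expWeight [Fintype I] (w : I → ℤ) (a : I →₀ ℕ) :
    ((Finset.univ : Finset I).toList.map fun i => (a i : ℤ) * w i).sum = expWeight w a :=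
  Finset.sum_map_toList _ _

end ExpWeight

variable {A : Type*} [Ring A] [Algebra ℂ A]

/-- An increasing ring filtration indexed by the integers. -/
structure IsRingFiltration (F : ℤ → Submodule ℂ A) : Prop where
  mono : Monotone F
  one_mem : (1 : A) ∈ F 0
  mul_mem : ∀ {p q : ℤ} {x y : A}, x ∈ F p → y ∈ F q → x * y ∈ F (p + q)

namespace IsRingFiltration

variable {F : ℤ → Submodule ℂ A} (hF : IsRingFiltration F)
include hF

theorem mul_mem_of_le {p q r : ℤ} (h : p + q ≤ r) {x y : A} (hx : x ∈ F p) (hy : y ∈ F q) :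
    x * y ∈ F r := hF.mono h (hF.mul_mem hx hy)

theorem pow_mem {p : ℤ} {x : A} (hx : x ∈ F p) (k : ℕ) : x ^ k ∈ F (k * p) := by
  induction k with
  | zero => simpa using hF.one_mem
  | succ k ih =>
    rw [pow_succ]
    exact hF.mul_mem_of_le (by push_cast; linarith) ih hx

/-- Commutation with `x` is a derivation, so a drop of one unit on letters passes to powers and to
ordered monomials. The number `r` plays the role of the weight of `x`. -/
theorem commutator_mul_mem {p q r : ℤ} {x y z : A} (hy : y ∈ F p) (hz : z ∈ F q)
    (hxy : x * y - y * x ∈ F (p + r - 1)) (hxz : x * z - z * x ∈ F (q + r - 1)) :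
    x * (y * z) - y * z * x ∈ F (p + q + r - 1) := by
  have e : x * (y * z) - y * z * x = (x * y - y * x) * z + y * (x * z - z * x) := by noncomm_ring
  rw [e]
  exact add_mem (hF.mul_mem_of_le (by linarith) hxy hz) (hF.mul_mem_of_le (by linarith) hy hxz)

theorem commutator_pow_mem {p r : ℤ} {x y : A} (hy : y ∈ F p)
    (hxy : x * y - y * x ∈ F (p + r - 1)) (k : ℕ) :
    x * y ^ k - y ^ k * x ∈ F (k * p + r - 1) := by
  induction k with
  | zero => simp
  | succ k ih =>
    rw [pow_succ]
    convert hF.commutator_mul_mem (hF.pow_mem hy k) hy ih hxy using 2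
    push_cast
    ring

end IsRingFiltration

variable {I : Type*}

section ListMonomial

variable {F : ℤ → Submodule ℂ A} (hF : IsRingFiltration F) {x : I → A} {w : I → ℤ}
  (hx : ∀ i, x i ∈ F (w i))
include hF hx

theorem listMonomial_mem (l : List I) (a : I → ℕ) :
    listMonomial x l a ∈ F (l.map fun i => a i * w i).sum := by
  induction l with
  | nil => simpa using hF.one_mem
  | cons i l ih =>
    simp only [listMonomial_cons, List.map_cons, List.sum_cons]
    exact hF.mul_mem (hF.pow_mem (hx i) _) ih

theorem commutator_listMonomial_mem {r : ℤ} {y : A}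
    (hy : ∀ i, y * x i - x i * y ∈ F (w i + r - 1)) (l : List I) (a : I → ℕ) :
    y * listMonomial x l a - listMonomial x l a * y ∈
      F ((l.map fun i => a i * w i).sum + r - 1) := by
  induction l with
  | nil => simp
  | cons i l ih =>
    simp only [listMonomial_cons, List.map_cons, List.sum_cons]
    exact hF.commutator_mul_mem (hF.pow_mem (hx i) _) (listMonomial_mem hF hx l a)
      (hF.commutator_pow_mem (hx i) (hy i) _) ih

/-- The letter is moved right to its own power, and each power that it passes costs a commutator of
lower weight. Since `l` has no repetitions, the raised exponent shows up only once. -/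
theorem mul_listMonomial_sub_mem [DecidableEq I]
    (hc : ∀ i j, x i * x j - x j * x i ∈ F (w i + w j - 1)) (l : List I) (hl : l.Nodup)
    (i : I) (hi : i ∈ l) (a : I → ℕ) :
    x i * listMonomial x l a - listMonomial x l (a + Pi.single i 1) ∈
      F ((l.map fun i => a i * w i).sum + w i - 1) := by
  induction l with
  | nil => simp at hi
  | cons j l ih =>
    rw [List.nodup_cons] at hl
    simp only [listMonomial_cons, List.map_cons, List.sum_cons]
    by_cases hij : i = j
    · subst hij
      rw [listMonomial_congr x l (a := a + Pi.single i 1) (b := a)]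
      · simp [pow_succ', mul_assoc]
      · intro k hk
        have : k ≠ i := fun h => hl.1 (h ▸ hk)
        simp [this]
    · have hil : i ∈ l := (List.mem_cons.mp hi).resolve_left hij
      have e : x i * (x j ^ a j * listMonomial x l a) -
          x j ^ (a + Pi.single i 1 : I → ℕ) j * listMonomial x l (a + Pi.single i 1) =
          (x i * x j ^ a j - x j ^ a j * x i) * listMonomial x l a +
          x j ^ a j * (x i * listMonomial x l a - listMonomial x l (a + Pi.single i 1)) := by
        have : (a + Pi.single i 1 : I → ℕ) j = a j := by simp [Ne.symm hij]
        rw [this]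
        noncomm_ring
      rw [e]
      have hji : x i * x j - x j * x i ∈ F (w j + w i - 1) := by
        rw [add_comm (w j)]; exact hc i j
      refine add_mem (hF.mul_mem_of_le ?_ (hF.commutator_pow_mem (r := w i) (hx j) hji _)
        (listMonomial_mem hF hx l a)) (hF.mul_mem_of_le ?_ (hF.pow_mem (hx j) _) (ih hl.2 hil))
      · linarith
      · linarith

/-- Letters are exchanged one at a time, and every exchange leaves a factor `x i - y i` of lower
filtration. -/
theorem listMonomial_sub_mem {y : I → A} (hy : ∀ i, y i ∈ F (w i))
    (hxy : ∀ i, x i - y i ∈ F (w i - 1)) (l : List I) (a : I → ℕ) :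
    listMonomial x l a - listMonomial y l a ∈ F ((l.map fun i => a i * w i).sum - 1) := by
  have hp : ∀ i (k : ℕ), x i ^ k - y i ^ k ∈ F (k * w i - 1) := by
    intro i k
    induction k with
    | zero => simp
    | succ k ih =>
      have e : x i ^ (k + 1) - y i ^ (k + 1) =
          (x i ^ k - y i ^ k) * x i + y i ^ k * (x i - y i) := by
        rw [pow_succ, pow_succ]; noncomm_ring
      rw [e]
      refine add_mem (hF.mul_mem_of_le ?_ ih (hx i)) (hF.mul_mem_of_le ?_
        (hF.pow_mem (hy i) k) (hxy i)) <;> push_cast <;> linarith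
  induction l with
  | nil => simp
  | cons i l ih =>
    simp only [listMonomial_cons, List.map_cons, List.sum_cons]
    have e : x i ^ a i * listMonomial x l a - y i ^ a i * listMonomial y l a =
        (x i ^ a i - y i ^ a i) * listMonomial x l a +
        y i ^ a i * (listMonomial x l a - listMonomial y l a) := by noncomm_ring
    rw [e]
    refine add_mem (hF.mul_mem_of_le ?_ (hp i _) (listMonomial_mem hF hx l a))
      (hF.mul_mem_of_le ?_ (hF.pow_mem (hy i) _) ih) <;> linarith

end ListMonomial

section OrderedMonomial

variable [Fintype I] {F : ℤ → Submodule ℂ A} (hF : IsRingFiltration F) {x : I → A} {w : I → ℤ}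
  (hx : ∀ i, x i ∈ F (w i))

include hF hx

theorem orderedMonomial_mem (a : I →₀ ℕ) : orderedMonomial x a ∈ F (expWeight w a) := by
  rw [← sum_toList_expWeight]
  exact listMonomial_mem hF hx _ _

theorem commutator_orderedMonomial_mem {r : ℤ} {y : A}
    (hy : ∀ i, y * x i - x i * y ∈ F (w i + r - 1)) (a : I →₀ ℕ) :
    y * orderedMonomial x a - orderedMonomial x a * y ∈ F (expWeight w a + r - 1) := by
  rw [← sum_toList_expWeight]
  exact commutator_listMonomial_mem hF hx hy _ _

theorem mul_orderedMonomial_sub_mem [DecidableEq I]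
    (hc : ∀ i j, x i * x j - x j * x i ∈ F (w i + w j - 1)) (i : I) (a : I →₀ ℕ) :
    x i * orderedMonomial x a - orderedMonomial x (a + Finsupp.single i 1) ∈
      F (expWeight w a + w i - 1) := by
  rw [← sum_toList_expWeight]
  have e : orderedMonomial x (a + Finsupp.single i 1) =
      listMonomial x (Finset.univ : Finset I).toList (⇑a + Pi.single i 1) :=
    listMonomial_congr x _ fun j _ => by simp [Finsupp.single_apply, Pi.single_apply, eq_comm]
  rw [e]
  exact mul_listMonomial_sub_mem hF hx hc _ (Finset.nodup_toList Finset.univ) i (by simp) a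

theorem orderedMonomial_sub_mem {y : I → A} (hy : ∀ i, y i ∈ F (w i))
    (hxy : ∀ i, x i - y i ∈ F (w i - 1)) (a : I →₀ ℕ) :
    orderedMonomial x a - orderedMonomial y a ∈ F (expWeight w a - 1) := by
  rw [← sum_toList_expWeight]
  exact listMonomial_sub_mem hF hx hy hxy _ _

end OrderedMonomial

/-- The filtration by words in the letters `x j` of weight `w j`. -/
def wordFiltration {J : Type*} (x : J → A) (w : J → ℤ) (p : ℤ) : Submodule ℂ A :=
  Submodule.span ℂ {y | ∃ l : List J, (l.map w).sum ≤ p ∧ y = (l.map x).prod}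

section Words

variable {J : Type*} (x : J → A) (w : J → ℤ)

theorem isRingFiltration_wordFiltration : IsRingFiltration (wordFiltration x w) where
  mono p q h := Submodule.span_mono fun y ⟨l, hl, e⟩ => ⟨l, hl.trans h, e⟩
  one_mem := Submodule.subset_span ⟨[], by simp, by simp⟩
  mul_mem {p q y z} hy hz := by
    have h := Submodule.mul_mem_mul hy hz
    rw [wordFiltration, wordFiltration, Submodule.span_mul_span] at h
    refine Submodule.span_mono ?_ h
    rintro _ ⟨_, ⟨l, hl, rfl⟩, _, ⟨l', hl', rfl⟩, rfl⟩
    exact ⟨l ++ l', by simpa using add_le_add hl hl', by simp⟩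

theorem letter_mem_wordFiltration (j : J) : x j ∈ wordFiltration x w (w j) :=
  Submodule.subset_span ⟨[j], by simp, by simp⟩

theorem wordFiltration_of_neg (hw : ∀ j, 0 ≤ w j) {p : ℤ} (hp : p < 0) :
    wordFiltration x w p = ⊥ := by
  rw [wordFiltration, Submodule.span_eq_bot]
  rintro _ ⟨l, hl, -⟩
  have : 0 ≤ (l.map w).sum := List.sum_nonneg (by simpa using fun j _ => hw j)
  omega

/-- To bound the filtration by words it is enough to bound products with letters up to words of
lower weight. -/
theorem wordFiltration_le (hw : ∀ j, 0 ≤ w j) {G : ℤ → Submodule ℂ A} (hG : Monotone G)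
    (h1 : (1 : A) ∈ G 0)
    (hmul : ∀ j p y, y ∈ G p → x j * y ∈ G (p + w j) ⊔ wordFiltration x w (p + w j - 1)) (p : ℤ) :
    wordFiltration x w p ≤ G p := by
  -- The outer induction disposes of the words of lower weight that `hmul` produces. The inner one
  -- has to be on the length of the word, since a letter of weight `0` does not lower `p`.
  have key : ∀ n : ℕ, ∀ p : ℤ, p < n → wordFiltration x w p ≤ G p := by
    intro n
    induction n with
    | zero => intro p hp; rw [wordFiltration_of_neg x w hw (by simpa using hp)]; exact bot_le
    | succ n ih =>
      intro p hp
      rw [wordFiltration, Submodule.span_le]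
      rintro _ ⟨l, hl, rfl⟩
      induction l generalizing p with
      | nil => exact hG (by simpa using hl) (by simpa using h1)
      | cons j l ihl =>
        rw [List.map_cons, List.sum_cons] at hl
        rw [List.map_cons, List.prod_cons]
        have h2 := hmul j _ _ (ihl (p - w j) (by have := hw j; omega) (by omega))
        rw [sub_add_cancel] at h2
        exact sup_le le_rfl ((ih _ (by push_cast at hp; omega)).trans (hG (by omega))) h2
  exact key (p + 1).toNat p (by omega)

theorem exists_mem_wordFiltration (h : ∀ y : A, y ∈ Algebra.adjoin ℂ (Set.range x))
    (y : A) : ∃ p : ℕ, y ∈ wordFiltration x w p := by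
  have hF := isRingFiltration_wordFiltration x w
  induction h y using Algebra.adjoin_induction with
  | mem y hy =>
    obtain ⟨j, rfl⟩ := hy
    exact ⟨(w j).toNat, hF.mono (Int.self_le_toNat _) (letter_mem_wordFiltration x w j)⟩
  | algebraMap r =>
    refine ⟨0, ?_⟩
    rw [Algebra.algebraMap_eq_smul_one]
    exact Submodule.smul_mem _ _ hF.one_mem
  | add y z _ _ hy hz =>
    obtain ⟨p, hp⟩ := hy
    obtain ⟨q, hq⟩ := hz
    exact ⟨p + q, add_mem (hF.mono (by omega) hp) (hF.mono (by omega) hq)⟩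
  | mul y z _ _ hy hz =>
    obtain ⟨p, hp⟩ := hy
    obtain ⟨q, hq⟩ := hz
    exact ⟨p + q, by push_cast; exact hF.mul_mem hp hq⟩

end Words

end Filtration

/-! ### The Poincaré–Birkhoff–Witt theorem for Lie algebras of matrices. -/

section PBW

open MvPolynomial

theorem derivation_mem_pow {σ : Type*} (D : Derivation ℂ (MvPolynomial σ ℂ) (MvPolynomial σ ℂ))
    (I : Ideal (MvPolynomial σ ℂ)) (k : ℕ) {f : MvPolynomial σ ℂ}
    (hf : f ∈ I ^ (k + 1)) : D f ∈ I ^ k := by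
  induction k generalizing f with
  | zero => simp
  | succ k ih =>
    rw [pow_succ] at hf
    induction hf using Submodule.mul_induction_on' with
    | mem_mul_mem a ha b hb =>
      rw [D.leibniz, smul_eq_mul, smul_eq_mul]
      refine add_mem (Ideal.mul_mem_right _ _ ha) ?_
      rw [pow_succ']
      exact Ideal.mul_mem_mul hb (ih ha)
    | add a _ b _ ha hb => rw [map_add]; exact add_mem ha hb

section FormalVectorField

variable {m : Type*} [Fintype m]

/-- The left-invariant vector field of the matrix `B`, as a derivation of the polynomial functions
of a square matrix. -/
def matrixDerivation (B : Matrix m m ℂ) :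
    Derivation ℂ (MvPolynomial (m × m) ℂ) (MvPolynomial (m × m) ℂ) :=
  mkDerivation ℂ fun p => ∑ k, B k p.2 • X (p.1, k)

theorem matrixDerivation_X (B : Matrix m m ℂ) (i j : m) :
    matrixDerivation B (X (i, j)) = ∑ k, B k j • X (i, k) := by
  simp [matrixDerivation, mkDerivation_X]

variable [DecidableEq m]

/-- The Lie algebra morphism from matrices to operators on polynomial functions. -/
def matrixAction : Matrix m m ℂ →ₗ⁅ℂ⁆ Module.End ℂ (MvPolynomial (m × m) ℂ) where
  toFun B := (matrixDerivation B).toLinearMap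
  map_add' B C := by
    have : matrixDerivation (B + C) = matrixDerivation B + matrixDerivation C := by
      apply derivation_ext
      rintro ⟨i, j⟩
      simp [matrixDerivation_X, add_smul, Finset.sum_add_distrib]
    rw [this]; rfl
  map_smul' r B := by
    have : matrixDerivation (r • B) = r • matrixDerivation B := by
      apply derivation_ext
      rintro ⟨i, j⟩
      simp [matrixDerivation_X, mul_smul, Finset.smul_sum]
    rw [this]; rfl
  map_lie' {B C} := by
    have : matrixDerivation ⁅B, C⁆ = ⁅matrixDerivation B, matrixDerivation C⁆ := by
      apply derivation_ext
      rintro ⟨i, j⟩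
      simp only [Derivation.commutator_apply, matrixDerivation_X, map_sum, Derivation.map_smul,
        LieRing.of_associative_ring_bracket, Matrix.sub_apply, Matrix.mul_apply, sub_smul,
        Finset.sum_sub_distrib, Finset.sum_smul, Finset.smul_sum, smul_smul]
      congr 1
      · rw [Finset.sum_comm]
        exact Finset.sum_congr rfl fun k _ => Finset.sum_congr rfl fun l _ => by rw [mul_comm]
      · rw [Finset.sum_comm]
        exact Finset.sum_congr rfl fun k _ => Finset.sum_congr rfl fun l _ => by rw [mul_comm]
    rw [this]; rfl

/-- Evaluation of a polynomial function at the identity matrix. -/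
def evalOne : MvPolynomial (m × m) ℂ →ₐ[ℂ] ℂ := aeval fun p => (1 : Matrix m m ℂ) p.1 p.2

/-- The linear function `g`, normalized to vanish at the identity matrix. -/
def linearFunction (g : Matrix m m ℂ →ₗ[ℂ] ℂ) : MvPolynomial (m × m) ℂ :=
  ∑ i, ∑ j, g (Matrix.single i j 1) • (X (i, j) - C ((1 : Matrix m m ℂ) i j))

theorem evalOne_linearFunction (g : Matrix m m ℂ →ₗ[ℂ] ℂ) : evalOne (linearFunction g) = 0 := by
  simp [linearFunction, evalOne, map_sum]

theorem evalOne_matrixDerivation (g : Matrix m m ℂ →ₗ[ℂ] ℂ) (B : Matrix m m ℂ) :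
    evalOne (matrixDerivation B (linearFunction g)) = g B := by
  nth_rewrite 2 [Matrix.matrix_eq_sum_single B]
  simp only [linearFunction, map_sum, Derivation.map_smul, map_sub, matrixDerivation_X,
    map_smul, derivation_C, sub_zero, evalOne, aeval_X, Matrix.one_apply]
  refine Finset.sum_congr rfl fun i _ => Finset.sum_congr rfl fun j _ => ?_
  have : Matrix.single i j (B i j) = B i j • Matrix.single i j (1 : ℂ) := by
    simp [Matrix.smul_single]
  rw [this, map_smul]
  simp [mul_comm]

variable {I : Type*}

/-- Each letter acts as a derivation and costs at most one order of vanishing at the identity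
matrix. A term that vanishes to an order exceeding the number of letters still to be applied can
therefore be dropped. -/
theorem word_mem_ker_pow (B : I → Matrix m m ℂ) (l : List I) (k : ℕ)
    {f : MvPolynomial (m × m) ℂ} (hf : f ∈ RingHom.ker (evalOne (m := m)) ^ (l.length + k)) :
    (l.map fun i => (matrixAction (B i) : Module.End ℂ _)).prod f ∈
      RingHom.ker (evalOne (m := m)) ^ k := by
  induction l generalizing k with
  | nil => simpa using hf
  | cons i l ih =>
    rw [List.map_cons, List.prod_cons, Module.End.mul_apply]
    refine derivation_mem_pow (matrixDerivation (B i)) _ _ (ih (k + 1) ?_)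
    convert hf using 2
    simp
    ring

/-- The rightmost letter turns the power `k + 1` of the linear function into `(k + 1) g (B i)` times
its `k`-th power, up to an error vanishing to order `k + 1`, which the remaining `k` letters cannot
detect. The order of the letters drops out of the result, so that noncommutative words are seen as
commutative monomials. -/
theorem evalOne_word_pow (B : I → Matrix m m ℂ) (g : Matrix m m ℂ →ₗ[ℂ] ℂ) (l : List I) :
    evalOne ((l.map fun i => (matrixAction (B i) : Module.End ℂ _)).prod
      (linearFunction g ^ l.length)) = (l.length.factorial : ℂ) * (l.map fun i => g (B i)).prod := by
  have hg : linearFunction g ∈ RingHom.ker (evalOne (m := m)) := evalOne_linearFunction g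
  induction l using List.reverseRecOn with
  | nil => simp
  | append_singleton l i ih =>
    simp only [List.map_append, List.prod_append, List.length_append, List.map_cons, List.map_nil,
      List.prod_singleton, List.length_cons, List.length_nil, zero_add, Module.End.mul_apply]
    set k := l.length with hk
    have h1 : matrixAction (B i) (linearFunction g ^ (k + 1)) =
        ((k + 1 : ℕ) : ℂ) • (g (B i) • linearFunction g ^ k) + ((k + 1 : ℕ) : ℂ) •
          (linearFunction g ^ k * (matrixDerivation (B i) (linearFunction g) - C (g (B i)))) := by
      change matrixDerivation (B i) _ = _
      rw [Derivation.leibniz_pow, Nat.add_sub_cancel, ← smul_add, ← Nat.cast_smul_eq_nsmul ℂ,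
        smul_eq_mul, smul_eq_C_mul (linearFunction g ^ k)]
      congr 1
      ring
    have h2 : linearFunction g ^ k * (matrixDerivation (B i) (linearFunction g) - C (g (B i))) ∈
        RingHom.ker (evalOne (m := m)) ^ (k + 1) := by
      rw [pow_succ]
      refine Ideal.mul_mem_mul (Ideal.pow_mem_pow hg k) ?_
      rw [RingHom.mem_ker, map_sub, evalOne_matrixDerivation]
      simp [evalOne]
    have h3 := word_mem_ker_pow B l 1 h2
    rw [pow_one, RingHom.mem_ker] at h3
    rw [h1]
    simp only [map_add, map_smul, smul_eq_mul, ih, h3]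
    rw [Nat.factorial_succ]
    push_cast
    ring

theorem evalOne_word_pow_of_lt (B : I → Matrix m m ℂ) (g : Matrix m m ℂ →ₗ[ℂ] ℂ) (l : List I)
    {k : ℕ} (hk : l.length < k) :
    evalOne ((l.map fun i => (matrixAction (B i) : Module.End ℂ _)).prod (linearFunction g ^ k)) =
      0 := by
  have hg : linearFunction g ∈ RingHom.ker (evalOne (m := m)) := evalOne_linearFunction g
  have h := word_mem_ker_pow B l 1 (Ideal.pow_le_pow_right hk (Ideal.pow_mem_pow hg k))
  rwa [pow_one, RingHom.mem_ker] at h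

end FormalVectorField

variable {L : Type*} [LieRing L] [LieAlgebra ℂ L] {I : Type*} [Fintype I]

/-- The linear map that takes a monomial to the ordered monomial in `x`. -/
def orderedMap {A : Type*} [Ring A] [Algebra ℂ A] (x : I → A) : MvPolynomial I ℂ →ₗ[ℂ] A :=
  (basisMonomials I ℂ).constr ℂ (orderedMonomial x)

theorem orderedMap_monomial {A : Type*} [Ring A] [Algebra ℂ A] (x : I → A) (a : I →₀ ℕ) :
    orderedMap x (monomial a 1) = orderedMonomial x a := by
  have := (basisMonomials I ℂ).constr_basis ℂ (orderedMonomial x) a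
  simpa [orderedMap] using this

/-- The linear map from polynomials to the universal enveloping algebra that takes a monomial to
the ordered monomial in a basis of the Lie algebra. -/
def pbwMap (e : Module.Basis I ℂ L) :
    MvPolynomial I ℂ →ₗ[ℂ] UniversalEnvelopingAlgebra ℂ L :=
  orderedMap fun i => UniversalEnvelopingAlgebra.ι ℂ (e i)

theorem pbwMap_monomial (e : Module.Basis I ℂ L) (a : I →₀ ℕ) :
    pbwMap e (monomial a 1) =
      orderedMonomial (fun i => UniversalEnvelopingAlgebra.ι ℂ (e i)) a :=
  orderedMap_monomial _ _

/-- The map `ι` takes values in the subalgebra; by the universal property it lifts there, and the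
lift followed by the inclusion is the identity. -/
theorem envelopingAlgebra_adjoin (e : Module.Basis I ℂ L) (u : UniversalEnvelopingAlgebra ℂ L) :
    u ∈ Algebra.adjoin ℂ (Set.range fun i => UniversalEnvelopingAlgebra.ι ℂ (e i)) := by
  set S := Algebra.adjoin ℂ (Set.range fun i => UniversalEnvelopingAlgebra.ι ℂ (e i)) with hS
  have hmem : ∀ x : L, UniversalEnvelopingAlgebra.ι ℂ x ∈ S := by
    intro x
    rw [← e.sum_repr x, map_sum]
    refine Subalgebra.sum_mem _ fun i _ => ?_
    rw [map_smul]
    exact S.smul_mem (Algebra.subset_adjoin ⟨i, rfl⟩) _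
  let f : L →ₗ⁅ℂ⁆ S :=
    { toFun := fun x => ⟨UniversalEnvelopingAlgebra.ι ℂ x, hmem x⟩
      map_add' := fun x y => by ext; simp
      map_smul' := fun r x => by ext; simp
      map_lie' := fun {x y} => by
        apply Subtype.ext
        exact LieHom.map_lie (UniversalEnvelopingAlgebra.ι ℂ) x y }
  have h : S.val.comp (UniversalEnvelopingAlgebra.lift ℂ f) = AlgHom.id ℂ _ := by
    apply UniversalEnvelopingAlgebra.hom_ext
    ext x
    change ((UniversalEnvelopingAlgebra.lift ℂ f (UniversalEnvelopingAlgebra.ι ℂ x) : S) : _) =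
      UniversalEnvelopingAlgebra.ι ℂ x
    rw [UniversalEnvelopingAlgebra.lift_ι_apply]
    rfl
  rw [← AlgHom.id_apply (R := ℂ) u, ← h]
  exact (UniversalEnvelopingAlgebra.lift ℂ f u).2

theorem ι_mul_sub_ι_mul (x y : L) :
    UniversalEnvelopingAlgebra.ι ℂ x * UniversalEnvelopingAlgebra.ι ℂ y -
      UniversalEnvelopingAlgebra.ι ℂ y * UniversalEnvelopingAlgebra.ι ℂ x =
      UniversalEnvelopingAlgebra.ι ℂ ⁅x, y⁆ := by
  rw [LieHom.map_lie]; rfl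

/-- Linear combinations of monomials of weight at most `p`. -/
def polyFiltration (w : I → ℤ) (p : ℤ) : Submodule ℂ (MvPolynomial I ℂ) :=
  Submodule.span ℂ {f | ∃ a, expWeight w a ≤ p ∧ f = monomial a 1}

theorem polyFiltration_mono (w : I → ℤ) : Monotone (polyFiltration w) :=
  fun _ _ h => Submodule.span_mono fun _ ⟨a, ha, e⟩ => ⟨a, ha.trans h, e⟩

theorem X_mul_mem_polyFiltration (w : I → ℤ) (i : I) {p : ℤ} {f : MvPolynomial I ℂ}
    (hf : f ∈ polyFiltration w p) : X i * f ∈ polyFiltration w (p + w i) := by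
  classical
  induction hf using Submodule.span_induction with
  | mem x h =>
    obtain ⟨a, ha, rfl⟩ := h
    refine Submodule.subset_span ⟨a + Finsupp.single i 1, ?_, ?_⟩
    · rw [expWeight_add_single]; linarith
    · rw [X, monomial_mul, add_comm, one_mul]
  | zero => simp
  | add x y _ _ hx hy => rw [mul_add]; exact add_mem hx hy
  | smul r x _ hx => rw [mul_smul_comm]; exact Submodule.smul_mem _ _ hx

theorem ι_mem_wordFiltration (e : Module.Basis I ℂ L) (x : L) :
    UniversalEnvelopingAlgebra.ι ℂ x ∈
      wordFiltration (fun i => UniversalEnvelopingAlgebra.ι ℂ (e i)) (fun _ => 1) 1 := by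
  rw [← e.sum_repr x, map_sum]
  refine Submodule.sum_mem _ fun i _ => ?_
  rw [map_smul]
  exact Submodule.smul_mem _ _ (letter_mem_wordFiltration _ _ i)

theorem X_mul_pbwMap_sub_mem (e : Module.Basis I ℂ L) (i : I) {p : ℤ} {f : MvPolynomial I ℂ}
    (hf : f ∈ polyFiltration (fun _ => 1) p) :
    UniversalEnvelopingAlgebra.ι ℂ (e i) * pbwMap e f - pbwMap e (X i * f) ∈
      wordFiltration (fun i => UniversalEnvelopingAlgebra.ι ℂ (e i)) (fun _ => 1) p := by
  classical
  set W := wordFiltration (fun i => UniversalEnvelopingAlgebra.ι ℂ (e i)) (fun _ => 1)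
  have hF : IsRingFiltration W := isRingFiltration_wordFiltration _ _
  induction hf using Submodule.span_induction with
  | mem x h =>
    obtain ⟨a, ha, rfl⟩ := h
    rw [X, monomial_mul, add_comm _ a, one_mul, pbwMap_monomial, pbwMap_monomial]
    refine hF.mono ?_ (mul_orderedMonomial_sub_mem hF (w := fun _ => 1)
      (fun i => letter_mem_wordFiltration _ _ i) ?_ i a)
    · linarith
    · intro i j
      rw [ι_mul_sub_ι_mul]
      exact ι_mem_wordFiltration e _
  | zero => simp
  | add x y _ _ hx hy =>
    rw [mul_add, map_add, map_add, mul_add, add_sub_add_comm]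
    exact add_mem hx hy
  | smul r x _ hx =>
    rw [mul_smul_comm, map_smul, map_smul, mul_smul_comm, ← smul_sub]
    exact Submodule.smul_mem _ _ hx

/-- The commutator of two letters is a combination of single letters, so sorting a word changes it
only by shorter words. -/
theorem wordFiltration_le_map_pbwMap (e : Module.Basis I ℂ L) (p : ℤ) :
    wordFiltration (fun i => UniversalEnvelopingAlgebra.ι ℂ (e i)) (fun _ => 1) p ≤
      (polyFiltration (fun _ => 1) p).map (pbwMap e) := by
  refine wordFiltration_le _ _ (fun _ => zero_le_one)
    (fun p q h => Submodule.map_mono (polyFiltration_mono _ h)) ?_ ?_ p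
  · refine ⟨1, Submodule.subset_span ⟨0, by simp [expWeight], rfl⟩, ?_⟩
    have := pbwMap_monomial e 0
    rwa [orderedMonomial_zero] at this
  · rintro j p _ ⟨f, hf, rfl⟩
    rw [← sub_add_cancel (_ * _) (pbwMap e (X j * f))]
    refine add_mem (Submodule.mem_sup_right ?_) (Submodule.mem_sup_left ?_)
    · rw [add_sub_cancel_right]
      exact X_mul_pbwMap_sub_mem e j hf
    · exact ⟨_, X_mul_mem_polyFiltration _ j hf, rfl⟩

theorem pbwMap_surjective (e : Module.Basis I ℂ L) : Function.Surjective (pbwMap e) := by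
  intro u
  obtain ⟨p, hp⟩ := exists_mem_wordFiltration (fun i => UniversalEnvelopingAlgebra.ι ℂ (e i))
    (fun _ => 1) (envelopingAlgebra_adjoin e) u
  obtain ⟨f, -, hf⟩ := wordFiltration_le_map_pbwMap e _ hp
  exact ⟨f, hf⟩

/-- The word that spells the ordered monomial with exponent `a`. -/
def monomialWord (a : I →₀ ℕ) : List I :=
  (Finset.univ : Finset I).toList.flatMap fun i => List.replicate (a i) i

theorem prod_monomialWord {A : Type*} [Ring A] (x : I → A) (a : I →₀ ℕ) :
    ((monomialWord a).map x).prod = orderedMonomial x a := by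
  unfold monomialWord orderedMonomial listMonomial
  induction (Finset.univ : Finset I).toList with
  | nil => rfl
  | cons i l ih => simp [List.flatMap_cons, ih]

theorem length_monomialWord (a : I →₀ ℕ) : (monomialWord a).length = a.degree := by
  rw [monomialWord, List.length_flatMap, Finsupp.degree_eq_sum, ← Finset.sum_map_toList]
  simp

section Faithful

variable {m : Type*} [Fintype m] [DecidableEq m]

/-- The independence part of the Poincaré–Birkhoff–Witt theorem for linear Lie algebras. -/
theorem pbwMap_injective (e : Module.Basis I ℂ L) (φ : L →ₗ⁅ℂ⁆ Matrix m m ℂ)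
    (hφ : Function.Injective φ) : Function.Injective (pbwMap e) := by
  rw [injective_iff_map_eq_zero]
  intro p hp
  by_contra hne
  set k := p.totalDegree with hk
  have hpk : homogeneousComponent k p ≠ 0 := by
    obtain ⟨a, ha, hak⟩ := Finset.exists_mem_eq_sup _ (support_nonempty.mpr hne)
      fun s => s.sum fun _ e => e
    intro h0
    have := congrArg (coeff a) h0
    have hd : a.degree = k := (hk.trans hak).symm
    rw [coeff_homogeneousComponent, if_pos hd] at this
    exact mem_support_iff.mp ha this
  -- Over an infinite field a nonzero polynomial does not vanish at every point. The point `t`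
  -- determines the linear function used as a test.
  obtain ⟨t, ht⟩ : ∃ t, eval t (homogeneousComponent k p) ≠ 0 := by
    by_contra! h
    exact hpk (funext fun x => by simpa using h x)
  -- A linear left inverse of the embedding extends the functional with values `t i` on the basis of
  -- `L` to all matrices.
  obtain ⟨ψ, hψ⟩ := LinearMap.exists_leftInverse_of_injective (φ : L →ₗ[ℂ] Matrix m m ℂ)
    (LinearMap.ker_eq_bot.mpr hφ)
  let g : Matrix m m ℂ →ₗ[ℂ] ℂ := (e.constr ℂ t).comp ψ
  have hg : ∀ i, g (φ (e i)) = t i := by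
    intro i
    have : ψ (φ (e i)) = e i := LinearMap.congr_fun hψ (e i)
    rw [LinearMap.comp_apply, this, Module.Basis.constr_basis]
  let θ := UniversalEnvelopingAlgebra.lift ℂ (matrixAction.comp φ)
  have hθ : ∀ a, θ (pbwMap e (monomial a 1)) =
      ((monomialWord a).map fun i => (matrixAction (φ (e i)) : Module.End ℂ _)).prod := by
    intro a
    rw [pbwMap_monomial, ← prod_monomialWord, map_list_prod, List.map_map]
    congr 2
    ext1 i
    exact UniversalEnvelopingAlgebra.lift_ι_apply ℂ _ _
  -- A word shorter than `k` leaves a positive order of vanishing of the `k`-th power, so the test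
  -- sees only the component of `p` of top degree.
  have h1 : ∀ a ∈ p.support, evalOne (θ (pbwMap e (monomial a 1)) (linearFunction g ^ k)) =
      if a.degree = k then (k.factorial : ℂ) * a.prod fun i j => t i ^ j else 0 := by
    intro a ha
    rw [hθ]
    split_ifs with h
    · have := evalOne_word_pow (fun i => φ (e i)) g (monomialWord a)
      rw [length_monomialWord, h] at this
      rw [this]
      simp only [hg]
      rw [prod_monomialWord t a, orderedMonomial, listMonomial, Finset.prod_map_toList,
        Finsupp.prod_fintype _ _ (by simp)]
    · refine evalOne_word_pow_of_lt _ g _ ?_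
      rw [length_monomialWord]
      exact lt_of_le_of_ne (le_totalDegree ha) h
  apply ht
  have h2 : evalOne (θ (pbwMap e p) (linearFunction g ^ k)) = 0 := by rw [hp]; simp
  have h3 : pbwMap e p = ∑ a ∈ p.support, coeff a p • pbwMap e (monomial a 1) := by
    conv_lhs => rw [p.as_sum]
    rw [map_sum]
    refine Finset.sum_congr rfl fun a _ => ?_
    rw [← map_smul, smul_monomial, smul_eq_mul, mul_one]
  rw [h3] at h2
  simp only [map_sum, map_smul, LinearMap.sum_apply, LinearMap.smul_apply, smul_eq_mul] at h2
  rw [Finset.sum_congr rfl fun a ha => by rw [h1 a ha]] at h2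
  have h4 : (k.factorial : ℂ) * eval t (homogeneousComponent k p) = 0 := by
    rw [← h2, homogeneousComponent_apply, map_sum, Finset.mul_sum, Finset.sum_filter]
    refine Finset.sum_congr rfl fun a _ => ?_
    split_ifs
    · rw [eval_monomial]; ring
    · simp
  exact (mul_eq_zero.mp h4).resolve_left (by exact_mod_cast k.factorial_ne_zero)

/-- The Poincaré–Birkhoff–Witt theorem for linear Lie algebras. -/
def pbwEquiv (e : Module.Basis I ℂ L) (φ : L →ₗ⁅ℂ⁆ Matrix m m ℂ) (hφ : Function.Injective φ) :
    MvPolynomial I ℂ ≃ₗ[ℂ] UniversalEnvelopingAlgebra ℂ L :=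
  LinearEquiv.ofBijective (pbwMap e) ⟨pbwMap_injective e φ hφ, pbwMap_surjective e⟩

end Faithful

end PBW

/-! ### Homological perturbation along a filtration. -/

section Perturbation

variable {V : Type*} [AddCommGroup V] [Module ℂ V]

/-- A contraction of the graded complex `(V, d)` onto the image of `e`, compatible with a
filtration `F`. -/
structure GradedContraction (F : ℤ → Submodule ℂ V) (G : ℤ → Submodule ℂ V)
    (d h e : Module.End ℂ V) : Prop where
  mono : Monotone F
  neg : F (-1) = ⊥
  top : ∀ x, ∃ p : ℕ, x ∈ F p
  d_d : ∀ x, d (d x) = 0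
  h_h : ∀ x, h (h x) = 0
  e_h : ∀ x, e (h x) = 0
  h_e : ∀ x, h (e x) = 0
  d_e : ∀ x, d (e x) = 0
  homotopy : ∀ x, d (h x) + h (d x) = x - e x
  d_mem : ∀ k x, x ∈ G k → d x ∈ G (k + 1)
  h_mem : ∀ k x, x ∈ G k → h x ∈ G (k - 1)
  e_eq : ∀ k x, k ≠ 0 → x ∈ G k → e x = 0
  e_mem : ∀ x, e x ∈ G 0
  d_fil : ∀ p x, x ∈ F p → d x ∈ F p
  h_fil : ∀ p x, x ∈ F p → h x ∈ F p

/-- A contraction of a graded complex `(V, D)` up to lower order: `D` is the sum of a differential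
`d` that is contracted by `h` onto the image of `e`, and of a perturbation that lowers the
filtration `F`. -/
structure FilteredContraction (F : ℤ → Submodule ℂ V) (G : ℤ → Submodule ℂ V)
    (D d h e : Module.End ℂ V) : Prop extends GradedContraction F G d h e where
  D_D : ∀ x, D (D x) = 0
  D_mem : ∀ k x, x ∈ G k → D x ∈ G (k + 1)
  lower : ∀ p x, x ∈ F p → D x - d x ∈ F (p - 1)

namespace FilteredContraction

variable {F G : ℤ → Submodule ℂ V} {D d h e : Module.End ℂ V} (C : FilteredContraction F G D d h e)
include C

/-- The filtration is exhaustive and vanishes at `-1`, so any argument that passes to strictly lower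
filtration terminates. -/
theorem induction {P : V → Prop} (h0 : P 0)
    (hs : ∀ p : ℕ, (∀ x ∈ F ((p : ℤ) - 1), P x) → ∀ x ∈ F (p : ℤ), P x) (x : V) : P x := by
  have key : ∀ p : ℕ, ∀ x ∈ F ((p : ℤ) - 1), P x := by
    intro p
    induction p with
    | zero => intro x hx; simp [C.neg] at hx; rwa [hx]
    | succ p ih => intro x hx; exact hs p ih x (by simpa using hx)
  obtain ⟨p, hp⟩ := C.top x
  exact hs p (key p) x hp

theorem e_fil (p : ℤ) (x : V) (hx : x ∈ F p) : e x ∈ F p := by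
  have : e x = x - (d (h x) + h (d x)) := by rw [C.homotopy]; abel
  rw [this]
  exact sub_mem hx (add_mem (C.d_fil _ _ (C.h_fil _ _ hx)) (C.h_fil _ _ (C.d_fil _ _ hx)))

theorem e_e (x : V) : e (e x) = e x := by
  have := C.homotopy (e x)
  rw [C.h_e, C.d_e, map_zero, map_zero, add_zero] at this
  exact (sub_eq_zero.mp this.symm).symm

/-- The error of the contraction. -/
theorem D_h_add_h_D_fil (p : ℤ) (x : V) (hx : x ∈ F p) :
    D (h x) + h (D x) - (x - e x) ∈ F (p - 1) := by
  have : D (h x) + h (D x) - (x - e x) = (D (h x) - d (h x)) + h (D x - d x) := by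
    rw [← C.homotopy, map_sub]; abel
  rw [this]
  exact add_mem (C.lower _ _ (C.h_fil _ _ hx)) (C.h_fil _ _ (C.lower _ _ hx))

/-- Outside degree `0` the projection `e` vanishes, so `h x` is a primitive of the cocycle `x` up to
an error of lower filtration. The error is again a cocycle of the same degree and is treated
recursively. -/
theorem exact_of_ne_zero {k : ℤ} (hk : k ≠ 0) (x : V) :
    x ∈ G k → D x = 0 → ∃ y ∈ G (k - 1), D y = x := by
  refine C.induction (P := fun x => x ∈ G k → D x = 0 → ∃ y ∈ G (k - 1), D y = x)
    (fun _ _ => ⟨0, zero_mem _, map_zero _⟩) (fun p ih x hx hxk hDx => ?_) x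
  have h1 := C.D_h_add_h_D_fil _ _ hx
  rw [hDx, map_zero, add_zero, C.e_eq k x hk hxk, sub_zero] at h1
  have hg : D (h x) ∈ G k := by simpa using C.D_mem _ _ (C.h_mem _ _ hxk)
  obtain ⟨y, hy, hy'⟩ := ih _ h1 (sub_mem hg hxk) (by rw [map_sub, C.D_D, hDx, sub_zero])
  exact ⟨h x - y, sub_mem (C.h_mem _ _ hxk) hy, by rw [map_sub, hy']; abel⟩

/-- The unipotent map that corrects the inclusion of the image of `e`. -/
theorem correction_bijective : Function.Bijective (LinearMap.id + h ∘ₗ (D - d) : V →ₗ[ℂ] V) := by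
  refine bijective_of_unipotent C.neg C.top _ fun p x hx => ?_
  have : (LinearMap.id + h ∘ₗ (D - d) : V →ₗ[ℂ] V) x - x = h (D x - d x) := by simp
  rw [this]
  exact C.h_fil _ _ (C.lower _ _ hx)

/-- Write `δ = D - d`. The hypothesis `hk` puts `u + h δ u` in the image of `e`, hence `d u = -d h δ
u`. In degree `1` the homotopy identity has no `e`-term, so `D u = d u + δ u = h d δ u`. From `D² =
0` one gets `d δ u = -δ D u`, whence `(1 + h δ) D u = 0`, and `1 + h δ` is injective. -/
theorem cocycle_of_correction {u : V} (hu : u ∈ G 0) (hk : e (u + h (D u - d u)) =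
    u + h (D u - d u)) : D u = 0 := by
  set δ : Module.End ℂ V := D - d with hδ
  have hδ' : ∀ x, D x = d x + δ x := fun x => by simp [hδ]
  have hDd : D u - d u = δ u := by simp [hδ]
  rw [hDd] at hk
  have h1 : d u + d (h (δ u)) = 0 := by rw [← map_add, ← hk, C.d_e]
  have hδu : δ u ∈ G 1 := sub_mem (by simpa using C.D_mem _ _ hu) (by simpa using C.d_mem _ _ hu)
  have h2 : d (h (δ u)) + h (d (δ u)) = δ u := by
    rw [C.homotopy, C.e_eq 1 _ one_ne_zero hδu, sub_zero]
  have h3 : D u = h (d (δ u)) := by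
    have : D u = d u + d (h (δ u)) + h (d (δ u)) := by rw [add_assoc, h2, hδ']
    rw [this, h1, zero_add]
  have h4 : d (δ u) = -δ (D u) := by
    have := C.D_D u
    rw [hδ' (D u), hδ' u, map_add, C.d_d, zero_add, ← hδ' u] at this
    exact eq_neg_of_add_eq_zero_left this
  apply (C.correction_bijective).1
  rw [map_zero]
  change D u + h (δ (D u)) = 0
  nth_rewrite 1 [h3]
  rw [h4, map_neg, neg_add_cancel]

/-- `i` is the inverse of `1 + h (D - d)`, the perturbed inclusion of the perturbation lemma. It
respects degree `0` and the filtration by recursion on the identity `Φ⁻¹ x = x - Φ⁻¹ (h (D x - d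
x))`. -/
theorem exists_correction : ∃ i : V →ₗ[ℂ] V, (∀ x, i x + h (D (i x) - d (i x)) = x) ∧
    (∀ x, x ∈ G 0 → i x ∈ G 0) ∧ ∀ p x, x ∈ F p → i x - x ∈ F (p - 1) := by
  let Φ := LinearEquiv.ofBijective _ C.correction_bijective
  have hΦ : ∀ x, Φ x = x + h (D x - d x) := fun x => rfl
  have hG : ∀ x, x ∈ G 0 → h (D x - d x) ∈ G 0 := by
    intro x hx
    have := C.h_mem _ _ (sub_mem (C.D_mem _ _ hx) (C.d_mem _ _ hx))
    simpa using this
  have hi : ∀ x, Φ.symm x + h (D (Φ.symm x) - d (Φ.symm x)) = x := by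
    intro x; rw [← hΦ]; simp
  have hfil : ∀ p x, x ∈ F p → h (D x - d x) ∈ F (p - 1) := fun p x hx =>
    C.h_fil _ _ (C.lower _ _ hx)
  have hsymm : ∀ x, (∀ p, x ∈ F p → Φ.symm x ∈ F p) ∧ (x ∈ G 0 → Φ.symm x ∈ G 0) := by
    refine C.induction (by simp) fun p ih x hx => ?_
    have e : Φ.symm x = x - Φ.symm (h (D x - d x)) := by
      apply Φ.injective
      rw [map_sub, Φ.apply_symm_apply, Φ.apply_symm_apply, hΦ, add_sub_cancel_right] 
    have h1 := ih _ (hfil _ _ hx)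
    refine ⟨fun q hq => ?_, fun hx0 => ?_⟩
    · rw [e]
      exact sub_mem hq (h1.1 _ (C.mono (by omega) (hfil _ _ hq)))
    · rw [e]
      exact sub_mem hx0 (h1.2 (hG _ hx0))
  refine ⟨Φ.symm.toLinearMap, hi, fun x => (hsymm x).2, fun p x hx => ?_⟩
  have := hi x
  have e : Φ.symm x - x = - h (D (Φ.symm x) - d (Φ.symm x)) := by
    nth_rewrite 2 [← this]; abel
  change Φ.symm x - x ∈ _
  rw [e]
  exact neg_mem (hfil _ _ ((hsymm x).1 _ hx))

/-- The cohomology in degree `0` is the image of `e`. -/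
theorem cohomology_zero : Nonempty (((G 0 ⊓ LinearMap.ker D : Submodule ℂ V) ⧸
    ((G (0 - 1)).map D).submoduleOf (G 0 ⊓ LinearMap.ker D)) ≃ₗ[ℂ] LinearMap.range e) := by
  obtain ⟨i, hi, hi0, hil⟩ := C.exists_correction
  have hei : ∀ x, e (i x) = e x := by
    intro x
    have := congrArg e (hi x)
    rwa [map_add, C.e_h, add_zero] at this
  have hDi : ∀ x, D (i (e x)) = 0 := by
    intro x
    refine C.cocycle_of_correction (hi0 _ (C.e_mem x)) ?_
    rw [hi, C.e_e]
  let f : LinearMap.range e →ₗ[ℂ] (G 0 ⊓ LinearMap.ker D : Submodule ℂ V) :=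
    LinearMap.codRestrict _ (i ∘ₗ (LinearMap.range e).subtype) (by
      rintro ⟨_, x, rfl⟩
      exact ⟨hi0 _ (C.e_mem x), hDi x⟩)
  let g := (Submodule.mkQ (((G (0 - 1)).map D).submoduleOf (G 0 ⊓ LinearMap.ker D))) ∘ₗ f
  have hinj : Function.Injective g := by
    rw [← LinearMap.ker_eq_bot, LinearMap.ker_eq_bot']
    rintro ⟨_, x, rfl⟩ hx
    have hx' : i (e x) ∈ (G (0 - 1)).map D := by
      have := (Submodule.Quotient.mk_eq_zero _).mp hx
      exact this
    obtain ⟨y, hy, hyx⟩ := hx'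
    have hhi : h (i (e x)) = 0 := by
      have := congrArg h (hi (e x))
      rwa [map_add, C.h_h, add_zero, C.h_e] at this
    -- A bounding element `y` may be replaced by `y - D (h y)`: the boundary is the same, and the
    -- filtration drops because `h` kills `i (e x)` and `e` kills degree `-1`. At the bottom `y =
    -- 0`.
    have key : ∀ y, y ∈ G (0 - 1) → D y = i (e x) → i (e x) = 0 := by
      refine C.induction (fun _ h0 => ?_) fun p ih y hyp hy hyx => ?_
      · rw [← h0, map_zero]
      · have h1 := C.D_h_add_h_D_fil _ _ hyp
        rw [hyx, hhi, add_zero, C.e_eq _ y (by norm_num) hy, sub_zero] at h1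
        have hDh : D (h y) ∈ G (0 - 1) := by
          have := C.D_mem _ _ (C.h_mem _ _ hy)
          rwa [sub_add_cancel] at this
        refine ih _ (neg_mem h1) (neg_mem (sub_mem hDh hy)) ?_
        rw [map_neg, map_sub, C.D_D, hyx, zero_sub, neg_neg]
    have h0 := key y hy hyx
    have : e x = 0 := by rw [← C.e_e, ← hei, h0, map_zero]
    simp [this]
  have hsurj : Function.Surjective g := by
    -- The cocycle `i (e z)` and the coboundary `D (h z)` together account for the top-order part of
    -- `z`; the remainder is a cocycle of lower filtration.
    have key : ∀ z (hz : z ∈ G 0) (hDz : D z = 0), ∃ x, ∃ y ∈ G (0 - 1), z = i (e x) + D y := by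
      intro z
      refine C.induction (P := fun z => z ∈ G 0 → D z = 0 → ∃ x, ∃ y ∈ G (0 - 1),
        z = i (e x) + D y) (fun _ _ => ⟨0, 0, zero_mem _, by simp⟩) (fun p ih z hz hz0 hDz => ?_) z
      have h1 := C.D_h_add_h_D_fil _ _ hz
      rw [hDz, map_zero, add_zero] at h1
      have h2 := hil _ _ (C.e_fil _ _ hz)
      have hDh : D (h z) ∈ G 0 := by
        have := C.D_mem _ _ (C.h_mem _ _ hz0)
        rwa [sub_add_cancel] at this
      obtain ⟨x, y, hy, hxy⟩ := ih (z - i (e z) - D (h z))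
        (by convert neg_mem (add_mem h1 h2) using 1; abel)
        (sub_mem (sub_mem hz0 (hi0 _ (C.e_mem z))) hDh)
        (by rw [map_sub, map_sub, hDz, hDi, C.D_D]; simp)
      refine ⟨x + z, y + h z, add_mem hy (C.h_mem _ _ hz0), ?_⟩
      rw [map_add, map_add, map_add, add_add_add_comm, ← hxy]
      abel
    intro q
    obtain ⟨⟨z, hz0, hDz⟩, rfl⟩ := Submodule.Quotient.mk_surjective _ q
    obtain ⟨x, y, hy, hxy⟩ := key z hz0 hDz
    refine ⟨⟨e x, x, rfl⟩, ?_⟩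
    refine (Submodule.Quotient.eq _).mpr ?_
    change i (e x) - z ∈ (G (0 - 1)).map D
    exact ⟨-y, neg_mem hy, by rw [hxy, map_neg]; abel⟩
  exact ⟨(LinearEquiv.ofBijective g ⟨hinj, hsurj⟩).symm⟩

end FilteredContraction
end Perturbation

/-! ### Functions of a diagonalizable operator. -/

section Eigen

variable {V J : Type*} [AddCommGroup V] [Module ℂ V]

/-- Operators that act on each eigenvector through a given function of the eigenvalue. -/
theorem exists_functionalCalculus (T : Module.End ℂ V) {v : J → V} {m : J → ℕ}
    (hv : ⊤ ≤ Submodule.span ℂ (Set.range v)) (hT : ∀ j, T (v j) = (m j : ℂ) • v j)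
    (c : ℕ → ℂ) : ∃ s : Module.End ℂ V, ∀ n : ℕ, ∀ x, T x = (n : ℂ) • x → s x = c n • x := by
  classical
  -- The family `v` is only assumed to span, so an operator cannot be prescribed on it. Prescribing
  -- it on the eigenspaces is unambiguous, as their sum is direct.
  have hint : DirectSum.IsInternal fun n : ℕ => T.eigenspace (n : ℂ) := by
    rw [DirectSum.isInternal_submodule_iff_iSupIndep_and_iSup_eq_top]
    refine ⟨(Module.End.eigenspaces_iSupIndep T).comp Nat.cast_injective, ?_⟩
    rw [eq_top_iff]
    refine hv.trans (Submodule.span_le.mpr ?_)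
    rintro _ ⟨j, rfl⟩
    exact Submodule.mem_iSup_of_mem (m j) (Module.End.mem_eigenspace_iff.mpr (hT j))
  let E := LinearEquiv.ofBijective (DirectSum.coeLinearMap fun n : ℕ => T.eigenspace (n : ℂ)) hint
  let s : Module.End ℂ V := (DirectSum.toModule ℂ ℕ V fun n =>
    c n • (T.eigenspace (n : ℂ)).subtype) ∘ₗ E.symm.toLinearMap
  refine ⟨s, fun n x hx => ?_⟩
  have h : E.symm x = DirectSum.lof ℂ ℕ (fun n : ℕ => T.eigenspace (n : ℂ)) n
      ⟨x, Module.End.mem_eigenspace_iff.mpr hx⟩ := by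
    rw [LinearEquiv.symm_apply_eq]
    exact (DirectSum.coeLinearMap_lof (fun n : ℕ => T.eigenspace (n : ℂ)) n
      ⟨x, Module.End.mem_eigenspace_iff.mpr hx⟩).symm
  change DirectSum.toModule ℂ ℕ V _ (E.symm x) = _
  rw [h, DirectSum.toModule_lof]
  rfl

end Eigen

/-! ### Sums of products of even and odd operators. -/

section OddEven

variable {R O : Type*} [Ring R] [Algebra ℂ R] [Fintype O] [DecidableEq O]
  {a b a' b' : O → R}

/-- The double sum contracts an expression symmetric in the two indices with an antisymmetric one.
-/
theorem sum_mul_sum_eq_zero (hab : ∀ i j, a i * b j = b j * a i)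
    (haa : ∀ i j, a i * a j = a j * a i) (hbb : ∀ i j, b i * b j = -(b j * b i)) :
    (∑ i, a i * b i) * (∑ i, a i * b i) = 0 := by
  have h : (∑ i, a i * b i) * (∑ i, a i * b i) = ∑ i, ∑ j, a i * a j * (b i * b j) := by
    rw [Finset.sum_mul_sum]
    refine Finset.sum_congr rfl fun i _ => Finset.sum_congr rfl fun j _ => ?_
    rw [mul_assoc, ← mul_assoc (b i), ← hab j i]; noncomm_ring
  have h2 : (∑ i, a i * b i) * (∑ i, a i * b i) = -((∑ i, a i * b i) * (∑ i, a i * b i)) := by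
    conv_lhs => rw [h, Finset.sum_comm]
    rw [h, ← Finset.sum_neg_distrib]
    refine Finset.sum_congr rfl fun i _ => ?_
    rw [← Finset.sum_neg_distrib]
    refine Finset.sum_congr rfl fun j _ => ?_
    rw [haa j i, hbb j i, mul_neg]
  have h3 : (2 : ℂ) • ((∑ i, a i * b i) * (∑ i, a i * b i)) = 0 := by
    rw [two_smul]
    nth_rewrite 1 [h2]
    simp
  exact (smul_eq_zero.mp h3).resolve_left (by norm_num)

/-- Off the diagonal the two orders of multiplication cancel by the sign of the odd factors. Only
equal indices survive, where the canonical relations contribute constants. -/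
theorem sum_mul_sum_add (hab' : ∀ i j, a i * b' j = b' j * a i)
    (ha'b : ∀ i j, a' i * b j = b j * a' i) (haa' : ∀ i j, i ≠ j → a i * a' j = a' j * a i)
    (hbb' : ∀ i j, i ≠ j → b i * b' j = -(b' j * b i)) :
    (∑ i, a i * b i) * (∑ i, a' i * b' i) + (∑ i, a' i * b' i) * (∑ i, a i * b i) =
      ∑ i, (a i * a' i * (b i * b' i) + a' i * a i * (b' i * b i)) := by
  have h1 : (∑ i, a i * b i) * (∑ i, a' i * b' i) = ∑ i, ∑ j, a i * a' j * (b i * b' j) := by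
    rw [Finset.sum_mul_sum]
    refine Finset.sum_congr rfl fun i _ => Finset.sum_congr rfl fun j _ => ?_
    rw [mul_assoc, ← mul_assoc (b i), ← ha'b j i]; noncomm_ring
  have h2 : (∑ i, a' i * b' i) * (∑ i, a i * b i) = ∑ i, ∑ j, a' j * a i * (b' j * b i) := by
    rw [Finset.sum_mul_sum, Finset.sum_comm]
    refine Finset.sum_congr rfl fun i _ => Finset.sum_congr rfl fun j _ => ?_
    rw [mul_assoc, ← mul_assoc (b' j), ← hab' i j]; noncomm_ring
  rw [h1, h2, ← Finset.sum_add_distrib]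
  refine Finset.sum_congr rfl fun i _ => ?_
  rw [← Finset.sum_add_distrib, Finset.sum_eq_single i _ (by simp)]
  intro j _ hj
  rw [haa' i j hj.symm, hbb' i j hj.symm, mul_neg, neg_add_cancel]

end OddEven

/-! ### The Koszul model: polynomials tensor fermions. -/

section Model

/-- Creation operators `W` and annihilation operators `K` on a fermionic space with vacuum. -/
structure Fermions (O C : Type*) [DecidableEq O] [AddCommGroup C] [Module ℂ C] where
  vac : C
  W : O → Module.End ℂ C
  K : O → Module.End ℂ C
  W_mul_W : ∀ i j, W i * W j = -(W j * W i)
  K_mul_K : ∀ i j, K i * K j = -(K j * K i)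
  K_mul_W : ∀ i j, K i * W j = (if i = j then 1 else 0) - W j * K i
  K_vac : ∀ i, K i vac = 0
  span_words : ⊤ ≤ Submodule.span ℂ (Set.range fun l : List O => (l.map W).prod vac)

variable {P κ C : Type*} [Fintype P] [DecidableEq P] [Fintype κ] [DecidableEq κ]
  [AddCommGroup C] [Module ℂ C]

/-- The degree of a ghost is `1`, that of an antighost is `-1`. -/
def letterDeg : P ⊕ P → ℤ := Sum.elim (fun _ => 1) (fun _ => -1)

/-- The even letter that is paired with an odd letter by the leading part of the differential. -/
def evenPartner : P ⊕ P → P ⊕ (P ⊕ κ) := Sum.elim (fun α => Sum.inr (Sum.inl α)) Sum.inl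

theorem evenPartner_injective : Function.Injective (evenPartner (P := P) (κ := κ)) := by
  rintro (a | a) (b | b) h <;> simp_all [evenPartner]

variable (P κ C) in
/-- The tensor product of a polynomial algebra and a fermionic space. -/
def ModelSpace : Type _ := MvPolynomial (P ⊕ (P ⊕ κ)) ℂ ⊗[ℂ] C

instance : AddCommGroup (ModelSpace P κ C) :=
  inferInstanceAs (AddCommGroup (MvPolynomial (P ⊕ (P ⊕ κ)) ℂ ⊗[ℂ] C))

instance : Module ℂ (ModelSpace P κ C) :=
  inferInstanceAs (Module ℂ (MvPolynomial (P ⊕ (P ⊕ κ)) ℂ ⊗[ℂ] C))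

/-- The pure tensors of the model space. -/
def pureTensor : MvPolynomial (P ⊕ (P ⊕ κ)) ℂ →ₗ[ℂ] C →ₗ[ℂ] ModelSpace P κ C :=
  TensorProduct.mk ℂ _ _

theorem ModelSpace.span_pureTensor :
    Submodule.span ℂ {x : ModelSpace P κ C | ∃ f c, pureTensor f c = x} = ⊤ :=
  TensorProduct.span_tmul_eq_top ℂ _ _

theorem ModelSpace.hom_ext {V : Type*} [AddCommGroup V] [Module ℂ V]
    {S T : ModelSpace P κ C →ₗ[ℂ] V} (h : ∀ f x, S (pureTensor f x) = T (pureTensor f x)) :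
    S = T :=
  TensorProduct.ext' h

namespace Fermions

variable (M : Fermions (P ⊕ P) C) (w : P ⊕ (P ⊕ κ) → ℤ)

/-- The state created by a word. -/
def state (l : List (P ⊕ P)) : C := (l.map M.W).prod M.vac

@[simp] theorem state_cons (o : P ⊕ P) (l : List (P ⊕ P)) :
    M.state (o :: l) = M.W o (M.state l) := by simp [state]

open MvPolynomial

/-- The tensor product of a monomial and a state. -/
def basisVec (j : (P ⊕ (P ⊕ κ) →₀ ℕ) × List (P ⊕ P)) : ModelSpace P κ C :=
  pureTensor (monomial j.1 1) (M.state j.2)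

/-- The total weight of a basis vector. -/
def weight (j : (P ⊕ (P ⊕ κ) →₀ ℕ) × List (P ⊕ P)) : ℤ :=
  expWeight w j.1 + (j.2.map fun o => w (evenPartner o)).sum

theorem span_basisVec : ⊤ ≤ Submodule.span ℂ (Set.range (M.basisVec (κ := κ))) := by
  rw [← ModelSpace.span_pureTensor, Submodule.span_le]
  rintro _ ⟨f, x, rfl⟩
  rw [SetLike.mem_coe]
  have hx : x ∈ Submodule.span ℂ (Set.range fun l : List (P ⊕ P) => M.state l) :=
    M.span_words trivial
  induction hx using Submodule.span_induction with
  | mem x h =>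
    obtain ⟨l, rfl⟩ := h
    induction f using MvPolynomial.induction_on' with
    | monomial a r =>
      have : pureTensor (monomial a r) (M.state l) = r • M.basisVec (κ := κ) (a, l) := by
        rw [basisVec, ← LinearMap.smul_apply, ← map_smul, smul_monomial, smul_eq_mul, mul_one]
      exact this ▸ Submodule.smul_mem _ _ (Submodule.subset_span ⟨_, rfl⟩)
    | add p q hp hq => rw [map_add, LinearMap.add_apply]; exact add_mem hp hq
  | zero => simp
  | add x y _ _ hx hy => rw [map_add]; exact add_mem hx hy
  | smul r x _ hx => rw [map_smul]; exact Submodule.smul_mem _ _ hx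

/-- The span of the basis vectors of given weight and degree. -/
def piece (p k : ℤ) : Submodule ℂ (ModelSpace P κ C) :=
  Submodule.span ℂ {x | ∃ j, weight w j = p ∧ (j.2.map letterDeg).sum = k ∧ x = M.basisVec j}

/-- The operator `T` raises the weight by `c` and the degree by `k`. -/
def HasBidegree (T : Module.End ℂ (ModelSpace P κ C)) (c k : ℤ) : Prop :=
  ∀ p q x, x ∈ M.piece w p q → T x ∈ M.piece w (p + c) (q + k)

variable {M w}

theorem basisVec_mem_piece (j) :
    M.basisVec (κ := κ) j ∈ M.piece w (weight w j) (j.2.map letterDeg).sum :=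
  Submodule.subset_span ⟨j, rfl, rfl, rfl⟩

theorem HasBidegree.of_basisVec {T : Module.End ℂ (ModelSpace P κ C)} {c k : ℤ}
    (h : ∀ j, T (M.basisVec j) ∈ M.piece w (weight w j + c) ((j.2.map letterDeg).sum + k)) :
    M.HasBidegree w T c k := by
  intro p q x hx
  induction hx using Submodule.span_induction with
  | mem x hx => obtain ⟨j, rfl, rfl, rfl⟩ := hx; exact h j
  | zero => simp
  | add x y _ _ hx hy => rw [map_add]; exact add_mem hx hy
  | smul r x _ hx => rw [map_smul]; exact Submodule.smul_mem _ _ hx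

theorem HasBidegree.mul {S T : Module.End ℂ (ModelSpace P κ C)} {c k c' k' : ℤ}
    (hS : M.HasBidegree w S c k) (hT : M.HasBidegree w T c' k') {c'' k'' : ℤ}
    (hc : c' + c = c'') (hk : k' + k = k'') : M.HasBidegree w (S * T) c'' k'' := by
  intro p q x hx
  have := hS _ _ _ (hT _ _ _ hx)
  rwa [add_assoc, add_assoc, hc, hk] at this

theorem HasBidegree.sum {ι : Type*} [Fintype ι]
    {T : ι → Module.End ℂ (ModelSpace P κ C)} {c k : ℤ}
    (h : ∀ i, M.HasBidegree w (T i) c k) : M.HasBidegree w (∑ i, T i) c k := by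
  intro p q x hx
  rw [LinearMap.sum_apply]
  exact sum_mem fun i _ => h i _ _ _ hx

variable (M w)

/-- Multiplication by a variable. -/
def mulX (i : P ⊕ (P ⊕ κ)) : Module.End ℂ (ModelSpace P κ C) :=
  (LinearMap.mulLeft ℂ (X i)).rTensor C

/-- Partial derivative by a variable. -/
def derX (i : P ⊕ (P ⊕ κ)) : Module.End ℂ (ModelSpace P κ C) :=
  (pderiv i).toLinearMap.rTensor C

/-- Creation on the second factor. -/
def create (o : P ⊕ P) : Module.End ℂ (ModelSpace P κ C) :=
  (M.W o).lTensor _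

/-- Annihilation on the second factor. -/
def annihilate (o : P ⊕ P) : Module.End ℂ (ModelSpace P κ C) :=
  (M.K o).lTensor _

theorem mulX_pureTensor (i : P ⊕ (P ⊕ κ)) (f) (x : C) :
    mulX i (pureTensor f x) = pureTensor (X i * f) x := rfl

theorem derX_pureTensor (i : P ⊕ (P ⊕ κ)) (f) (x : C) :
    derX i (pureTensor f x) = pureTensor (pderiv i f) x := rfl

theorem create_pureTensor (o) (f : MvPolynomial (P ⊕ (P ⊕ κ)) ℂ) (x : C) :
    M.create o (pureTensor f x) = pureTensor f (M.W o x) := rfl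

theorem annihilate_pureTensor (o) (f : MvPolynomial (P ⊕ (P ⊕ κ)) ℂ) (x : C) :
    M.annihilate o (pureTensor f x) = pureTensor f (M.K o x) := rfl

theorem mulX_basisVec (i : P ⊕ (P ⊕ κ)) (j) :
    mulX i (M.basisVec j) = M.basisVec (j.1 + Finsupp.single i 1, j.2) := by
  rw [basisVec, mulX_pureTensor, X, monomial_mul, add_comm, one_mul, basisVec]

theorem derX_basisVec (i : P ⊕ (P ⊕ κ)) (j) :
    derX i (M.basisVec j) = (j.1 i : ℂ) • M.basisVec (j.1 - Finsupp.single i 1, j.2) := by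
  rw [basisVec, derX_pureTensor, pderiv_monomial, basisVec, ← LinearMap.smul_apply, ← map_smul,
    smul_monomial]
  simp

theorem create_basisVec (o : P ⊕ P) (j : (P ⊕ (P ⊕ κ) →₀ ℕ) × List (P ⊕ P)) :
    M.create o (M.basisVec j) = M.basisVec (j.1, o :: j.2) := by
  rw [basisVec, create_pureTensor, basisVec, state_cons]

theorem mulX_bidegree (i : P ⊕ (P ⊕ κ)) : M.HasBidegree w (mulX i) (w i) 0 := by
  refine .of_basisVec fun j => ?_
  rw [mulX_basisVec]
  refine Submodule.subset_span ⟨_, ?_, by simp, rfl⟩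
  simp only [weight, expWeight_add_single]
  ring

theorem derX_bidegree (i : P ⊕ (P ⊕ κ)) : M.HasBidegree w (derX i) (-w i) 0 := by
  refine .of_basisVec fun j => ?_
  rw [derX_basisVec]
  by_cases h : j.1 i = 0
  · simp [h]
  · refine Submodule.smul_mem _ _ (Submodule.subset_span ⟨_, ?_, by simp, rfl⟩)
    simp only [weight, expWeight_sub_single w h]
    ring

theorem create_bidegree (o : P ⊕ P) :
    M.HasBidegree w (M.create o) (w (evenPartner o)) (letterDeg o) := by
  refine .of_basisVec fun j => ?_
  rw [create_basisVec]
  refine Submodule.subset_span ⟨_, ?_, ?_, rfl⟩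
  · simp only [weight, List.map_cons, List.sum_cons]
    ring
  · simp only [List.map_cons, List.sum_cons]
    ring

theorem annihilate_create (o o' : P ⊕ P) (x : ModelSpace P κ C) :
    M.annihilate o (M.create o' x) = (if o = o' then x else 0) - M.create o' (M.annihilate o x) := by
  have h : M.annihilate (κ := κ) o * M.create o' =
      (if o = o' then 1 else 0) - M.create o' * M.annihilate o := by
    refine ModelSpace.hom_ext fun f x => ?_
    have := LinearMap.congr_fun (M.K_mul_W o o') x
    simp only [Module.End.mul_apply, LinearMap.sub_apply] at this
    simp only [Module.End.mul_apply, LinearMap.sub_apply, create_pureTensor,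
      annihilate_pureTensor, this, map_sub]
    split_ifs <;> simp
  have := LinearMap.congr_fun h x
  rw [Module.End.mul_apply] at this
  rw [this]
  split_ifs <;> rfl

theorem annihilate_bidegree (o : P ⊕ P) :
    M.HasBidegree (κ := κ) w (M.annihilate o) (-w (evenPartner o)) (-letterDeg o) := by
  refine .of_basisVec fun ⟨a, l⟩ => ?_
  induction l with
  | nil => simp [basisVec, state, annihilate_pureTensor, M.K_vac]
  | cons o' l ih =>
    rw [← M.create_basisVec o' (a, l), annihilate_create]
    refine sub_mem ?_ ?_
    · split_ifs with h
      · subst h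
        refine Submodule.subset_span ⟨(a, l), ?_, ?_, rfl⟩
        · simp only [weight, List.map_cons, List.sum_cons]; ring
        · simp only [List.map_cons, List.sum_cons]; ring
      · exact zero_mem _
    · have := M.create_bidegree w o' _ _ _ ih
      convert this using 1
      simp only [weight, List.map_cons, List.sum_cons]
      congr 1 <;> ring_nf

/-- The even factors of the leading differential. -/
def evenFactor (o : P ⊕ P) : Module.End ℂ (ModelSpace P κ C) :=
  Sum.elim (fun _ => derX (evenPartner o)) (fun _ => mulX (evenPartner o)) o

/-- The even factors of the homotopy. -/
def evenFactor' (o : P ⊕ P) : Module.End ℂ (ModelSpace P κ C) :=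
  Sum.elim (fun _ => mulX (evenPartner o)) (fun _ => derX (evenPartner o)) o

/-- The odd factors of the leading differential. -/
def oddFactor (o : P ⊕ P) : Module.End ℂ (ModelSpace P κ C) :=
  Sum.elim (fun _ => M.create o) (fun _ => M.annihilate o) o

/-- The odd factors of the homotopy. -/
def oddFactor' (o : P ⊕ P) : Module.End ℂ (ModelSpace P κ C) :=
  Sum.elim (fun _ => M.annihilate o) (fun _ => M.create o) o

theorem mulX_mul_mulX (i j : P ⊕ (P ⊕ κ)) : (mulX i * mulX j : Module.End ℂ (ModelSpace P κ C)) =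
    mulX j * mulX i := by
  refine ModelSpace.hom_ext fun f x => ?_
  simp only [Module.End.mul_apply, mulX_pureTensor]
  congr 1
  ring

theorem pderiv_comm {σ : Type*} (i j : σ) (f : MvPolynomial σ ℂ) :
    pderiv i (pderiv j f) = pderiv j (pderiv i f) := by
  classical
  induction f using MvPolynomial.induction_on with
  | C r => simp
  | add p q hp hq => simp only [map_add, hp, hq]
  | mul_X p k hp =>
    have h : ∀ i j : σ, pderiv (R := ℂ) i ((Pi.single j 1 : σ → MvPolynomial σ ℂ) k) = 0 := by
      intro i j
      rw [Pi.single_apply]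
      split_ifs <;> simp
    simp only [Derivation.leibniz, map_add, smul_eq_mul, pderiv_X, hp, h]
    ring

theorem derX_mul_derX (i j : P ⊕ (P ⊕ κ)) : (derX i * derX j : Module.End ℂ (ModelSpace P κ C)) =
    derX j * derX i := by
  refine ModelSpace.hom_ext fun f x => ?_
  simp only [Module.End.mul_apply, derX_pureTensor]
  rw [pderiv_comm]

theorem derX_mul_mulX (i j : P ⊕ (P ⊕ κ)) : (derX i * mulX j : Module.End ℂ (ModelSpace P κ C)) =
    mulX j * derX i + if i = j then 1 else 0 := by
  refine ModelSpace.hom_ext fun f x => ?_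
  simp only [Module.End.mul_apply, derX_pureTensor, mulX_pureTensor, LinearMap.add_apply, Derivation.leibniz,
    pderiv_X, smul_eq_mul, map_add]
  congr 1
  split_ifs with h
  · subst h; simp
  · simp [Ne.symm h]

theorem create_mul_create (o o' : P ⊕ P) :
    (M.create o * M.create o' : Module.End ℂ (ModelSpace P κ C)) =
      -(M.create o' * M.create o) := by
  refine ModelSpace.hom_ext fun f x => ?_
  have := LinearMap.congr_fun (M.W_mul_W o o') x
  simp only [Module.End.mul_apply, LinearMap.neg_apply] at this
  simp only [Module.End.mul_apply, LinearMap.neg_apply, create_pureTensor, this, map_neg]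

theorem annihilate_mul_annihilate (o o' : P ⊕ P) :
    (M.annihilate o * M.annihilate o' : Module.End ℂ (ModelSpace P κ C)) =
      -(M.annihilate o' * M.annihilate o) := by
  refine ModelSpace.hom_ext fun f x => ?_
  have := LinearMap.congr_fun (M.K_mul_K o o') x
  simp only [Module.End.mul_apply, LinearMap.neg_apply] at this
  simp only [Module.End.mul_apply, LinearMap.neg_apply, annihilate_pureTensor, this,
    map_neg]

theorem annihilate_mul_create (o o' : P ⊕ P) :
    (M.annihilate o * M.create o' : Module.End ℂ (ModelSpace P κ C)) =
      (if o = o' then 1 else 0) - M.create o' * M.annihilate o := by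
  refine LinearMap.ext fun x => ?_
  rw [Module.End.mul_apply, annihilate_create]
  split_ifs <;> rfl

theorem even_mul_odd (o o' : P ⊕ P) :
    (evenFactor (κ := κ) o * M.oddFactor o' = M.oddFactor o' * evenFactor o) ∧
      (evenFactor (κ := κ) o * M.oddFactor' o' = M.oddFactor' o' * evenFactor o) ∧
      (evenFactor' (κ := κ) o * M.oddFactor o' = M.oddFactor o' * evenFactor' o) ∧
      (evenFactor' (κ := κ) o * M.oddFactor' o' = M.oddFactor' o' * evenFactor' o) := by
  rcases o with o | o <;> rcases o' with o' | o' <;>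
    exact ⟨ModelSpace.hom_ext fun _ _ => rfl, ModelSpace.hom_ext fun _ _ => rfl,
      ModelSpace.hom_ext fun _ _ => rfl, ModelSpace.hom_ext fun _ _ => rfl⟩

theorem evenFactor_comm : ∀ o o' : P ⊕ P,
    (evenFactor o * evenFactor o' : Module.End ℂ (ModelSpace P κ C)) =
      evenFactor o' * evenFactor o
  | Sum.inl _, Sum.inl _ => derX_mul_derX _ _
  | Sum.inr _, Sum.inr _ => mulX_mul_mulX _ _
  | Sum.inl o, Sum.inr o' => by
    have := derX_mul_mulX (C := C) (evenPartner (κ := κ) (Sum.inl o)) (evenPartner (Sum.inr o'))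
    rwa [if_neg (evenPartner_injective.ne (by simp)), add_zero] at this
  | Sum.inr o, Sum.inl o' => by
    have := derX_mul_mulX (C := C) (evenPartner (κ := κ) (Sum.inl o')) (evenPartner (Sum.inr o))
    rw [if_neg (evenPartner_injective.ne (by simp)), add_zero] at this
    exact this.symm

theorem evenFactor'_comm : ∀ o o' : P ⊕ P,
    (evenFactor' o * evenFactor' o' : Module.End ℂ (ModelSpace P κ C)) =
      evenFactor' o' * evenFactor' o
  | Sum.inl _, Sum.inl _ => mulX_mul_mulX _ _
  | Sum.inr _, Sum.inr _ => derX_mul_derX _ _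
  | Sum.inr o, Sum.inl o' => by
    have := derX_mul_mulX (C := C) (evenPartner (κ := κ) (Sum.inr o)) (evenPartner (Sum.inl o'))
    rwa [if_neg (evenPartner_injective.ne (by simp)), add_zero] at this
  | Sum.inl o, Sum.inr o' => by
    have := derX_mul_mulX (C := C) (evenPartner (κ := κ) (Sum.inr o')) (evenPartner (Sum.inl o))
    rw [if_neg (evenPartner_injective.ne (by simp)), add_zero] at this
    exact this.symm

theorem evenFactor_comm' : ∀ o o' : P ⊕ P, o ≠ o' →
    (evenFactor o * evenFactor' o' : Module.End ℂ (ModelSpace P κ C)) =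
      evenFactor' o' * evenFactor o
  | Sum.inl o, Sum.inl o', h => by
    have := derX_mul_mulX (C := C) (evenPartner (κ := κ) (Sum.inl o)) (evenPartner (Sum.inl o'))
    rwa [if_neg (evenPartner_injective.ne h), add_zero] at this
  | Sum.inr o, Sum.inr o', h => by
    have := derX_mul_mulX (C := C) (evenPartner (κ := κ) (Sum.inr o')) (evenPartner (Sum.inr o))
    rw [if_neg (evenPartner_injective.ne h.symm), add_zero] at this
    exact this.symm
  | Sum.inl _, Sum.inr _, _ => derX_mul_derX _ _
  | Sum.inr _, Sum.inl _, _ => mulX_mul_mulX _ _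

theorem create_annihilate_anticomm {o o' : P ⊕ P} (h : o ≠ o') :
    (M.create o * M.annihilate o' : Module.End ℂ (ModelSpace P κ C)) =
      -(M.annihilate o' * M.create o) := by
  rw [annihilate_mul_create, if_neg h.symm, zero_sub, neg_neg]

theorem annihilate_create_anticomm {o o' : P ⊕ P} (h : o ≠ o') :
    (M.annihilate o * M.create o' : Module.End ℂ (ModelSpace P κ C)) =
      -(M.create o' * M.annihilate o) := by
  rw [annihilate_mul_create, if_neg h, zero_sub]

theorem oddFactor_anticomm : ∀ o o' : P ⊕ P,
    (M.oddFactor o * M.oddFactor o' : Module.End ℂ (ModelSpace P κ C)) =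
      -(M.oddFactor o' * M.oddFactor o)
  | Sum.inl _, Sum.inl _ => M.create_mul_create _ _
  | Sum.inr _, Sum.inr _ => M.annihilate_mul_annihilate _ _
  | Sum.inl _, Sum.inr _ => M.create_annihilate_anticomm (by simp)
  | Sum.inr _, Sum.inl _ => M.annihilate_create_anticomm (by simp)

theorem oddFactor'_anticomm : ∀ o o' : P ⊕ P,
    (M.oddFactor' o * M.oddFactor' o' : Module.End ℂ (ModelSpace P κ C)) =
      -(M.oddFactor' o' * M.oddFactor' o)
  | Sum.inl _, Sum.inl _ => M.annihilate_mul_annihilate _ _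
  | Sum.inr _, Sum.inr _ => M.create_mul_create _ _
  | Sum.inr _, Sum.inl _ => M.create_annihilate_anticomm (by simp)
  | Sum.inl _, Sum.inr _ => M.annihilate_create_anticomm (by simp)

theorem oddFactor_anticomm' : ∀ o o' : P ⊕ P, o ≠ o' →
    (M.oddFactor o * M.oddFactor' o' : Module.End ℂ (ModelSpace P κ C)) =
      -(M.oddFactor' o' * M.oddFactor o)
  | Sum.inl _, Sum.inl _, h => M.create_annihilate_anticomm h
  | Sum.inr _, Sum.inr _, h => M.annihilate_create_anticomm h
  | Sum.inl _, Sum.inr _, _ => M.create_mul_create _ _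
  | Sum.inr _, Sum.inl _, _ => M.annihilate_mul_annihilate _ _

/-- The leading part of the differential. -/
def leading : Module.End ℂ (ModelSpace P κ C) :=
  ∑ o, evenFactor o * M.oddFactor o

/-- The homotopy of the leading part of the differential. -/
def homotopy : Module.End ℂ (ModelSpace P κ C) :=
  ∑ o, evenFactor' o * M.oddFactor' o

/-- The number of paired letters. -/
def pairCount (j : (P ⊕ (P ⊕ κ) →₀ ℕ) × List (P ⊕ P)) : ℕ :=
  ∑ o, j.1 (evenPartner o) + j.2.length

theorem leading_mul_leading : M.leading (κ := κ) * M.leading = 0 :=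
  sum_mul_sum_eq_zero (fun o o' => (M.even_mul_odd o o').1) evenFactor_comm M.oddFactor_anticomm

theorem homotopy_mul_homotopy : M.homotopy (κ := κ) * M.homotopy = 0 :=
  sum_mul_sum_eq_zero (fun o o' => (M.even_mul_odd o o').2.2.2) evenFactor'_comm
    M.oddFactor'_anticomm

/-- By the canonical relations, `∂x · c c* + x∂ · c* c = (x∂ + 1) c c* + x∂ (1 - c c*) = x∂ + c c*`
for a single pair. Exchanging the roles of derivative and multiplication, and of creation and
annihilation, gives the same operator, so both kinds of pairs contribute number operators. -/
theorem laplacian_eq : M.leading (κ := κ) * M.homotopy + M.homotopy * M.leading =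
    ∑ o, (mulX (evenPartner o) * derX (evenPartner o) + M.create o * M.annihilate o) := by
  rw [leading, homotopy, sum_mul_sum_add (fun o o' => (M.even_mul_odd o o').2.1)
    (fun o o' => (M.even_mul_odd o o').2.2.1) evenFactor_comm' M.oddFactor_anticomm']
  refine Finset.sum_congr rfl fun o _ => ?_
  rcases o with o | o <;>
    simp only [evenFactor, evenFactor', oddFactor, oddFactor', Sum.elim_inl, Sum.elim_inr,
      annihilate_mul_create, derX_mul_mulX, if_true] <;> noncomm_ring

/-- This is the fermion number, computed from the anticommutation relations alone. Words with
repeated letters need no separate case. -/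
theorem sum_create_annihilate (a : P ⊕ (P ⊕ κ) →₀ ℕ) (l : List (P ⊕ P)) :
    ∑ o, M.create o (M.annihilate o (M.basisVec (a, l))) = (l.length : ℂ) • M.basisVec (a, l) := by
  induction l with
  | nil => simp [basisVec, state, annihilate_pureTensor, M.K_vac]
  | cons o' l ih =>
    rw [← M.create_basisVec o' (a, l)]
    have h : ∀ o, M.create o (M.annihilate o (M.create o' (M.basisVec (a, l)))) =
        (if o = o' then M.create o (M.basisVec (a, l)) else 0) +
        M.create o' (M.create o (M.annihilate o (M.basisVec (a, l)))) := by
      intro o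
      have := LinearMap.congr_fun (M.create_mul_create (κ := κ) o o')
        (M.annihilate o (M.basisVec (a, l)))
      simp only [Module.End.mul_apply, LinearMap.neg_apply] at this
      rw [annihilate_create, map_sub, this, sub_neg_eq_add]
      split_ifs <;> simp
    rw [Finset.sum_congr rfl fun o _ => h o, Finset.sum_add_distrib, ← map_sum, ih]
    simp only [Finset.sum_ite_eq', Finset.mem_univ, if_true, map_smul, List.length_cons]
    push_cast
    rw [add_smul, one_smul, add_comm]

theorem laplacian_basisVec (j : (P ⊕ (P ⊕ κ) →₀ ℕ) × List (P ⊕ P)) :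
    (M.leading * M.homotopy + M.homotopy * M.leading : Module.End ℂ (ModelSpace P κ C))
        (M.basisVec j) =
      (pairCount j : ℂ) • M.basisVec j := by
  have h1 : ∀ i, mulX i (derX i (M.basisVec j)) = (j.1 i : ℂ) • M.basisVec j := by
    intro i
    rw [derX_basisVec, map_smul, mulX_basisVec]
    by_cases h : j.1 i = 0
    · simp [h]
    · have : j.1 - Finsupp.single i 1 + Finsupp.single i 1 = j.1 :=
        tsub_add_cancel_of_le (by simpa using Nat.one_le_iff_ne_zero.mpr h)
      simp only [this]
  rw [laplacian_eq, LinearMap.sum_apply]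
  simp only [LinearMap.add_apply, Module.End.mul_apply, h1, Finset.sum_add_distrib,
    M.sum_create_annihilate j.1 j.2, ← Finset.sum_smul, ← add_smul, pairCount]
  push_cast
  rfl

/-- An odd letter carries the weight of its even partner precisely so that exchanging the two leaves
the total weight unchanged. -/
theorem leading_bidegree : M.HasBidegree (κ := κ) w M.leading 0 1 := by
  refine .sum fun o => ?_
  rcases o with o | o
  · exact (M.derX_bidegree w _).mul (M.create_bidegree w (Sum.inl o)) (by simp) (by simp [letterDeg])
  · exact (M.mulX_bidegree w _).mul (M.annihilate_bidegree w (Sum.inr o)) (by simp)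
      (by simp [letterDeg])

theorem homotopy_bidegree : M.HasBidegree (κ := κ) w M.homotopy 0 (-1) := by
  refine .sum fun o => ?_
  rcases o with o | o
  · exact (M.mulX_bidegree w _).mul (M.annihilate_bidegree w (Sum.inl o)) (by simp)
      (by simp [letterDeg])
  · exact (M.derX_bidegree w _).mul (M.create_bidegree w (Sum.inr o)) (by simp) (by simp [letterDeg])

/-- The span of the basis vectors of weight at most `p`. -/
def filtration (p : ℤ) : Submodule ℂ (ModelSpace P κ C) :=
  Submodule.span ℂ {x | ∃ j, weight w j ≤ p ∧ x = M.basisVec j}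

/-- The span of the basis vectors of degree `k`. -/
def gradedPart (k : ℤ) : Submodule ℂ (ModelSpace P κ C) :=
  Submodule.span ℂ {x | ∃ j, (j.2.map letterDeg).sum = k ∧ x = M.basisVec j}

variable {M w}

theorem HasBidegree.mem_filtration {T : Module.End ℂ (ModelSpace P κ C)}
    {c k : ℤ} (h : M.HasBidegree w T c k) {p q : ℤ} (hpq : p + c ≤ q) {x}
    (hx : x ∈ M.filtration w p) : T x ∈ M.filtration w q := by
  induction hx using Submodule.span_induction with
  | mem x hx =>
    obtain ⟨j, hj, rfl⟩ := hx
    refine Submodule.span_mono ?_ (h _ _ _ (M.basisVec_mem_piece j))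
    rintro _ ⟨j', hj', -, rfl⟩
    exact ⟨j', by linarith, rfl⟩
  | zero => simp
  | add x y _ _ hx hy => rw [map_add]; exact add_mem hx hy
  | smul r x _ hx => rw [map_smul]; exact Submodule.smul_mem _ _ hx

theorem HasBidegree.mem_gradedPart {T : Module.End ℂ (ModelSpace P κ C)}
    {c k : ℤ} (h : M.HasBidegree w T c k) {p : ℤ} {x}
    (hx : x ∈ M.gradedPart p) : T x ∈ M.gradedPart (p + k) := by
  induction hx using Submodule.span_induction with
  | mem x hx =>
    obtain ⟨j, rfl, rfl⟩ := hx
    refine Submodule.span_mono ?_ (h _ _ _ (M.basisVec_mem_piece j))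
    rintro _ ⟨j', -, hj', rfl⟩
    exact ⟨j', hj', rfl⟩
  | zero => simp
  | add x y _ _ hx hy => rw [map_add]; exact add_mem hx hy
  | smul r x _ hx => rw [map_smul]; exact Submodule.smul_mem _ _ hx

variable (M w)

theorem filtration_mono : Monotone (M.filtration w) :=
  fun _ _ h => Submodule.span_mono fun _ ⟨j, hj, e⟩ => ⟨j, hj.trans h, e⟩

theorem weight_nonneg (hw : ∀ i, 0 ≤ w i) (j : (P ⊕ (P ⊕ κ) →₀ ℕ) × List (P ⊕ P)) :
    0 ≤ weight w j :=
  add_nonneg (Finset.sum_nonneg fun i _ => mul_nonneg (by positivity) (hw i))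
    (List.sum_nonneg (by
      simp only [List.mem_map]
      rintro _ ⟨o, -, rfl⟩
      exact hw _))

theorem filtration_of_neg (hw : ∀ i, 0 ≤ w i) : M.filtration w (-1) = ⊥ := by
  rw [filtration, Submodule.span_eq_bot]
  rintro _ ⟨j, hj, -⟩
  have := weight_nonneg w hw j
  omega

theorem exists_mem_filtration (x) : ∃ p : ℕ, x ∈ M.filtration (κ := κ) w p := by
  induction M.span_basisVec (κ := κ) (Submodule.mem_top (x := x)) using
    Submodule.span_induction with
  | mem x hx =>
    obtain ⟨j, rfl⟩ := hx
    exact ⟨(weight w j).toNat, Submodule.subset_span ⟨j, Int.self_le_toNat _, rfl⟩⟩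
  | zero => exact ⟨0, zero_mem _⟩
  | add x y _ _ hx hy =>
    obtain ⟨p, hp⟩ := hx
    obtain ⟨q, hq⟩ := hy
    exact ⟨p + q, add_mem (M.filtration_mono w (by omega) hp)
      (M.filtration_mono w (by omega) hq)⟩
  | smul r x _ hx => obtain ⟨p, hp⟩ := hx; exact ⟨p, Submodule.smul_mem _ _ hp⟩

/-- The leading part of the differential contracts onto the span of the basis vectors without
paired letters. -/
theorem exists_gradedContraction (hw : ∀ i, 0 ≤ w i) :
    ∃ h e : Module.End ℂ (ModelSpace P κ C),
      GradedContraction (M.filtration w) M.gradedPart M.leading h e ∧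
      ∀ j, e (M.basisVec j) = if pairCount j = 0 then M.basisVec j else 0 := by
  set T := M.leading (κ := κ) * M.homotopy + M.homotopy * M.leading with hT
  -- `s` divides by the number of paired letters, with the value `0⁻¹ = 0` where there are none; `e`
  -- projects onto the latter part.
  obtain ⟨s, hs⟩ := exists_functionalCalculus T M.span_basisVec M.laplacian_basisVec
    fun n => (n : ℂ)⁻¹
  obtain ⟨e, he⟩ := exists_functionalCalculus T M.span_basisVec M.laplacian_basisVec
    fun n => if n = 0 then 1 else 0
  have hdd : ∀ x, M.leading (M.leading x) = 0 := LinearMap.congr_fun (M.leading_mul_leading (κ := κ))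
  have hhh : ∀ x, M.homotopy (M.homotopy x) = 0 :=
    LinearMap.congr_fun (M.homotopy_mul_homotopy (κ := κ))
  have hTx : ∀ x, T x = M.leading (M.homotopy x) + M.homotopy (M.leading x) := fun _ => rfl
  have hsj : ∀ j, s (M.basisVec j) = (pairCount j : ℂ)⁻¹ • M.basisVec j := fun j =>
    hs _ _ (M.laplacian_basisVec j)
  have hej : ∀ j, e (M.basisVec j) = if pairCount j = 0 then M.basisVec j else 0 := by
    intro j
    rw [he _ _ (M.laplacian_basisVec j)]
    split_ifs <;> simp
  -- Both the differential and the homotopy square to zero, so each commutes with the Laplacian and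
  -- preserves its eigenspaces. Hence `s` and `e` act on their values by scalars.
  have hTh : ∀ j, T (M.homotopy (M.basisVec j)) = (pairCount j : ℂ) • M.homotopy (M.basisVec j) := by
    intro j
    rw [← map_smul, ← M.laplacian_basisVec, ← hT, hTx, hTx, map_add, hhh, map_zero, zero_add,
      hhh, add_zero]
  have hTd : ∀ j, T (M.leading (M.basisVec j)) = (pairCount j : ℂ) • M.leading (M.basisVec j) := by
    intro j
    rw [← map_smul, ← M.laplacian_basisVec, ← hT, hTx, hTx, map_add, hdd, map_zero, add_zero,
      hdd, zero_add]
  have ext : ∀ {f g : Module.End ℂ (ModelSpace P κ C)},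
      (∀ j, f (M.basisVec j) = g (M.basisVec j)) → ∀ x, f x = g x := by
    intro f g h x
    have : f = g := LinearMap.ext_on (eq_top_iff.mpr M.span_basisVec) (by rintro _ ⟨j, rfl⟩; exact h j)
    rw [this]
  have hs_bi : M.HasBidegree w s 0 0 := .of_basisVec fun j => by
    rw [hsj, add_zero, add_zero]
    exact Submodule.smul_mem _ _ (M.basisVec_mem_piece j)
  have hh_bi : M.HasBidegree w (M.homotopy * s) 0 (-1) :=
    (M.homotopy_bidegree w).mul hs_bi (by simp) (by simp)
  refine ⟨M.homotopy * s, e, ?_, hej⟩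
  refine
    { mono := M.filtration_mono w
      neg := M.filtration_of_neg w hw
      top := M.exists_mem_filtration w
      d_d := hdd
      h_h := ext (f := (M.homotopy * s) * (M.homotopy * s)) (g := 0) fun j => ?_
      e_h := ext (f := e * (M.homotopy * s)) (g := 0) fun j => ?_
      h_e := ext (f := (M.homotopy * s) * e) (g := 0) fun j => ?_
      d_e := ext (f := M.leading * e) (g := 0) fun j => ?_
      homotopy := ext (f := M.leading * (M.homotopy * s) + (M.homotopy * s) * M.leading)
        (g := 1 - e) fun j => ?_
      d_mem := fun k x hx => (M.leading_bidegree w).mem_gradedPart hx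
      h_mem := fun k x hx => hh_bi.mem_gradedPart hx
      e_eq := fun k x hk hx => ?_
      e_mem := fun x => ?_
      d_fil := fun p x hx => (M.leading_bidegree w).mem_filtration (by simp) hx
      h_fil := fun p x hx => hh_bi.mem_filtration (by simp) hx }
  · simp only [Module.End.mul_apply, hsj, map_smul, hs _ _ (hTh j), hhh, smul_zero,
      LinearMap.zero_apply]
  · simp only [Module.End.mul_apply, hsj, map_smul, he _ _ (hTh j), LinearMap.zero_apply]
    by_cases h : pairCount j = 0 <;> simp [h]
  · simp only [Module.End.mul_apply, hej, LinearMap.zero_apply]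
    by_cases h : pairCount j = 0 <;> simp [h, hsj]
  · simp only [Module.End.mul_apply, hej, LinearMap.zero_apply]
    split_ifs with h
    -- Without paired letters every derivative meets a zero exponent and every annihilator meets the
    -- vacuum.
    · obtain ⟨a, l⟩ := j
      simp only [pairCount, Nat.add_eq_zero_iff, Finset.sum_eq_zero_iff, Finset.mem_univ,
        true_imp_iff, List.length_eq_zero_iff] at h
      obtain ⟨ha, rfl⟩ := h
      rw [leading, LinearMap.sum_apply]
      refine Finset.sum_eq_zero fun o _ => ?_
      rw [(M.even_mul_odd o o).1]
      rcases o with o | o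
      · simp only [evenFactor, Sum.elim_inl, Module.End.mul_apply, derX_basisVec, ha]
        simp
      · rw [← (M.even_mul_odd _ _).1]
        simp [oddFactor, basisVec, state, annihilate_pureTensor, M.K_vac]
    · simp
  · simp only [Module.End.mul_apply, LinearMap.add_apply, hsj, map_smul, hs _ _ (hTd j),
      LinearMap.sub_apply, Module.End.one_apply, hej, ← smul_add]
    rw [← hTx, M.laplacian_basisVec, smul_smul]
    by_cases h : pairCount j = 0
    · simp [h]
    · rw [inv_mul_cancel₀ (by exact_mod_cast h)]; simp [h]
  · induction hx using Submodule.span_induction with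
    | mem x hx =>
      obtain ⟨⟨a, l⟩, hj, rfl⟩ := hx
      rw [hej, if_neg]
      intro h
      simp only [pairCount, Nat.add_eq_zero_iff, List.length_eq_zero_iff] at h
      exact hk (by rw [← hj, h.2]; rfl)
    | zero => simp
    | add x y _ _ hx hy => rw [map_add, hx, hy, add_zero]
    | smul r x _ hx => rw [map_smul, hx, smul_zero]
  · induction M.span_basisVec (κ := κ) (Submodule.mem_top (x := x)) using
      Submodule.span_induction with
    | mem x hx =>
      obtain ⟨⟨a, l⟩, rfl⟩ := hx
      rw [hej]
      split_ifs with h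
      · simp only [pairCount, Nat.add_eq_zero_iff, List.length_eq_zero_iff] at h
        exact Submodule.subset_span ⟨_, by rw [h.2]; rfl, rfl⟩
      · exact zero_mem _
    | zero => simp
    | add x y _ _ hx hy => rw [map_add]; exact add_mem hx hy
    | smul r x _ hx => rw [map_smul]; exact Submodule.smul_mem _ _ hx

end Fermions
end Model

/-! ### Comparison of a deformed algebra with the model. -/

section Comparison

open MvPolynomial

variable {P κ C A : Type*} [Fintype P] [DecidableEq P] [Fintype κ] [DecidableEq κ]
  [AddCommGroup C] [Module ℂ C] [Ring A] [Algebra ℂ A]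

namespace Fermions

variable (M : Fermions (P ⊕ P) C)

/-- Anticommuted towards the vacuum, the annihilator deletes one occurrence of `o` in each term that
arises. The additive function `u` is left free, to be specialized to the weight and to the ghost
degree. -/
theorem K_state_mem (u : P ⊕ P → ℤ) (o : P ⊕ P) (l : List (P ⊕ P)) :
    M.K o (M.state l) ∈ Submodule.span ℂ {c | ∃ l' : List (P ⊕ P), l'.length ≤ l.length ∧
      (l'.map u).sum = (l.map u).sum - u o ∧ c = M.state l'} := by
  induction l with
  | nil => simp [state, M.K_vac]
  | cons o' l ih =>
    have h := LinearMap.congr_fun (M.K_mul_W o o') (M.state l)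
    rw [state_cons, ← Module.End.mul_apply, h, LinearMap.sub_apply]
    refine sub_mem ?_ ?_
    · split_ifs with ho
      · subst ho
        exact Submodule.subset_span ⟨l, by simp, by simp, rfl⟩
      · exact zero_mem _
    · rw [Module.End.mul_apply]
      generalize M.K o (M.state l) = c at ih
      induction ih using Submodule.span_induction with
      | mem x hx =>
        obtain ⟨l', h1, h2, rfl⟩ := hx
        refine Submodule.subset_span ⟨o' :: l', by simpa using h1, ?_, (M.state_cons _ _).symm⟩
        simp only [List.map_cons, List.sum_cons, h2]
        ring
      | zero => simp
      | add x y _ _ hx hy => rw [map_add]; exact add_mem hx hy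
      | smul r x _ hx => rw [map_smul]; exact Submodule.smul_mem _ _ hx

variable {M}

/-- Left multiplication by the odd letters acts on the fermionic space by creation operators, plus
an annihilation operator for the antighosts. -/
structure IsCliffordAction (M : Fermions (P ⊕ P) C) (ξ : P ⊕ P → A) (j : C →ₗ[ℂ] A) : Prop where
  vac : j M.vac = 1
  ghost : ∀ α c, ξ (Sum.inl α) * j c = j (M.W (Sum.inl α) c)
  antighost : ∀ α c, ξ (Sum.inr α) * j c = j (M.W (Sum.inr α) c) + j (M.K (Sum.inl α) c)

/-- Creating an antighost differs from multiplying by it through a contraction with the conjugate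
ghost, so a state is a word in the letters up to contracted words. `hK` says that deleting the ghost
costs no more than adding the antighost. -/
theorem IsCliffordAction.state_mem {ξ : P ⊕ P → A} {j : C →ₗ[ℂ] A} (hj : M.IsCliffordAction ξ j)
    (Y : ℤ → Submodule ℂ A) (u : P ⊕ P → ℤ) (h1 : 1 ∈ Y 0)
    (hξ : ∀ o p y, y ∈ Y p → ξ o * y ∈ Y (p + u o))
    (hK : ∀ γ p, Y (p - u (Sum.inl γ)) ≤ Y (p + u (Sum.inr γ))) (l : List (P ⊕ P)) :
    j (M.state l) ∈ Y (l.map u).sum := by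
  -- Induction on a bound for the length, because the contraction term involves words other than the
  -- tail.
  have key : ∀ n : ℕ, ∀ l : List (P ⊕ P), l.length ≤ n → j (M.state l) ∈ Y (l.map u).sum := by
    intro n
    induction n with
    | zero =>
      intro l hl
      obtain rfl : l = [] := List.eq_nil_of_length_eq_zero (by omega)
      simpa [state, hj.vac] using h1
    | succ n ih =>
      intro l hl
      cases l with
      | nil => simpa [state, hj.vac] using h1
      | cons o l =>
        have hl' : l.length ≤ n := by simpa using hl
        have h2 := hξ o _ _ (ih l hl')
        rw [state_cons, List.map_cons, List.sum_cons, add_comm]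
        rcases o with α | γ
        · rwa [hj.ghost] at h2
        · rw [hj.antighost] at h2
          refine (add_mem_cancel_right ?_).mp h2
          apply hK
          have h3 := M.K_state_mem u (Sum.inl γ) l
          generalize M.K (Sum.inl γ) (M.state l) = c at h3
          induction h3 using Submodule.span_induction with
          | mem x hx =>
            obtain ⟨l', h4, h5, rfl⟩ := hx
            rw [← h5]
            exact ih l' (h4.trans hl')
          | zero => simp
          | add x y _ _ hx hy => rw [map_add]; exact add_mem hx hy
          | smul r x _ hx => rw [map_smul]; exact Submodule.smul_mem _ _ hx
  exact key _ l le_rfl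

/-- Only the derivative paired with `i` fails to commute with the variable, so the commutator is the
leading value of the differential on that letter. This is the counterpart in the model of the rule
`d_even` of `IsDeformation`. -/
theorem leading_mulX (i : P ⊕ (P ⊕ κ)) (v : ModelSpace P κ C) :
    M.leading (mulX i v) = mulX i (M.leading v) +
      Sum.elim (fun _ => 0) (Sum.elim (fun α => M.create (Sum.inl α) v) fun _ => 0) i := by
  have h : ∀ o, (evenFactor o * M.oddFactor o : Module.End ℂ (ModelSpace P κ C)) (mulX i v) =
      mulX i ((evenFactor o * M.oddFactor o : Module.End ℂ (ModelSpace P κ C)) v) + if evenPartner o = i then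
        Sum.elim (fun α => M.create (Sum.inl α) v) (fun _ => 0) o else 0 := by
    intro o
    have hodd : ∀ v : ModelSpace P κ C, M.oddFactor o (mulX i v) = mulX i (M.oddFactor o v) := by
      intro v
      have : M.oddFactor o * mulX i = mulX (C := C) i * M.oddFactor o := by
        rcases o with o | o <;> exact ModelSpace.hom_ext fun _ _ => rfl
      exact LinearMap.congr_fun this v
    rw [Module.End.mul_apply, Module.End.mul_apply, hodd]
    rcases o with α | γ
    · have := LinearMap.congr_fun (derX_mul_mulX (C := C) (evenPartner (Sum.inl α)) i)
        (M.oddFactor (Sum.inl α) v)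
      simp only [Module.End.mul_apply, LinearMap.add_apply] at this
      simp only [evenFactor, Sum.elim_inl, this]
      congr 1
      split_ifs <;> rfl
    · have := LinearMap.congr_fun (mulX_mul_mulX (C := C) (evenPartner (Sum.inr γ)) i)
        (M.oddFactor (Sum.inr γ) v)
      simp only [Module.End.mul_apply] at this
      simp only [evenFactor, Sum.elim_inr, this, ite_self, add_zero]
  rw [leading, LinearMap.sum_apply, LinearMap.sum_apply, Finset.sum_congr rfl fun o _ => h o,
    Finset.sum_add_distrib, ← map_sum]
  congr 1
  rcases i with γ | α | k
  · refine Finset.sum_eq_zero fun o _ => ?_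
    rcases o with o | o <;> simp [evenPartner]
  · simp [Fintype.sum_sum_type, evenPartner]
  · refine Finset.sum_eq_zero fun o _ => ?_
    rcases o with o | o <;> simp [evenPartner]

/-- Only the annihilator of `o` itself fails to anticommute with its creation, and it occurs in the
differential for antighosts only. This is the counterpart of `d_odd`. -/
theorem leading_create (o : P ⊕ P) (v : ModelSpace P κ C) :
    M.leading (M.create o v) = -M.create o (M.leading v) +
      Sum.elim (fun _ => 0) (fun γ => mulX (Sum.inl γ) v) o := by
  have h : ∀ o', (evenFactor o' * M.oddFactor o' : Module.End ℂ (ModelSpace P κ C)) (M.create o v) =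
      -M.create o ((evenFactor o' * M.oddFactor o' : Module.End ℂ (ModelSpace P κ C)) v) +
        if o' = o then
        Sum.elim (fun _ => 0) (fun γ => mulX (Sum.inl γ) v) o' else 0 := by
    intro o'
    have heven : ∀ v : ModelSpace P κ C,
        evenFactor o' (M.create o v) = M.create o (evenFactor o' v) := by
      intro v
      have : evenFactor o' * M.create o = M.create (κ := κ) o * evenFactor o' := by
        rcases o' with o' | o' <;> exact ModelSpace.hom_ext fun _ _ => rfl
      exact LinearMap.congr_fun this v
    rw [Module.End.mul_apply, Module.End.mul_apply]
    rcases o' with α | γ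
    · have := LinearMap.congr_fun (M.create_mul_create (κ := κ) (Sum.inl α) o) v
      simp only [Module.End.mul_apply, LinearMap.neg_apply] at this
      simp only [oddFactor, Sum.elim_inl, this, map_neg, heven, ite_self, add_zero]
    · simp only [oddFactor, Sum.elim_inr, annihilate_create, map_sub, heven]
      rw [sub_eq_neg_add]
      congr 1
      split_ifs
      · rfl
      · simp
  rw [leading, LinearMap.sum_apply, LinearMap.sum_apply, Finset.sum_congr rfl fun o _ => h o,
    Finset.sum_add_distrib, Finset.sum_neg_distrib, ← map_sum]
  congr 1
  simp

end Fermions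

open Fermions

/-- The linear map from the model space given by ordered monomials in `x` followed by `j`. -/
def monomialMap (x : P ⊕ (P ⊕ κ) → A) (j : C →ₗ[ℂ] A) : ModelSpace P κ C →ₗ[ℂ] A :=
  TensorProduct.lift ((LinearMap.mul ℂ A).compl₁₂ (orderedMap x) j)

theorem monomialMap_pureTensor (x : P ⊕ (P ⊕ κ) → A) (j : C →ₗ[ℂ] A) (f) (c : C) :
    monomialMap x j (pureTensor f c) = orderedMap x f * j c := rfl

theorem monomialMap_basisVec (M : Fermions (P ⊕ P) C) (x : P ⊕ (P ⊕ κ) → A) (j : C →ₗ[ℂ] A) (b) :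
    monomialMap x j (M.basisVec b) = orderedMonomial x b.1 * j (M.state b.2) := by
  rw [basisVec, monomialMap_pureTensor, orderedMap_monomial]

/-- The filtration by words in the even letters `x` and the odd letters `ξ`. -/
abbrev letterFiltration (x : P ⊕ (P ⊕ κ) → A) (ξ : P ⊕ P → A) (w : P ⊕ (P ⊕ κ) → ℤ) :
    ℤ → Submodule ℂ A :=
  wordFiltration (Sum.elim x ξ) (Sum.elim w fun o => w (evenPartner o))

/-- An algebra with a differential generated by letters whose relations and differentials agree up
to lower order with those of the model. -/
structure IsDeformation (M : Fermions (P ⊕ P) C) (x : P ⊕ (P ⊕ κ) → A) (ξ : P ⊕ P → A)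
    (j : C →ₗ[ℂ] A) (w : P ⊕ (P ⊕ κ) → ℤ) (d : A →ₗ[ℂ] A) : Prop where
  one_le : ∀ i, 1 ≤ w i
  clifford : M.IsCliffordAction ξ j
  even_even : ∀ i i', x i * x i' - x i' * x i ∈ letterFiltration x ξ w (w i + w i' - 1)
  odd_even : ∀ o i, ξ o * x i - x i * ξ o ∈ letterFiltration x ξ w (w i + w (evenPartner o) - 1)
  d_one : d 1 = 0
  d_even : ∀ i y, d (x i * y) = d (x i) * y + x i * d y
  d_odd : ∀ o y, d (ξ o * y) = d (ξ o) * y - ξ o * d y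
  d_low : ∀ γ, d (x (Sum.inl γ)) ∈ letterFiltration x ξ w (w (Sum.inl γ) - 1)
  d_mid : ∀ α, d (x (Sum.inr (Sum.inl α))) - ξ (Sum.inl α) ∈
    letterFiltration x ξ w (w (Sum.inr (Sum.inl α)) - 1)
  d_free : ∀ k, d (x (Sum.inr (Sum.inr k))) ∈ letterFiltration x ξ w (w (Sum.inr (Sum.inr k)) - 1)
  d_ghost : ∀ α, d (ξ (Sum.inl α)) ∈ letterFiltration x ξ w (w (Sum.inr (Sum.inl α)) - 1)
  d_antighost : ∀ γ, d (ξ (Sum.inr γ)) - x (Sum.inl γ) ∈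
    letterFiltration x ξ w (w (Sum.inl γ) - 1)

namespace IsDeformation

variable {M : Fermions (P ⊕ P) C} {x : P ⊕ (P ⊕ κ) → A} {ξ : P ⊕ P → A} {j : C →ₗ[ℂ] A}
  {w : P ⊕ (P ⊕ κ) → ℤ} {d : A →ₗ[ℂ] A} (hD : IsDeformation M x ξ j w d)
include hD

omit hD in
theorem isRingFiltration : IsRingFiltration (letterFiltration x ξ w) :=
  isRingFiltration_wordFiltration _ _

omit hD in
theorem even_mem (i) : x i ∈ letterFiltration x ξ w (w i) :=
  letter_mem_wordFiltration (Sum.elim x ξ) (Sum.elim w fun o => w (evenPartner o)) (Sum.inl i)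

omit hD in
theorem odd_mem (o) : ξ o ∈ letterFiltration x ξ w (w (evenPartner o)) :=
  letter_mem_wordFiltration (Sum.elim x ξ) (Sum.elim w fun o => w (evenPartner o)) (Sum.inr o)

theorem state_mem (l : List (P ⊕ P)) :
    j (M.state l) ∈ letterFiltration x ξ w (l.map fun o => w (evenPartner o)).sum := by
  refine hD.clifford.state_mem _ _ isRingFiltration.one_mem (fun o p y hy => ?_)
    (fun γ p => isRingFiltration.mono ?_) l
  · exact isRingFiltration.mul_mem_of_le (by rw [add_comm]) (odd_mem o) hy
  · have h1 := hD.one_le (evenPartner (Sum.inl γ))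
    have h2 := hD.one_le (evenPartner (Sum.inr γ))
    omega

theorem K_state_mem (o : P ⊕ P) (l : List (P ⊕ P)) :
    j (M.K o (M.state l)) ∈ letterFiltration x ξ w
      ((l.map fun o => w (evenPartner o)).sum - w (evenPartner o)) := by
  have h3 := M.K_state_mem (fun o => w (evenPartner o)) o l
  generalize M.K o (M.state l) = c at h3
  induction h3 using Submodule.span_induction with
  | mem x hx =>
    obtain ⟨l', h4, h5, rfl⟩ := hx
    rw [← h5]
    exact hD.state_mem l'
  | zero => simp
  | add x y _ _ hx hy => rw [map_add]; exact add_mem hx hy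
  | smul r x _ hx => rw [map_smul]; exact Submodule.smul_mem _ _ hx

omit hD in
/-- A filtered linear statement about the model space only has to be checked on basis vectors. -/
theorem filtered_of_basisVec {Y : ℤ → Submodule ℂ A} (hY : Monotone Y) {f : ModelSpace P κ C →ₗ[ℂ] A}
    {c : ℤ} (h : ∀ b, f (M.basisVec b) ∈ Y (weight w b + c)) {p : ℤ} {v : ModelSpace P κ C}
    (hv : v ∈ M.filtration w p) : f v ∈ Y (p + c) := by
  induction hv using Submodule.span_induction with
  | mem v hv =>
    obtain ⟨b, hb, rfl⟩ := hv
    exact hY (by linarith) (h b)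
  | zero => simp
  | add x y _ _ hx hy => rw [map_add]; exact add_mem hx hy
  | smul r x _ hx => rw [map_smul]; exact Submodule.smul_mem _ _ hx

theorem monomialMap_mem {p : ℤ} {v : ModelSpace P κ C} (hv : v ∈ M.filtration w p) :
    monomialMap x j v ∈ letterFiltration x ξ w p := by
  rw [← add_zero p]
  refine filtered_of_basisVec isRingFiltration.mono (fun b => ?_) hv
  rw [monomialMap_basisVec]
  exact isRingFiltration.mul_mem_of_le (by simp [weight])
    (orderedMonomial_mem isRingFiltration even_mem b.1) (hD.state_mem b.2)

theorem even_mul_monomialMap (i) {p : ℤ} {v : ModelSpace P κ C} (hv : v ∈ M.filtration w p) :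
    x i * monomialMap x j v - monomialMap x j (mulX i v) ∈
      letterFiltration x ξ w (p + (w i - 1)) := by
  refine filtered_of_basisVec (f := LinearMap.mulLeft ℂ (x i) ∘ₗ monomialMap x j -
    monomialMap x j ∘ₗ mulX i) isRingFiltration.mono (fun b => ?_) hv
  rw [LinearMap.sub_apply, LinearMap.comp_apply, LinearMap.comp_apply, mulX_basisVec,
    monomialMap_basisVec, monomialMap_basisVec, LinearMap.mulLeft_apply, ← mul_assoc, ← sub_mul]
  exact isRingFiltration.mul_mem_of_le (by simp only [weight]; linarith)
    (mul_orderedMonomial_sub_mem isRingFiltration even_mem hD.even_even i b.1) (hD.state_mem b.2)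

/-- There are two errors: the commutators with the monomial that `ξ o` has to pass, and for an
antighost the contraction term. The latter loses the weight of a ghost instead of gaining that of
the antighost, and both weights are positive. -/
theorem odd_mul_monomialMap (o) {p : ℤ} {v : ModelSpace P κ C} (hv : v ∈ M.filtration w p) :
    ξ o * monomialMap x j v - monomialMap x j (M.create o v) ∈
      letterFiltration x ξ w (p + (w (evenPartner o) - 1)) := by
  refine filtered_of_basisVec (f := LinearMap.mulLeft ℂ (ξ o) ∘ₗ monomialMap x j -
    monomialMap x j ∘ₗ M.create o) isRingFiltration.mono (fun b => ?_) hv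
  rw [LinearMap.sub_apply, LinearMap.comp_apply, LinearMap.comp_apply, create_basisVec,
    monomialMap_basisVec, monomialMap_basisVec, LinearMap.mulLeft_apply, state_cons]
  have e : ξ o * (orderedMonomial x b.1 * j (M.state b.2)) -
      orderedMonomial x b.1 * j (M.W o (M.state b.2)) =
      (ξ o * orderedMonomial x b.1 - orderedMonomial x b.1 * ξ o) * j (M.state b.2) +
      orderedMonomial x b.1 * (ξ o * j (M.state b.2) - j (M.W o (M.state b.2))) := by noncomm_ring
  rw [e]
  refine add_mem (isRingFiltration.mul_mem_of_le (by simp only [weight]; linarith)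
    (commutator_orderedMonomial_mem isRingFiltration even_mem (hD.odd_even o) b.1)
    (hD.state_mem b.2)) ?_
  rcases o with α | γ
  · rw [hD.clifford.ghost, sub_self, mul_zero]
    exact zero_mem _
  · rw [hD.clifford.antighost, add_sub_cancel_left]
    refine isRingFiltration.mul_mem_of_le ?_
      (orderedMonomial_mem isRingFiltration even_mem b.1) (hD.K_state_mem (Sum.inl γ) b.2)
    have h1 := hD.one_le (evenPartner (Sum.inl γ))
    have h2 := hD.one_le (evenPartner (Sum.inr γ))
    simp only [weight]
    linarith

/-- Letters multiply in the algebra as they do in the model up to words of lower weight, which is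
the input of `wordFiltration_le`. With `monomialMap_mem` this makes the two filtrations correspond
exactly. -/
theorem letterFiltration_le (p : ℤ) :
    letterFiltration x ξ w p ≤ (M.filtration w p).map (monomialMap x j) := by
  refine wordFiltration_le _ _ ?_ (fun p q h => Submodule.map_mono (M.filtration_mono w h)) ?_ ?_ p
  · rintro (i | o)
    · exact zero_le_one.trans (hD.one_le i)
    · exact zero_le_one.trans (hD.one_le _)
  · refine ⟨M.basisVec (0, []), Submodule.subset_span ⟨_, by simp [weight, expWeight], rfl⟩, ?_⟩
    rw [monomialMap_basisVec]
    simp [state, hD.clifford.vac]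
  · rintro (i | o) p _ ⟨v, hv, rfl⟩
    · rw [← sub_add_cancel (_ * _) (monomialMap x j (mulX i v))]
      refine add_mem (Submodule.mem_sup_right ?_) (Submodule.mem_sup_left ?_)
      · rw [add_sub_assoc]
        exact hD.even_mul_monomialMap i hv
      · exact ⟨_, (M.mulX_bidegree w i).mem_filtration le_rfl hv, rfl⟩
    · rw [← sub_add_cancel (_ * _) (monomialMap x j (M.create o v))]
      refine add_mem (Submodule.mem_sup_right ?_) (Submodule.mem_sup_left ?_)
      · rw [add_sub_assoc]
        exact hD.odd_mul_monomialMap o hv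
      · exact ⟨_, (M.create_bidegree w o).mem_filtration le_rfl hv, rfl⟩

theorem d_even_mem (i) : d (x i) ∈ letterFiltration x ξ w (w i) := by
  rcases i with γ | α | k
  · exact isRingFiltration.mono (by linarith) (hD.d_low γ)
  · have := add_mem (isRingFiltration.mono (sub_le_self _ zero_le_one) (hD.d_mid α))
      (odd_mem (Sum.inl α))
    rwa [sub_add_cancel] at this
  · exact isRingFiltration.mono (by linarith) (hD.d_free k)

theorem d_odd_mem (o) : d (ξ o) ∈ letterFiltration x ξ w (w (evenPartner o)) := by
  rcases o with α | γ
  · exact isRingFiltration.mono (sub_le_self _ zero_le_one) (hD.d_ghost α)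
  · have := add_mem (isRingFiltration.mono (sub_le_self _ zero_le_one) (hD.d_antighost γ))
      (even_mem (Sum.inl γ))
    rwa [sub_add_cancel] at this

theorem d_mem {p : ℤ} {y : A} (hy : y ∈ letterFiltration x ξ w p) :
    d y ∈ letterFiltration x ξ w p := by
  induction hy using Submodule.span_induction with
  | mem y hy =>
    obtain ⟨l, hl, rfl⟩ := hy
    refine isRingFiltration.mono hl ?_
    clear hl
    induction l with
    | nil => simp [hD.d_one]
    | cons a l ih =>
      have hl : (l.map (Sum.elim x ξ)).prod ∈ letterFiltration x ξ w
        (l.map (Sum.elim w fun o => w (evenPartner o))).sum :=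
        Submodule.subset_span ⟨l, le_rfl, rfl⟩
      simp only [List.map_cons, List.prod_cons, List.sum_cons]
      rcases a with i | o
      · simp only [Sum.elim_inl]
        rw [hD.d_even]
        exact add_mem (isRingFiltration.mul_mem (hD.d_even_mem i) hl)
          (isRingFiltration.mul_mem (even_mem i) ih)
      · simp only [Sum.elim_inr]
        rw [hD.d_odd]
        exact sub_mem (isRingFiltration.mul_mem (hD.d_odd_mem o) hl)
          (isRingFiltration.mul_mem (odd_mem o) ih)
  | zero => simp
  | add x y _ _ hx hy => rw [map_add]; exact add_mem hx hy
  | smul r x _ hx => rw [map_smul]; exact Submodule.smul_mem _ _ hx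

/-- The discrepancy splits into four terms of lower order: the differential of the multiplication
error on `v` (`h1`), the multiplication error on the leading differential of `v` (`h2`), the
deviation of the differential of the letter from its leading value (`h4`), and the letter times the
discrepancy `h` already known. The proof of `d_create` has the same shape, with signs. -/
theorem d_mulX {p : ℤ} {v : ModelSpace P κ C} (hv : v ∈ M.filtration w p)
    (h : d (monomialMap x j v) - monomialMap x j (M.leading v) ∈ letterFiltration x ξ w (p - 1))
    (i) : d (monomialMap x j (mulX i v)) - monomialMap x j (M.leading (mulX i v)) ∈
      letterFiltration x ξ w (p + w i - 1) := by
  have h1 := hD.d_mem (hD.even_mul_monomialMap i hv)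
  have hlv : M.leading v ∈ M.filtration w p := (M.leading_bidegree w).mem_filtration (by simp) hv
  have h2 := hD.even_mul_monomialMap i hlv
  have h3 := isRingFiltration.mul_mem (even_mem (ξ := ξ) (x := x) (w := w) i) h
  have h4 : d (x i) * monomialMap x j v - monomialMap x j
      (Sum.elim (fun _ => 0) (Sum.elim (fun α => M.create (Sum.inl α) v) fun _ => 0) i) ∈
      letterFiltration x ξ w (p + (w i - 1)) := by
    rcases i with γ | α | k
    · simp only [Sum.elim_inl, map_zero, sub_zero]
      exact isRingFiltration.mul_mem_of_le (by linarith) (hD.d_low γ) (hD.monomialMap_mem hv)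
    · simp only [Sum.elim_inl, Sum.elim_inr]
      have h5 := isRingFiltration.mul_mem_of_le (add_comm _ _).le (hD.d_mid α)
        (hD.monomialMap_mem hv)
      have := add_mem h5 (hD.odd_mul_monomialMap (Sum.inl α) hv)
      rwa [sub_mul, sub_add_sub_cancel] at this
    · simp only [Sum.elim_inr, map_zero, sub_zero]
      exact isRingFiltration.mul_mem_of_le (by linarith) (hD.d_free k) (hD.monomialMap_mem hv)
  rw [map_sub, hD.d_even] at h1
  rw [leading_mulX, map_add]
  rw [← add_sub_assoc] at h1 h2 h4
  rw [add_sub_left_comm] at h3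
  have := add_mem (add_mem (sub_mem h4 h1) h2)
    (isRingFiltration.mono (by linarith : w i + (p - 1) ≤ p + w i - 1)
      (isRingFiltration.mul_mem (even_mem (ξ := ξ) (x := x) (w := w) i) h))
  convert this using 1
  noncomm_ring

theorem d_create {p : ℤ} {v : ModelSpace P κ C} (hv : v ∈ M.filtration w p)
    (h : d (monomialMap x j v) - monomialMap x j (M.leading v) ∈ letterFiltration x ξ w (p - 1))
    (o) : d (monomialMap x j (M.create o v)) - monomialMap x j (M.leading (M.create o v)) ∈
      letterFiltration x ξ w (p + w (evenPartner o) - 1) := by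
  have h1 := hD.d_mem (hD.odd_mul_monomialMap o hv)
  have hlv : M.leading v ∈ M.filtration w p := (M.leading_bidegree w).mem_filtration (by simp) hv
  have h2 := hD.odd_mul_monomialMap o hlv
  have h4 : d (ξ o) * monomialMap x j v - monomialMap x j
      (Sum.elim (fun _ => 0) (fun γ => mulX (Sum.inl γ) v) o) ∈
      letterFiltration x ξ w (p + (w (evenPartner o) - 1)) := by
    rcases o with α | γ
    · simp only [Sum.elim_inl, map_zero, sub_zero]
      exact isRingFiltration.mul_mem_of_le (add_comm _ _).le (hD.d_ghost α) (hD.monomialMap_mem hv)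
    · simp only [Sum.elim_inr]
      have h5 := isRingFiltration.mul_mem_of_le (add_comm _ _).le (hD.d_antighost γ)
        (hD.monomialMap_mem hv)
      have := add_mem h5 (hD.even_mul_monomialMap (Sum.inl γ) hv)
      rwa [sub_mul, sub_add_sub_cancel] at this
  rw [map_sub, hD.d_odd] at h1
  rw [leading_create, map_add, map_neg]
  rw [← add_sub_assoc] at h1 h2 h4
  have := sub_mem (sub_mem (sub_mem h4 h1) h2)
    (isRingFiltration.mono (by linarith : w (evenPartner o) + (p - 1) ≤ p + w (evenPartner o) - 1)
      (isRingFiltration.mul_mem (odd_mem (ξ := ξ) (x := x) (w := w) o) h))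
  convert this using 1
  noncomm_ring

theorem d_basisVec (b : (P ⊕ (P ⊕ κ) →₀ ℕ) × List (P ⊕ P)) :
    d (monomialMap x j (M.basisVec b)) - monomialMap x j (M.leading (M.basisVec b)) ∈
      letterFiltration x ξ w (weight w b - 1) := by
  have hb : ∀ b : (P ⊕ (P ⊕ κ) →₀ ℕ) × List (P ⊕ P), M.basisVec b ∈ M.filtration w (weight w b) :=
    fun b => Submodule.subset_span ⟨b, le_rfl, rfl⟩
  obtain ⟨a, l⟩ := b
  induction a using Finsupp.induction with
  | zero =>
    induction l with
    | nil =>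
      have h0 : M.leading (M.basisVec (κ := κ) (0, [])) = 0 := by
        rw [leading, LinearMap.sum_apply]
        refine Finset.sum_eq_zero fun o _ => ?_
        rcases o with o | o
        · rw [(M.even_mul_odd _ _).1]
          simp [evenFactor, derX_basisVec]
        · simp [oddFactor, basisVec, state, annihilate_pureTensor, M.K_vac]
      rw [h0, monomialMap_basisVec]
      simp [state, hD.clifford.vac, hD.d_one]
    | cons o l ih =>
      have := hD.d_create (hb _) ih o
      rw [create_basisVec] at this
      convert this using 2
      simp only [weight, List.map_cons, List.sum_cons]
      ring
  | single_add i n a _ _ ih =>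
    -- `d_mulX` adjoins a single letter, so a power is built one factor at a time.
    have key : ∀ n : ℕ, d (monomialMap x j (M.basisVec (Finsupp.single i n + a, l))) -
        monomialMap x j (M.leading (M.basisVec (Finsupp.single i n + a, l))) ∈
        letterFiltration x ξ w (weight w (Finsupp.single i n + a, l) - 1) := by
      intro n
      induction n with
      | zero => simpa using ih
      | succ n ihn =>
        have := hD.d_mulX (hb _) ihn i
        rw [mulX_basisVec] at this
        have e : Finsupp.single i n + a + Finsupp.single i 1 = Finsupp.single i (n + 1) + a := by
          rw [add_right_comm, ← Finsupp.single_add]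
        simp only [e] at this
        convert this using 2
        simp only [weight, ← e, expWeight_add_single]
        ring
    exact key n

theorem d_sub_leading_mem {p : ℤ} {v : ModelSpace P κ C} (hv : v ∈ M.filtration w p) :
    d (monomialMap x j v) - monomialMap x j (M.leading v) ∈ letterFiltration x ξ w (p - 1) :=
  filtered_of_basisVec (f := d ∘ₗ monomialMap x j - monomialMap x j ∘ₗ M.leading) (c := -1)
    isRingFiltration.mono hD.d_basisVec hv

omit hD in
/-- An idempotent onto the span of the basis vectors without paired letters has the polynomials in
the free variables as its range. -/
theorem nonempty_range_equiv (hvac : M.vac ≠ 0) {e : Module.End ℂ (ModelSpace P κ C)}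
    (he : ∀ b, e (M.basisVec b) = if pairCount b = 0 then M.basisVec b else 0) :
    Nonempty (MvPolynomial κ ℂ ≃ₗ[ℂ] LinearMap.range e) := by
  let f : MvPolynomial κ ℂ →ₗ[ℂ] ModelSpace P κ C :=
    (pureTensor (P := P) (κ := κ)).flip M.vac ∘ₗ
      (rename fun k => (Sum.inr (Sum.inr k) : P ⊕ (P ⊕ κ))).toLinearMap
  have hinj : Function.Injective f := by
    -- A functional that does not vanish on the vacuum recovers a polynomial from its tensor product
    -- with the vacuum.
    obtain ⟨φ, hφ⟩ : ∃ φ : Module.Dual ℂ C, φ M.vac ≠ 0 := by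
      by_contra! h
      exact hvac ((Module.forall_dual_apply_eq_zero_iff ℂ _).mp h)
    rw [injective_iff_map_eq_zero]
    intro p hp
    let ev : ModelSpace P κ C →ₗ[ℂ] MvPolynomial (P ⊕ (P ⊕ κ)) ℂ :=
      TensorProduct.lift ((LinearMap.lsmul ℂ _).flip.compl₂ φ)
    have h1 : ev (f p) = φ M.vac • rename (fun k => (Sum.inr (Sum.inr k) : P ⊕ (P ⊕ κ))) p := rfl
    rw [hp, map_zero] at h1
    have h2 := (smul_eq_zero.mp h1.symm).resolve_left hφ
    exact (rename_injective _ (Sum.inr_injective.comp Sum.inr_injective)) (h2.trans (map_zero _).symm)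
  have hmon : ∀ a : κ →₀ ℕ, f (monomial a 1) =
      M.basisVec (a.mapDomain fun k => (Sum.inr (Sum.inr k) : P ⊕ (P ⊕ κ)), []) := by
    intro a
    simp only [f, LinearMap.comp_apply, AlgHom.toLinearMap_apply, rename_monomial]
    simp [basisVec, state]
  have hrange : LinearMap.range f = LinearMap.range e := by
    apply le_antisymm
    · rintro _ ⟨p, rfl⟩
      induction p using MvPolynomial.induction_on' with
      | monomial a r =>
        rw [← mul_one r, ← smul_eq_mul, ← smul_monomial, map_smul, hmon]
        refine Submodule.smul_mem _ _ ⟨M.basisVec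
          (a.mapDomain fun k => (Sum.inr (Sum.inr k) : P ⊕ (P ⊕ κ)), []), ?_⟩
        rw [he, if_pos]
        simp only [pairCount, List.length_nil, add_zero, Finset.sum_eq_zero_iff]
        rintro o -
        refine Finsupp.mapDomain_of_notMem_range _ _ ?_
        rintro ⟨k, hk⟩
        rcases o with o | o <;> simp [evenPartner] at hk
      | add p q hp hq => rw [map_add]; exact add_mem hp hq
    · rintro _ ⟨y, rfl⟩
      have hy := M.span_basisVec (Submodule.mem_top (x := y))
      induction hy using Submodule.span_induction with
      | mem y hy =>
        obtain ⟨⟨a, l⟩, rfl⟩ := hy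
        rw [he]
        split_ifs with h
        · have hl : l = [] := List.eq_nil_of_length_eq_zero (by simp only [pairCount] at h; omega)
          have ha : ∀ o, a (evenPartner o) = 0 := by
            simp only [pairCount, Nat.add_eq_zero_iff, Finset.sum_eq_zero_iff] at h
            exact fun o => h.1 o (Finset.mem_univ o)
          subst hl
          refine ⟨monomial (a.comapDomain (fun k => (Sum.inr (Sum.inr k) : P ⊕ (P ⊕ κ)))
            (Sum.inr_injective.comp Sum.inr_injective).injOn) 1, ?_⟩
          rw [hmon]
          congr 2
          refine Finsupp.mapDomain_comapDomain _ (Sum.inr_injective.comp Sum.inr_injective) _ ?_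
          intro i hi
          rcases i with γ | α | k
          · exact absurd (ha (Sum.inr γ)) (Finsupp.mem_support_iff.mp hi)
          · exact absurd (ha (Sum.inl α)) (Finsupp.mem_support_iff.mp hi)
          · exact ⟨k, rfl⟩
        · exact zero_mem _
      | zero => simp
      | add x y _ _ hx hy => rw [map_add]; exact add_mem hx hy
      | smul r x _ hx => rw [map_smul]; exact Submodule.smul_mem _ _ hx
  exact ⟨LinearEquiv.ofInjective f hinj ≪≫ₗ LinearEquiv.ofEq _ _ hrange⟩

/-- A deformation of the model is contracted by the transported homotopy. -/
theorem exists_filteredContraction (hvac : M.vac ≠ 0) (hbij : Function.Bijective (monomialMap (κ := κ) x j))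
    {G : ℤ → Submodule ℂ A} (hG : ∀ k, G k = (M.gradedPart k).map (monomialMap x j))
    (hdd : ∀ y, d (d y) = 0) (hdG : ∀ k y, y ∈ G k → d y ∈ G (k + 1)) :
    ∃ F : ℤ → Submodule ℂ A, ∃ d' h e : Module.End ℂ A, FilteredContraction F G d d' h e ∧
      Nonempty (LinearMap.range e ≃ₗ[ℂ] MvPolynomial κ ℂ) := by
  obtain ⟨h, e, hC, he⟩ := M.exists_gradedContraction w fun i => zero_le_one.trans (hD.one_le i)
  let Ψ := LinearEquiv.ofBijective (monomialMap x j) hbij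
  -- Equality is needed: one inclusion lets the transported homotopy preserve the letter filtration,
  -- the other lets the perturbation lower it.
  have hF : ∀ p, letterFiltration x ξ w p = (M.filtration w p).map (monomialMap x j) := fun p =>
    le_antisymm (hD.letterFiltration_le p) (by rintro _ ⟨v, hv, rfl⟩; exact hD.monomialMap_mem hv)
  have hΨF : ∀ p y, y ∈ letterFiltration x ξ w p ↔ Ψ.symm y ∈ M.filtration w p := by
    intro p y
    rw [hF]
    refine ⟨?_, fun h => ⟨_, h, Ψ.apply_symm_apply y⟩⟩
    rintro ⟨v, hv, rfl⟩
    rwa [show monomialMap x j v = Ψ v from rfl, Ψ.symm_apply_apply]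
  have hΨG : ∀ k y, y ∈ G k ↔ Ψ.symm y ∈ M.gradedPart k := by
    intro p y
    rw [hG]
    refine ⟨?_, fun h => ⟨_, h, Ψ.apply_symm_apply y⟩⟩
    rintro ⟨v, hv, rfl⟩
    rwa [show monomialMap x j v = Ψ v from rfl, Ψ.symm_apply_apply]
  have hconj : ∀ (f : Module.End ℂ (ModelSpace P κ C)) y, Ψ.symm (Ψ.conj f y) = f (Ψ.symm y) :=
    fun f y => by simp [LinearEquiv.conj_apply]
  have hconj' : ∀ (f : Module.End ℂ (ModelSpace P κ C)) y, Ψ.conj f y = Ψ (f (Ψ.symm y)) :=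
    fun f y => by simp [LinearEquiv.conj_apply]
  refine ⟨letterFiltration x ξ w, Ψ.conj M.leading, Ψ.conj h, Ψ.conj e,
    { mono := isRingFiltration.mono
      neg := by rw [hF, hC.neg, Submodule.map_bot]
      top := fun y => by
        obtain ⟨p, hp⟩ := hC.top (Ψ.symm y)
        exact ⟨p, (hΨF _ _).mpr hp⟩
      d_d := fun y => Ψ.symm.injective (by simp only [hconj, hC.d_d, map_zero])
      h_h := fun y => Ψ.symm.injective (by simp only [hconj, hC.h_h, map_zero])
      e_h := fun y => Ψ.symm.injective (by simp only [hconj, hC.e_h, map_zero])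
      h_e := fun y => Ψ.symm.injective (by simp only [hconj, hC.h_e, map_zero])
      d_e := fun y => Ψ.symm.injective (by simp only [hconj, hC.d_e, map_zero])
      homotopy := fun y => Ψ.symm.injective (by
        simp only [hconj, map_add, map_sub, hC.homotopy])
      d_mem := fun k y hy => (hΨG _ _).mpr (by
        rw [hconj]; exact hC.d_mem _ _ ((hΨG _ _).mp hy))
      h_mem := fun k y hy => (hΨG _ _).mpr (by
        rw [hconj]; exact hC.h_mem _ _ ((hΨG _ _).mp hy))
      e_eq := fun k y hk hy => by
        rw [hconj', hC.e_eq k _ hk ((hΨG _ _).mp hy), map_zero]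
      e_mem := fun y => (hΨG _ _).mpr (by rw [hconj]; exact hC.e_mem _)
      d_fil := fun p y hy => (hΨF _ _).mpr (by
        rw [hconj]; exact hC.d_fil _ _ ((hΨF _ _).mp hy))
      h_fil := fun p y hy => (hΨF _ _).mpr (by
        rw [hconj]; exact hC.h_fil _ _ ((hΨF _ _).mp hy))
      D_D := hdd
      D_mem := hdG
      lower := fun p y hy => by
        have := hD.d_sub_leading_mem ((hΨF _ _).mp hy)
        rw [hconj']
        rwa [show monomialMap x j (Ψ.symm y) = y from Ψ.apply_symm_apply y] at this }, ?_⟩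
  obtain ⟨g⟩ := nonempty_range_equiv hvac he
  have hr : LinearMap.range (Ψ.conj e) = (LinearMap.range e).map Ψ.toLinearMap := by
    ext y
    constructor
    · rintro ⟨z, rfl⟩
      exact ⟨_, ⟨Ψ.symm z, rfl⟩, (hconj' e z).symm⟩
    · rintro ⟨_, ⟨z, rfl⟩, rfl⟩
      exact ⟨Ψ z, by rw [hconj', Ψ.symm_apply_apply]; rfl⟩
  exact ⟨LinearEquiv.ofEq _ _ hr ≪≫ₗ (Ψ.submoduleMap _).symm ≪≫ₗ g.symm⟩

end IsDeformation

end Comparison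

/-! ### BRST calculus of currents, ghosts and antighosts. -/

section GhostCalculus

variable {L A P : Type*} [LieRing L] [LieAlgebra ℂ L] [Ring A] [Algebra ℂ A] [Fintype P]
  [DecidableEq P]

/-- Currents `J`, ghosts `c` and antighosts `b` for the Lie subalgebra of `L` with basis `t`; the
functionals `τ` extend the dual basis. -/
structure GhostSystem (J : L →ₗ[ℂ] A) (c b : P → A) (t : P → L) (τ : P → Module.Dual ℂ L) :
    Prop where
  J_lie : ∀ x y, J x * J y - J y * J x = J ⁅x, y⁆
  J_c : ∀ x α, J x * c α = c α * J x
  J_b : ∀ x α, J x * b α = b α * J x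
  c_c : ∀ α β, c α * c β = -(c β * c α)
  b_b : ∀ α β, b α * b β = -(b β * b α)
  b_c : ∀ α β, b α * c β = (if α = β then 1 else 0) - c β * b α
  τ_t : ∀ α β, τ α (t β) = if α = β then 1 else 0
  t_lie : ∀ α β, ⁅t α, t β⁆ = ∑ γ, τ γ ⁅t α, t β⁆ • t γ

section Operators

variable (J : L →ₗ[ℂ] A) (c b : P → A) (t : P → L) (τ : P → Module.Dual ℂ L)

/-- The antighost attached to a vector. -/
def antighostOf : L →ₗ[ℂ] A := ∑ γ, (τ γ).smulRight (b γ)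

/-- The projection to the span of the `t γ`. -/
def lowerProj : L →ₗ[ℂ] L := ∑ γ, (τ γ).smulRight (t γ)

/-- The ghost current. -/
def ghostCurrent : L →ₗ[ℂ] A where
  toFun x := ∑ β, antighostOf b τ ⁅x, t β⁆ * c β
  map_add' x y := by simp only [add_lie, map_add, add_mul, Finset.sum_add_distrib]
  map_smul' r x := by
    simp only [smul_lie, map_smul, smul_mul_assoc, Finset.smul_sum, RingHom.id_apply]

/-- The total current. -/
def totalCurrent : L →ₗ[ℂ] A := J + ghostCurrent c b t τ

/-- The charge with character `χ`. -/
def charge (χ : L →ₗ[ℂ] ℂ) : A :=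
  ∑ α, (J (t α) - algebraMap ℂ A (χ (t α)) + (1 / 2 : ℂ) • ghostCurrent c b t τ (t α)) * c α

end Operators

variable {J : L →ₗ[ℂ] A} {c b : P → A} {t : P → L} {τ : P → Module.Dual ℂ L}

theorem antighostOf_apply (x : L) : antighostOf b τ x = ∑ γ, τ γ x • b γ := by
  simp [antighostOf]

theorem lowerProj_apply (x : L) : lowerProj t τ x = ∑ γ, τ γ x • t γ := by
  simp [lowerProj]

theorem ghostCurrent_apply (x : L) :
    ghostCurrent c b t τ x = ∑ β, antighostOf b τ ⁅x, t β⁆ * c β := rfl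

namespace GhostSystem

variable (S : GhostSystem J c b t τ)
include S

theorem antighostOf_t (δ : P) : antighostOf b τ (t δ) = b δ := by
  simp [antighostOf_apply, S.τ_t]

theorem lowerProj_t (δ : P) : lowerProj t τ (t δ) = t δ := by
  simp [lowerProj_apply, S.τ_t]

theorem lowerProj_t_lie (α β : P) : lowerProj t τ ⁅t α, t β⁆ = ⁅t α, t β⁆ := by
  rw [lowerProj_apply, ← S.t_lie]

theorem antighostOf_mul_antighostOf (x y : L) :
    antighostOf b τ x * antighostOf b τ y = -(antighostOf b τ y * antighostOf b τ x) := by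
  simp only [antighostOf_apply, Finset.sum_mul_sum]
  rw [Finset.sum_comm, ← Finset.sum_neg_distrib]
  refine Finset.sum_congr rfl fun α _ => ?_
  rw [← Finset.sum_neg_distrib]
  refine Finset.sum_congr rfl fun β _ => ?_
  rw [smul_mul_smul_comm, smul_mul_smul_comm, S.b_b β α, mul_comm, smul_neg]

theorem antighostOf_mul_ghost (x : L) (β : P) :
    antighostOf b τ x * c β = algebraMap ℂ A (τ β x) - c β * antighostOf b τ x := by
  simp only [antighostOf_apply, Finset.sum_mul, Finset.mul_sum, smul_mul_assoc, S.b_c, smul_sub,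
    mul_smul_comm, Finset.sum_sub_distrib]
  simp [Algebra.algebraMap_eq_smul_one]

theorem ghost_mul_antighostOf (x : L) (β : P) :
    c β * antighostOf b τ x = algebraMap ℂ A (τ β x) - antighostOf b τ x * c β := by
  rw [S.antighostOf_mul_ghost, sub_sub_cancel]

theorem J_mul_antighostOf (x y : L) : J x * antighostOf b τ y = antighostOf b τ y * J x := by
  simp only [antighostOf_apply, Finset.sum_mul, Finset.mul_sum, smul_mul_assoc, mul_smul_comm, S.J_b]

theorem J_mul_ghostCurrent (x y : L) :
    J x * ghostCurrent c b t τ y = ghostCurrent c b t τ y * J x := by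
  simp only [ghostCurrent_apply, Finset.sum_mul, Finset.mul_sum]
  refine Finset.sum_congr rfl fun β _ => ?_
  rw [← mul_assoc, S.J_mul_antighostOf, mul_assoc, S.J_c, mul_assoc]

/-- Contracting the ghosts of the current with `b(y)` replaces `y` by its projection to the span of
the `t γ`; what is left is the adjoint action. -/
theorem ghostCurrent_antighostOf (x y : L) :
    ghostCurrent c b t τ x * antighostOf b τ y - antighostOf b τ y * ghostCurrent c b t τ x =
      antighostOf b τ ⁅x, lowerProj t τ y⁆ := by
  simp only [ghostCurrent_apply, Finset.sum_mul, Finset.mul_sum, lowerProj_apply, lie_sum, map_sum,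
    lie_smul, map_smul, ← Finset.sum_sub_distrib]
  refine Finset.sum_congr rfl fun β _ => ?_
  rw [mul_assoc, S.ghost_mul_antighostOf, mul_sub, ← Algebra.commutes, ← Algebra.smul_def,
    ← mul_assoc, S.antighostOf_mul_antighostOf, neg_mul, mul_assoc]
  abel

theorem ghostCurrent_ghost (x : L) (α : P) :
    ghostCurrent c b t τ x * c α - c α * ghostCurrent c b t τ x = -∑ β, τ α ⁅x, t β⁆ • c β := by
  simp only [ghostCurrent_apply, Finset.sum_mul, Finset.mul_sum, ← Finset.sum_sub_distrib,
    ← Finset.sum_neg_distrib]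
  refine Finset.sum_congr rfl fun β _ => ?_
  rw [← mul_assoc (c α), S.ghost_mul_antighostOf, sub_mul, ← Algebra.smul_def, mul_assoc,
    mul_assoc, S.c_c α β]
  noncomm_ring

/-- The ghost current implements the adjoint action cut off by `lowerProj`, which is not equivariant
under all of `L`. The extra sum is the resulting defect; a term of it vanishes when the bracket with
`t β` stays in the span of the `t γ`. -/
theorem ghostCurrent_ghostCurrent (x y : L) :
    ghostCurrent c b t τ x * ghostCurrent c b t τ y -
      ghostCurrent c b t τ y * ghostCurrent c b t τ x = ghostCurrent c b t τ ⁅x, y⁆ +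
      ∑ β, antighostOf b τ (⁅y, ⁅x, t β⁆ - lowerProj t τ ⁅x, t β⁆⁆ -
        ⁅x, ⁅y, t β⁆ - lowerProj t τ ⁅y, t β⁆⁆) * c β := by
  have h1 : ghostCurrent c b t τ x * ghostCurrent c b t τ y -
      ghostCurrent c b t τ y * ghostCurrent c b t τ x =
      ∑ β, (antighostOf b τ ⁅x, lowerProj t τ ⁅y, t β⁆⁆ * c β -
        ∑ γ, τ β ⁅x, t γ⁆ • (antighostOf b τ ⁅y, t β⁆ * c γ)) := by
    rw [ghostCurrent_apply (x := y), Finset.mul_sum, Finset.sum_mul, ← Finset.sum_sub_distrib]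
    refine Finset.sum_congr rfl fun β _ => ?_
    rw [← S.ghostCurrent_antighostOf]
    have h := congrArg (antighostOf b τ ⁅y, t β⁆ * ·) (S.ghostCurrent_ghost x β)
    simp only [mul_neg, Finset.mul_sum, mul_smul_comm, mul_sub] at h
    rw [sub_eq_add_neg _ (∑ γ, _), ← h]
    noncomm_ring
  have h2 : ∑ β, ∑ γ, τ β ⁅x, t γ⁆ • (antighostOf b τ ⁅y, t β⁆ * c γ) =
      ∑ γ, antighostOf b τ ⁅y, lowerProj t τ ⁅x, t γ⁆⁆ * c γ := by
    rw [Finset.sum_comm]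
    refine Finset.sum_congr rfl fun γ _ => ?_
    simp only [lowerProj_apply, lie_sum, lie_smul, map_sum, map_smul, Finset.sum_mul,
      smul_mul_assoc]
  rw [h1, Finset.sum_sub_distrib, h2, ghostCurrent_apply, ← Finset.sum_sub_distrib,
    ← Finset.sum_add_distrib]
  refine Finset.sum_congr rfl fun β _ => ?_
  rw [← sub_mul, ← add_mul, ← map_sub, ← map_add]
  congr 2
  rw [lie_lie]
  simp only [lie_sub]
  abel

theorem totalCurrent_totalCurrent (x y : L) :
    totalCurrent J c b t τ x * totalCurrent J c b t τ y -
      totalCurrent J c b t τ y * totalCurrent J c b t τ x = totalCurrent J c b t τ ⁅x, y⁆ +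
      ∑ β, antighostOf b τ (⁅y, ⁅x, t β⁆ - lowerProj t τ ⁅x, t β⁆⁆ -
        ⁅x, ⁅y, t β⁆ - lowerProj t τ ⁅y, t β⁆⁆) * c β := by
  have h1 := S.J_lie x y
  have h2 := S.ghostCurrent_ghostCurrent x y
  simp only [totalCurrent, LinearMap.add_apply, add_mul, mul_add, S.J_mul_ghostCurrent, ← h1]
  rw [add_assoc (J x * J y - J y * J x), ← h2]
  abel

theorem totalCurrent_antighost (x : L) (δ : P) :
    totalCurrent J c b t τ x * b δ - b δ * totalCurrent J c b t τ x = antighostOf b τ ⁅x, t δ⁆ := by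
  have := S.ghostCurrent_antighostOf x (t δ)
  rw [S.antighostOf_t, S.lowerProj_t] at this
  rw [← this, totalCurrent, LinearMap.add_apply, add_mul, mul_add, S.J_b]
  abel

theorem totalCurrent_ghost (x : L) (α : P) :
    totalCurrent J c b t τ x * c α - c α * totalCurrent J c b t τ x = -∑ β, τ α ⁅x, t β⁆ • c β := by
  rw [← S.ghostCurrent_ghost, totalCurrent, LinearMap.add_apply, add_mul, mul_add, S.J_c]
  abel

/-- The ghost current enters the charge with the factor `1/2`. Contracting `b δ` with the outer
ghost gives one half of the current of `t δ`, and commuting it with the inner current gives the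
other half. -/
theorem charge_antighost (χ : L →ₗ[ℂ] ℂ) (δ : P) :
    charge J c b t τ χ * b δ + b δ * charge J c b t τ χ =
      totalCurrent J c b t τ (t δ) - algebraMap ℂ A (χ (t δ)) := by
  have h : ∀ α, (J (t α) - algebraMap ℂ A (χ (t α)) +
      (1 / 2 : ℂ) • ghostCurrent c b t τ (t α)) * c α * b δ + b δ * ((J (t α) -
      algebraMap ℂ A (χ (t α)) + (1 / 2 : ℂ) • ghostCurrent c b t τ (t α)) * c α) =
      (if δ = α then (J (t α) - algebraMap ℂ A (χ (t α)) +
        (1 / 2 : ℂ) • ghostCurrent c b t τ (t α)) else 0) +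
      (1 / 2 : ℂ) • (antighostOf b τ ⁅t δ, t α⁆ * c α) := by
    intro α
    have e1 : c α * b δ = (if δ = α then 1 else 0) - b δ * c α := by rw [S.b_c, sub_sub_cancel]
    have e2 := S.ghostCurrent_antighostOf (t α) (t δ)
    rw [S.antighostOf_t, S.lowerProj_t, ← lie_skew, map_neg, sub_eq_iff_eq_add] at e2
    rw [mul_assoc, e1, ← mul_assoc, mul_sub, ← mul_assoc, add_mul _ _ (b δ), sub_mul _ _ (b δ),
      smul_mul_assoc, e2, S.J_b, Algebra.commutes, mul_ite, mul_one, mul_zero]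
    simp only [mul_add, mul_sub, add_mul, sub_mul, smul_add, smul_mul_assoc, mul_smul_comm, neg_mul,
      smul_neg]
    abel
  rw [charge, Finset.sum_mul, Finset.mul_sum, ← Finset.sum_add_distrib,
    Finset.sum_congr rfl fun α _ => h α, Finset.sum_add_distrib, Finset.sum_ite_eq,
    if_pos (Finset.mem_univ _), ← Finset.smul_sum, ← ghostCurrent_apply, totalCurrent,
    LinearMap.add_apply]
  module

/-- Only the inner ghost current acts on `c γ`, and it does so by the coadjoint action. The result
is the Chevalley–Eilenberg differential. -/
theorem charge_ghost (χ : L →ₗ[ℂ] ℂ) (γ : P) :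
    charge J c b t τ χ * c γ + c γ * charge J c b t τ χ =
      -(1 / 2 : ℂ) • ∑ α, ∑ β, τ γ ⁅t α, t β⁆ • (c α * c β) := by
  rw [charge, Finset.sum_mul, Finset.mul_sum, ← Finset.sum_add_distrib, Finset.smul_sum]
  refine Finset.sum_congr rfl fun α _ => ?_
  have e2 := S.ghostCurrent_ghost (t α) γ
  rw [sub_eq_iff_eq_add] at e2
  have e3 : ∑ β, τ γ ⁅t α, t β⁆ • (c α * c β) = -((∑ β, τ γ ⁅t α, t β⁆ • c β) * c α) := by
    simp only [Finset.sum_mul, smul_mul_assoc, S.c_c α, smul_neg, Finset.sum_neg_distrib]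
  rw [mul_assoc, S.c_c α γ, mul_neg, ← mul_assoc, add_mul _ _ (c γ), sub_mul _ _ (c γ),
    smul_mul_assoc, e2, S.J_c, Algebra.commutes, e3]
  simp only [mul_add, mul_sub, add_mul, sub_mul, smul_add, smul_mul_assoc, mul_smul_comm, neg_mul,
    smul_neg, neg_smul, ← mul_assoc]
  abel

/-- Commuting the current of `x` with the currents in the charge produces those of `⁅t β, x⁆`;
commuting it with the ghosts subtracts those of the projection of `⁅t β, x⁆`. The projected part
thus survives only through the constant `χ`. -/
theorem charge_totalCurrent (χ : L →ₗ[ℂ] ℂ) (x : L) :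
    charge J c b t τ χ * totalCurrent J c b t τ x - totalCurrent J c b t τ x * charge J c b t τ χ =
      ∑ β, (totalCurrent J c b t τ (⁅t β, x⁆ - lowerProj t τ ⁅t β, x⁆) +
        algebraMap ℂ A (χ (lowerProj t τ ⁅t β, x⁆))) * c β := by
  let X : L →ₗ[ℂ] A := J - (Algebra.linearMap ℂ A) ∘ₗ χ + (1 / 2 : ℂ) • ghostCurrent c b t τ
  have hX : ∀ z, X z = J z - algebraMap ℂ A (χ z) + (1 / 2 : ℂ) • ghostCurrent c b t τ z :=
    fun z => rfl
  have hQ : charge J c b t τ χ = ∑ α, X (t α) * c α := rfl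
  have h1 : ∑ α, X (t α) * (c α * totalCurrent J c b t τ x - totalCurrent J c b t τ x * c α) =
      ∑ β, X (lowerProj t τ ⁅x, t β⁆) * c β := by
    have : ∀ α, c α * totalCurrent J c b t τ x - totalCurrent J c b t τ x * c α =
        ∑ β, τ α ⁅x, t β⁆ • c β := fun α => by
      rw [← neg_sub, S.totalCurrent_ghost, neg_neg]
    simp only [this, lowerProj_apply, map_sum, map_smul, Finset.sum_mul, Finset.mul_sum,
      smul_mul_assoc, mul_smul_comm]
    exact Finset.sum_comm
  have h2 : ∀ α, X (t α) * totalCurrent J c b t τ x - totalCurrent J c b t τ x * X (t α) =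
      J ⁅t α, x⁆ + (1 / 2 : ℂ) • (ghostCurrent c b t τ ⁅t α, x⁆ -
        ∑ β, antighostOf b τ ⁅t α, ⁅x, t β⁆ - lowerProj t τ ⁅x, t β⁆⁆ * c β) := by
    intro α
    have e1 := S.J_lie (t α) x
    have e2 := S.ghostCurrent_ghostCurrent (t α) x
    -- The `t α` span a subalgebra, so one of the two cut-off defects vanishes.
    simp only [S.lowerProj_t_lie, sub_self, lie_zero, zero_sub, map_neg, neg_mul,
      Finset.sum_neg_distrib] at e2
    rw [← sub_eq_add_neg] at e2
    rw [← e1, ← e2, hX, totalCurrent, LinearMap.add_apply]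
    simp only [add_mul, mul_add, sub_mul, mul_sub, smul_mul_assoc, mul_smul_comm, smul_sub,
      smul_add, Algebra.commutes, S.J_mul_ghostCurrent]
    abel
  -- Exchanging the two ghosts turns the remaining defect into ghost currents of the complementary
  -- part; with their factor `1/2` they restore the full ghost current.
  have h3 : ∑ α, (∑ β, antighostOf b τ ⁅t α, ⁅x, t β⁆ - lowerProj t τ ⁅x, t β⁆⁆ * c β) * c α =
      -∑ β, ghostCurrent c b t τ (⁅t β, x⁆ - lowerProj t τ ⁅t β, x⁆) * c β := by
    have e : ∀ α β, antighostOf b τ ⁅t α, ⁅x, t β⁆ - lowerProj t τ ⁅x, t β⁆⁆ * c β * c α =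
        -(antighostOf b τ ⁅⁅t β, x⁆ - lowerProj t τ ⁅t β, x⁆, t α⁆ * c α * c β) := by
      intro α β
      rw [mul_assoc, mul_assoc, S.c_c β α, ← lie_skew x (t β), ← lie_skew (t α)]
      simp only [map_neg, neg_sub_neg, mul_neg, neg_neg, neg_mul]
      rw [← neg_sub ⁅t β, x⁆, neg_lie, map_neg, neg_mul]
    simp only [Finset.sum_mul, ghostCurrent_apply, e]
    rw [Finset.sum_comm]
    simp only [Finset.sum_neg_distrib]
  have h4 : charge J c b t τ χ * totalCurrent J c b t τ x -
      totalCurrent J c b t τ x * charge J c b t τ χ =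
      ∑ α, (X (t α) * totalCurrent J c b t τ x - totalCurrent J c b t τ x * X (t α)) * c α +
      ∑ α, X (t α) * (c α * totalCurrent J c b t τ x - totalCurrent J c b t τ x * c α) := by
    rw [hQ, Finset.sum_mul, Finset.mul_sum, ← Finset.sum_sub_distrib, ← Finset.sum_add_distrib]
    refine Finset.sum_congr rfl fun α _ => ?_
    noncomm_ring
  rw [h4, h1]
  simp only [h2, add_mul, smul_mul_assoc, sub_mul, Finset.sum_add_distrib, ← Finset.smul_sum,
    Finset.sum_sub_distrib, h3]
  simp only [sub_neg_eq_add, totalCurrent, LinearMap.add_apply, add_mul, ← lie_skew x, map_neg, hX,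
    Finset.smul_sum, smul_add, ← Finset.sum_add_distrib, map_sub, sub_mul, neg_mul, smul_mul_assoc]
  refine Finset.sum_congr rfl fun α _ => ?_
  module

end GhostSystem

end GhostCalculus

/-! ### A weight for which all corrections are of lower order. -/

section Weights

/-- The weight of a current of degree `j`. -/
def currentWeight (m j : ℤ) : ℤ := if 0 ≤ j then 2 * (m + 1) ^ 2 * (j + 1) + (j + 1) ^ 2 else 1

theorem currentWeight_of_neg {m j : ℤ} (h : j < 0) : currentWeight m j = 1 :=
  if_neg (not_le.mpr h)

theorem one_le_currentWeight (m j : ℤ) : 1 ≤ currentWeight m j := by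
  unfold currentWeight
  split_ifs with h
  · nlinarith [mul_nonneg (sq_nonneg (m + 1)) (by linarith : 0 ≤ j + 1)]
  · exact le_rfl

theorem currentWeight_mono (m : ℤ) : Monotone (currentWeight m) := by
  intro i j hij
  by_cases hi : 0 ≤ i
  · rw [currentWeight, currentWeight, if_pos hi, if_pos (hi.trans hij)]
    nlinarith [mul_nonneg (sq_nonneg (m + 1)) (sub_nonneg.mpr hij)]
  · rw [currentWeight, if_neg hi]
    exact one_le_currentWeight m j

/-- For nonnegative degrees put `a = p + 1` and `b = q + 1`. The linear terms leave a surplus `2 (m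
+ 1)²`, which absorbs the cross term `2ab` of the squares because `a, b ≤ m + 1`. This strict
subadditivity lowers the order of commutators of currents. -/
theorem currentWeight_add {m p q : ℤ} (hp : p ≤ m) (hq : q ≤ m) :
    currentWeight m (p + q) ≤ currentWeight m p + currentWeight m q - 1 := by
  rcases lt_or_ge p 0 with h1 | h1
  · have := currentWeight_mono m (by linarith : p + q ≤ q)
    rw [currentWeight_of_neg h1]
    linarith
  rcases lt_or_ge q 0 with h2 | h2
  · have := currentWeight_mono m (by linarith : p + q ≤ p)
    rw [currentWeight_of_neg h2]
    linarith
  rw [currentWeight, currentWeight, currentWeight, if_pos h1, if_pos h2, if_pos (add_nonneg h1 h2)]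
  nlinarith [mul_le_mul hp hq h2 (h1.trans hp)]

/-- The linear terms cancel and the squares leave `2ab`. The shift by one in the degrees is that of
the ghosts, as `c α` has the weight of degree `deg α - 1`; the inequality lowers the order of the
products of a current and a ghost, or of two ghosts, in the differential. -/
theorem add_currentWeight_le (m : ℤ) {a b : ℤ} (ha : 1 ≤ a) (hb : 1 ≤ b) :
    currentWeight m (a - 1) + currentWeight m (b - 1) ≤ currentWeight m (a + b - 1) - 1 := by
  rw [currentWeight, currentWeight, currentWeight, if_pos (by linarith), if_pos (by linarith),
    if_pos (by linarith)]
  nlinarith [mul_le_mul ha hb zero_le_one (by linarith)]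

theorem currentWeight_sub_one_lt (m : ℤ) {d q : ℤ} (hd : 1 ≤ d) (hq : d ≤ q) :
    currentWeight m (d - 1) + 1 ≤ currentWeight m q := by
  have h1 := add_currentWeight_le m hd (by linarith : 1 ≤ q - d + 1)
  have h2 := one_le_currentWeight m (q - d + 1 - 1)
  rw [show d + (q - d + 1) - 1 = q by ring] at h1
  linarith

end Weights

/-! ### Graded reductions as deformations of the model. -/

section GradedReduction

variable {L A P κ C : Type*} [LieRing L] [LieAlgebra ℂ L] [Ring A] [Algebra ℂ A] [Fintype P]
  [DecidableEq P] [Fintype κ] [DecidableEq κ] [AddCommGroup C] [Module ℂ C]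

/-- A grading of `L` in which the `t γ` span the part of negative degree and `χ` has degree `-1`,
with a homogeneous basis consisting of the `t γ`, of vectors that are dual to them under
`χ ⁅x, y⁆`, and of vectors annihilated by `χ ⁅t γ, -⁆`. -/
structure IsGradedReduction (t : P → L) (τ : P → Module.Dual ℂ L) (χ : L →ₗ[ℂ] ℂ)
    (Lg : ℤ → Submodule ℂ L) (deg : P → ℤ) (e : P ⊕ (P ⊕ κ) → L) (dg : P ⊕ (P ⊕ κ) → ℤ) (m : ℤ) :
    Prop where
  lie_mem : ∀ i j x y, x ∈ Lg i → y ∈ Lg j → ⁅x, y⁆ ∈ Lg (i + j)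
  deg_pos : ∀ α, 1 ≤ deg α
  dg_le : ∀ i, dg i ≤ m
  t_mem : ∀ α, t α ∈ Lg (-deg α)
  τ_eq : ∀ j x γ, x ∈ Lg j → j ≠ -deg γ → τ γ x = 0
  proj_eq : ∀ j x, x ∈ Lg j → j < 0 → lowerProj t τ x = x
  χ_eq : ∀ j x, x ∈ Lg j → j ≠ -1 → χ x = 0
  e_mem : ∀ i, e i ∈ Lg (dg i)
  mem_span : ∀ j x, x ∈ Lg j → x ∈ Submodule.span ℂ (e '' {i | dg i = j})
  e_low : ∀ γ, e (Sum.inl γ) = t γ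
  dg_low : ∀ γ, dg (Sum.inl γ) = -deg γ
  dg_mid : ∀ α, dg (Sum.inr (Sum.inl α)) = deg α - 1
  χ_mid : ∀ β α, χ ⁅t β, e (Sum.inr (Sum.inl α))⁆ = if β = α then 1 else 0
  χ_free : ∀ β k, χ ⁅t β, e (Sum.inr (Sum.inr k))⁆ = 0

namespace IsGradedReduction

variable {t : P → L} {τ : P → Module.Dual ℂ L} {χ : L →ₗ[ℂ] ℂ} {Lg : ℤ → Submodule ℂ L}
  {deg : P → ℤ} {e : P ⊕ (P ⊕ κ) → L} {dg : P ⊕ (P ⊕ κ) → ℤ} {m : ℤ}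
  (H : IsGradedReduction t τ χ Lg deg e dg m)
include H

theorem proj_of_nonneg {j : ℤ} {x : L} (hx : x ∈ Lg j) (hj : 0 ≤ j) : lowerProj t τ x = 0 := by
  rw [lowerProj_apply]
  refine Finset.sum_eq_zero fun γ _ => ?_
  rw [H.τ_eq j x γ hx (by have := H.deg_pos γ; omega), zero_smul]

theorem sub_proj_mem {j : ℤ} {x : L} (hx : x ∈ Lg j) : x - lowerProj t τ x ∈ Lg j := by
  rcases lt_or_ge j 0 with h | h
  · rw [H.proj_eq j x hx h, sub_self]
    exact zero_mem _
  · rwa [H.proj_of_nonneg hx h, sub_zero]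

theorem χ_proj {j : ℤ} {x : L} (hx : x ∈ Lg j) : χ (lowerProj t τ x) = χ x := by
  rcases lt_or_ge j 0 with h | h
  · rw [H.proj_eq j x hx h]
  · rw [H.proj_of_nonneg hx h, map_zero, H.χ_eq j x hx (by omega)]

theorem antighostOf_of_nonneg {b : P → A} {j : ℤ} {x : L} (hx : x ∈ Lg j) (hj : 0 ≤ j) :
    antighostOf b τ x = 0 := by
  rw [antighostOf_apply]
  refine Finset.sum_eq_zero fun γ _ => ?_
  rw [H.τ_eq j x γ hx (by have := H.deg_pos γ; omega), zero_smul]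

theorem t_lie_mem (β : P) {j : ℤ} {x : L} (hx : x ∈ Lg j) : ⁅t β, x⁆ ∈ Lg (j - deg β) := by
  have := H.lie_mem _ _ _ _ (H.t_mem β) hx
  rwa [neg_add_eq_sub] at this

theorem lie_t_mem (β : P) {j : ℤ} {x : L} (hx : x ∈ Lg j) : ⁅x, t β⁆ ∈ Lg (j - deg β) :=
  H.lie_mem _ _ _ _ hx (H.t_mem β)

section Filtered

variable {J : L →ₗ[ℂ] A} {c b : P → A} (S : GhostSystem J c b t τ) {F : ℤ → Submodule ℂ A}
  (hF : IsRingFiltration F)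
  (hJ : ∀ i, totalCurrent J c b t τ (e i) ∈ F (currentWeight m (dg i)))
  (hc : ∀ α, c α ∈ F (currentWeight m (deg α - 1))) (hb : ∀ α, b α ∈ F 1)

include hF hJ in
theorem totalCurrent_mem {j : ℤ} {x : L} (hx : x ∈ Lg j) :
    totalCurrent J c b t τ x ∈ F (currentWeight m j) := by
  have h := H.mem_span j x hx
  clear hx
  induction h using Submodule.span_induction with
  | mem x hx =>
    obtain ⟨i, rfl, rfl⟩ := hx
    exact hJ i
  | zero => simp
  | add x y _ _ hx hy => rw [map_add]; exact add_mem hx hy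
  | smul r x _ hx => rw [map_smul]; exact Submodule.smul_mem _ _ hx

include hb in
omit H in
theorem antighostOf_mem (x : L) : antighostOf b τ x ∈ F 1 := by
  rw [antighostOf_apply]
  exact sum_mem fun γ _ => Submodule.smul_mem _ _ (hb γ)

include S hF hJ hc hb in
-- The bracket term is handled by `currentWeight_add`. The cut-off defect contributes only when a
-- bracket leaves the negative part and a second one returns to it.
theorem even_even_mem (i i' : P ⊕ (P ⊕ κ)) :
    totalCurrent J c b t τ (e i) * totalCurrent J c b t τ (e i') -
      totalCurrent J c b t τ (e i') * totalCurrent J c b t τ (e i) ∈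
      F (currentWeight m (dg i) + currentWeight m (dg i') - 1) := by
  have key : ∀ i i' β, antighostOf b τ ⁅e i', ⁅e i, t β⁆ - lowerProj t τ ⁅e i, t β⁆⁆ * c β ∈
      F (currentWeight m (dg i) + currentWeight m (dg i') - 1) := by
    intro i i' β
    have h1 := H.lie_t_mem β (H.e_mem i)
    rcases lt_or_ge (dg i - deg β) 0 with h | h
    · simp [H.proj_eq _ _ h1 h]
    have h2 := H.lie_mem _ _ _ _ (H.e_mem i') (H.sub_proj_mem h1)
    rcases lt_or_ge (dg i' + (dg i - deg β)) 0 with h' | h'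
    -- The current of `e i'` now has weight `1`, which offsets the required drop of one. The current
    -- of `e i` is traded for an antighost of weight `1` and a ghost `c β` with `deg β ≤ dg i`, and
    -- `currentWeight_sub_one_lt` is exactly what is needed.
    · have h3 : dg i' < 0 := by linarith
      refine hF.mul_mem_of_le ?_ (antighostOf_mem hb _) (hc β)
      have := currentWeight_sub_one_lt m (H.deg_pos β) (by linarith : deg β ≤ dg i)
      rw [currentWeight_of_neg h3]
      linarith
    · rw [H.antighostOf_of_nonneg h2 h', zero_mul]
      exact zero_mem _
  rw [S.totalCurrent_totalCurrent]
  refine add_mem (hF.mono (currentWeight_add (H.dg_le i) (H.dg_le i'))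
    (H.totalCurrent_mem hF hJ (H.lie_mem _ _ _ _ (H.e_mem i) (H.e_mem i'))))
    (sum_mem fun β _ => ?_)
  rw [map_sub, sub_mul]
  refine sub_mem (key i i' β) ?_
  rw [add_comm (currentWeight m (dg i))]
  exact key i' i β

include S hF hc in
-- By homogeneity a ghost `c β` can occur only if `deg β - 1 = dg i + (deg α - 1)`. The bound is
-- then subadditivity for `e i` and the middle basis vector paired with `c α`.
theorem ghost_even_mem (α : P) (i : P ⊕ (P ⊕ κ)) :
    c α * totalCurrent J c b t τ (e i) - totalCurrent J c b t τ (e i) * c α ∈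
      F (currentWeight m (dg i) + currentWeight m (deg α - 1) - 1) := by
  rw [← neg_sub (_ * c α), S.totalCurrent_ghost, neg_neg]
  refine sum_mem fun β _ => ?_
  have h1 := H.lie_t_mem β (H.e_mem i)
  by_cases h : dg i - deg β = -deg α
  · refine Submodule.smul_mem _ _ (hF.mono ?_ (hc β))
    have := currentWeight_add (H.dg_le i) (H.dg_le (Sum.inr (Sum.inl α)))
    rw [H.dg_mid] at this
    rwa [show deg β - 1 = dg i + (deg α - 1) by linarith]
  · rw [H.τ_eq _ _ _ h1 h, zero_smul]
    exact zero_mem _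

include S hF hb in
omit H in
theorem antighost_even_mem (γ : P) (i : P ⊕ (P ⊕ κ)) :
    b γ * totalCurrent J c b t τ (e i) - totalCurrent J c b t τ (e i) * b γ ∈
      F (currentWeight m (dg i) + 1 - 1) := by
  rw [← neg_sub (_ * b γ), S.totalCurrent_antighost]
  refine neg_mem (hF.mono ?_ (antighostOf_mem hb _))
  have := one_le_currentWeight m (dg i)
  linarith

include hF hJ hc in
theorem lower_mem {j : ℤ} {x : L} (hx : x ∈ Lg j) (β : P) :
    totalCurrent J c b t τ (⁅t β, x⁆ - lowerProj t τ ⁅t β, x⁆) * c β ∈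
      F (currentWeight m j - 1) := by
  have h1 := H.t_lie_mem β hx
  rcases lt_or_ge (j - deg β) 0 with h | h
  · simp [H.proj_eq _ _ h1 h]
  · refine hF.mul_mem_of_le ?_ (H.totalCurrent_mem hF hJ (H.sub_proj_mem h1)) (hc β)
    have := add_currentWeight_le m (by linarith : 1 ≤ j - deg β + 1) (H.deg_pos β)
    rwa [show j - deg β + 1 - 1 = j - deg β by ring,
      show j - deg β + 1 + deg β - 1 = j by ring] at this

include S hF hJ hc in
-- In `charge_totalCurrent` the only terms that are not of lower order by `lower_mem` are the
-- constants `χ` times ghosts. They form the part of the differential on which the contraction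
-- rests.
theorem charge_even_mem {j : ℤ} {x : L} (hx : x ∈ Lg j) :
    charge J c b t τ χ * totalCurrent J c b t τ x - totalCurrent J c b t τ x * charge J c b t τ χ -
      ∑ β, χ ⁅t β, x⁆ • c β ∈ F (currentWeight m j - 1) := by
  rw [S.charge_totalCurrent, ← Finset.sum_sub_distrib]
  refine sum_mem fun β _ => ?_
  rw [H.χ_proj (H.t_lie_mem β hx), add_mul, Algebra.smul_def, add_sub_cancel_right]
  exact H.lower_mem hF hJ hc hx β

include S hF hc in
theorem charge_ghost_mem (α : P) : charge J c b t τ χ * c α + c α * charge J c b t τ χ ∈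
    F (currentWeight m (deg α - 1) - 1) := by
  rw [S.charge_ghost]
  refine Submodule.smul_mem _ _ (sum_mem fun β _ => sum_mem fun γ _ => ?_)
  by_cases h : -deg β - deg γ = -deg α
  · refine Submodule.smul_mem _ _ (hF.mul_mem_of_le ?_ (hc β) (hc γ))
    have := add_currentWeight_le m (H.deg_pos β) (H.deg_pos γ)
    rwa [show deg β + deg γ - 1 = deg α - 1 by linarith] at this
  · rw [H.τ_eq _ _ _ (H.lie_t_mem γ (H.t_mem β)) h, zero_smul]
    exact zero_mem _

end Filtered

/-- The reduction of a graded Lie algebra by a charge is a deformation of the model. -/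
theorem isDeformation {J : L →ₗ[ℂ] A} {c b : P → A} (S : GhostSystem J c b t τ)
    {M : Fermions (P ⊕ P) C} {j : C →ₗ[ℂ] A} (hM : M.IsCliffordAction (Sum.elim c b) j)
    (σ : A →ₐ[ℂ] A) (hσJ : ∀ x, σ (J x) = J x) (hσc : ∀ α, σ (c α) = -c α)
    (hσb : ∀ α, σ (b α) = -b α) {d : A →ₗ[ℂ] A}
    (hd : ∀ y, d y = charge J c b t τ χ * y - σ y * charge J c b t τ χ) :
    IsDeformation M (fun i => totalCurrent J c b t τ (e i)) (Sum.elim c b) j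
      (fun i => currentWeight m (dg i)) d := by
  have hF : IsRingFiltration (letterFiltration (fun i => totalCurrent J c b t τ (e i))
      (Sum.elim c b) fun i => currentWeight m (dg i)) := isRingFiltration_wordFiltration _ _
  have hJ := IsDeformation.even_mem (x := fun i => totalCurrent J c b t τ (e i))
    (ξ := Sum.elim c b) (w := fun i => currentWeight m (dg i))
  have hξ := IsDeformation.odd_mem (x := fun i => totalCurrent J c b t τ (e i))
    (ξ := Sum.elim c b) (w := fun i => currentWeight m (dg i))
  have w1 : ∀ α, currentWeight m (dg (Sum.inr (Sum.inl α))) = currentWeight m (deg α - 1) :=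
    fun α => by rw [H.dg_mid]
  have w2 : ∀ γ, currentWeight m (dg (Sum.inl γ)) = 1 := fun γ =>
    currentWeight_of_neg (by rw [H.dg_low]; have := H.deg_pos γ; linarith)
  have hc : ∀ α, c α ∈ letterFiltration (fun i => totalCurrent J c b t τ (e i))
      (Sum.elim c b) (fun i => currentWeight m (dg i)) (currentWeight m (deg α - 1)) := fun α => by
    have := hξ (Sum.inl α)
    simp only [evenPartner, Sum.elim_inl, w1] at this
    exact this
  have hb : ∀ γ, b γ ∈ letterFiltration (fun i => totalCurrent J c b t τ (e i))
      (Sum.elim c b) (fun i => currentWeight m (dg i)) 1 := fun γ => by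
    have := hξ (Sum.inr γ)
    simp only [evenPartner, Sum.elim_inr, w2] at this
    exact this
  have hσ : ∀ x, σ (totalCurrent J c b t τ x) = totalCurrent J c b t τ x := by
    intro x
    simp [totalCurrent, hσJ, ghostCurrent_apply, antighostOf_apply, hσc, hσb]
  have hmul : ∀ y z, d (y * z) = d y * z + σ y * d z := by
    intro y z
    simp only [hd, map_mul]
    noncomm_ring
  have hdx : ∀ x, d (totalCurrent J c b t τ x) = charge J c b t τ χ * totalCurrent J c b t τ x -
      totalCurrent J c b t τ x * charge J c b t τ χ := fun x => by rw [hd, hσ]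
  exact
    { one_le := fun i => one_le_currentWeight _ _
      clifford := hM
      even_even := H.even_even_mem S hF hJ hc hb
      odd_even := by
        rintro (α | γ) i
        · have := H.ghost_even_mem S hF hc α i
          simpa only [evenPartner, Sum.elim_inl, w1] using this
        · have := antighost_even_mem (m := m) (e := e) (dg := dg) S hF hb γ i
          simpa only [evenPartner, Sum.elim_inr, w2] using this
      d_one := by simp [hd]
      d_even := fun i y => by rw [hmul, hσ]
      d_odd := fun o y => by
        rcases o with α | γ
        · simp only [Sum.elim_inl, hmul, hσc]
          noncomm_ring
        · simp only [Sum.elim_inr, hmul, hσb]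
          noncomm_ring
      d_low := fun γ => by
        have := H.charge_even_mem S hF hJ hc (H.e_mem (Sum.inl γ))
        rw [Finset.sum_eq_zero, sub_zero, ← hdx] at this
        · exact this
        · intro β _
          -- A bracket of two vectors of negative degree has degree at most `-2`, and `χ` is
          -- concentrated in degree `-1`.
          rw [H.χ_eq _ _ (H.t_lie_mem β (H.e_mem (Sum.inl γ))), zero_smul]
          have h1 := H.deg_pos β
          have h2 := H.deg_pos γ
          rw [H.dg_low]
          omega
      d_mid := fun α => by
        have := H.charge_even_mem S hF hJ hc (H.e_mem (Sum.inr (Sum.inl α)))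
        simp only [H.χ_mid, ite_smul, one_smul, zero_smul, Finset.sum_ite_eq', Finset.mem_univ,
          if_true, ← hdx] at this
        exact this
      d_free := fun k => by
        have := H.charge_even_mem S hF hJ hc (H.e_mem (Sum.inr (Sum.inr k)))
        simp only [H.χ_free, zero_smul, Finset.sum_const_zero, sub_zero, ← hdx] at this
        exact this
      d_ghost := fun α => by
        have := H.charge_ghost_mem S hF hc α
        simp only [w1, Sum.elim_inl, hd, hσc, neg_mul, sub_neg_eq_add]
        exact this
      d_antighost := fun γ => by
        have h := S.charge_antighost χ γ
        simp only [w2, Sum.elim_inr, hd, hσb, neg_mul, sub_neg_eq_add, h, H.e_low, sub_self]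
        -- What is left is the constant `χ (t γ)`, of weight `0`, while the current of `t γ` has
        -- weight `1`.
        rw [sub_sub_cancel_left, Algebra.algebraMap_eq_smul_one]
        exact neg_mem (Submodule.smul_mem _ _ hF.one_mem) }

end IsGradedReduction

end GradedReduction

/-! ### Corrected ordered monomials in an enveloping algebra with coefficients. -/

section TensorPBW

open MvPolynomial

variable {I L m B : Type*} [Fintype I] [DecidableEq I] [LieRing L] [LieAlgebra ℂ L] [Fintype m]
  [DecidableEq m] [Ring B] [Algebra ℂ B]

theorem map_orderedMonomial {A A' : Type*} [Ring A] [Algebra ℂ A] [Ring A'] [Algebra ℂ A']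
    (f : A →ₐ[ℂ] A') (x : I → A) (a : I →₀ ℕ) :
    f (orderedMonomial x a) = orderedMonomial (fun i => f (x i)) a := by
  simp [orderedMonomial, listMonomial, map_list_prod, Function.comp_def]

/-- The letters of `U(L) ⊗ B`. -/
def tensorLetter (e : Module.Basis I ℂ L) : I ⊕ B → UniversalEnvelopingAlgebra ℂ L ⊗[ℂ] B :=
  Sum.elim (fun i => UniversalEnvelopingAlgebra.ι ℂ (e i) ⊗ₜ 1) fun r => 1 ⊗ₜ r

/-- The filtration of `U(L) ⊗ B` by the degree in `U(L)`. -/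
abbrev tensorFiltration (B : Type*) [Ring B] [Algebra ℂ B] (e : Module.Basis I ℂ L) :
    ℤ → Submodule ℂ (UniversalEnvelopingAlgebra ℂ L ⊗[ℂ] B) :=
  wordFiltration (tensorLetter e) (Sum.elim (fun _ => 1) fun _ => 0)

theorem exists_mem_tensorFiltration (e : Module.Basis I ℂ L)
    (y : UniversalEnvelopingAlgebra ℂ L ⊗[ℂ] B) : ∃ p : ℕ, y ∈ tensorFiltration B e p := by
  refine exists_mem_wordFiltration _ _ (fun y => ?_) y
  set S := Algebra.adjoin ℂ (Set.range (tensorLetter (B := B) e))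
  induction y using TensorProduct.induction_on with
  | zero => exact zero_mem _
  | add y z hy hz => exact add_mem hy hz
  | tmul u r =>
    have h1 : (1 : UniversalEnvelopingAlgebra ℂ L) ⊗ₜ[ℂ] r ∈ S :=
      Algebra.subset_adjoin ⟨Sum.inr r, rfl⟩
    have h2 : u ⊗ₜ[ℂ] (1 : B) ∈ S := by
      have h := envelopingAlgebra_adjoin e u
      induction h using Algebra.adjoin_induction with
      | mem u hu =>
        obtain ⟨i, rfl⟩ := hu
        exact Algebra.subset_adjoin ⟨Sum.inl i, rfl⟩
      | algebraMap r => exact S.algebraMap_mem r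
      | add u u' _ _ h h' => rw [TensorProduct.add_tmul]; exact add_mem h h'
      | mul u u' _ _ h h' =>
        rw [← mul_one (1 : B), ← Algebra.TensorProduct.tmul_mul_tmul]
        exact mul_mem h h'
    have := mul_mem h2 h1
    rwa [Algebra.TensorProduct.tmul_mul_tmul, mul_one, one_mul] at this

theorem ι_tmul_mem_tensorFiltration (e : Module.Basis I ℂ L) (x : L) :
    UniversalEnvelopingAlgebra.ι ℂ x ⊗ₜ[ℂ] (1 : B) ∈ tensorFiltration B e 1 := by
  rw [← e.sum_repr x, map_sum, TensorProduct.sum_tmul]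
  refine sum_mem fun i _ => ?_
  rw [map_smul, ← TensorProduct.smul_tmul']
  exact Submodule.smul_mem _ _ (letter_mem_wordFiltration (tensorLetter e)
    (Sum.elim (fun _ => 1) fun _ => 0) (Sum.inl i))

theorem one_tmul_mem_tensorFiltration (e : Module.Basis I ℂ L) (r : B) :
    (1 : UniversalEnvelopingAlgebra ℂ L) ⊗ₜ[ℂ] r ∈ tensorFiltration B e 0 :=
  letter_mem_wordFiltration (tensorLetter e) (Sum.elim (fun _ => 1) fun _ => 0) (Sum.inr r)

theorem mul_orderedMonomial_sub_mem_tensorFiltration (e : Module.Basis I ℂ L) (i : I) (a : I →₀ ℕ) :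
    (UniversalEnvelopingAlgebra.ι ℂ (e i) ⊗ₜ[ℂ] (1 : B)) *
      orderedMonomial (fun i => UniversalEnvelopingAlgebra.ι ℂ (e i) ⊗ₜ[ℂ] (1 : B)) a -
      orderedMonomial (fun i => UniversalEnvelopingAlgebra.ι ℂ (e i) ⊗ₜ[ℂ] (1 : B))
        (a + Finsupp.single i 1) ∈ tensorFiltration B e (expWeight (fun _ => 1) a + 1 - 1) := by
  refine mul_orderedMonomial_sub_mem (w := fun _ => 1) (isRingFiltration_wordFiltration _ _)
    (fun i => ι_tmul_mem_tensorFiltration e (e i)) (fun i j => ?_) i a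
  rw [Algebra.TensorProduct.tmul_mul_tmul, Algebra.TensorProduct.tmul_mul_tmul,
    ← TensorProduct.sub_tmul, mul_one, ι_mul_sub_ι_mul]
  exact ι_tmul_mem_tensorFiltration e _

/-- This is the sorting argument of `wordFiltration_le_map_pbwMap`, with `B` as coefficients of
weight `0` that commute with the letters of `L`. -/
theorem tensorFiltration_le (e : Module.Basis I ℂ L) (p : ℤ) : tensorFiltration B e p ≤
    Submodule.span ℂ {y | ∃ a r, expWeight (fun _ => 1) a ≤ p ∧
      y = orderedMonomial (fun i => UniversalEnvelopingAlgebra.ι ℂ (e i)) a ⊗ₜ[ℂ] r} := by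
  have ht : ∀ (a : I →₀ ℕ) (r : B),
      orderedMonomial (fun i => UniversalEnvelopingAlgebra.ι ℂ (e i)) a ⊗ₜ[ℂ] r =
      orderedMonomial (fun i => UniversalEnvelopingAlgebra.ι ℂ (e i) ⊗ₜ[ℂ] (1 : B)) a *
        (1 ⊗ₜ[ℂ] r) := by
    intro a r
    have := map_orderedMonomial (Algebra.TensorProduct.includeLeft (R := ℂ) (S := ℂ) (B := B))
      (fun i => UniversalEnvelopingAlgebra.ι ℂ (e i)) a
    simp only [Algebra.TensorProduct.includeLeft_apply] at this
    rw [← this, Algebra.TensorProduct.tmul_mul_tmul, mul_one, one_mul]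
  refine wordFiltration_le (G := fun p : ℤ => Submodule.span ℂ {y | ∃ a r,
      expWeight (fun _ => 1) a ≤ p ∧
      y = orderedMonomial (fun i => UniversalEnvelopingAlgebra.ι ℂ (e i)) a ⊗ₜ[ℂ] r}) _ _ ?_
    (fun p q h => Submodule.span_mono ?_) ?_ ?_ p
  · rintro (i | r)
    · exact zero_le_one
    · exact le_rfl
  · rintro y ⟨a, r, ha, rfl⟩
    exact ⟨a, r, ha.trans h, rfl⟩
  · refine Submodule.subset_span ⟨0, 1, by simp [expWeight], ?_⟩
    simp [orderedMonomial, listMonomial, Algebra.TensorProduct.one_def]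
  · intro s p y hy
    induction hy using Submodule.span_induction with
    | mem y hy =>
      obtain ⟨a, r, ha, rfl⟩ := hy
      rcases s with i | r'
      · have h := mul_orderedMonomial_sub_mem_tensorFiltration (B := B) e i a
        rw [ht, ← mul_assoc, ← sub_add_cancel (_ * _ * _)
          (orderedMonomial (fun i => UniversalEnvelopingAlgebra.ι ℂ (e i)) (a + Finsupp.single i 1)
            ⊗ₜ[ℂ] r)]
        refine add_mem (Submodule.mem_sup_right ?_) (Submodule.mem_sup_left (Submodule.subset_span
          ⟨_, r, ?_, rfl⟩))
        · rw [ht, ← sub_mul]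
          exact (isRingFiltration_wordFiltration _ _).mul_mem_of_le
            (by simp only [Sum.elim_inl]; linarith) h (one_tmul_mem_tensorFiltration e r)
        · rw [expWeight_add_single]
          simpa using ha
      · refine Submodule.mem_sup_left (Submodule.subset_span ⟨a, r' * r, by simpa using ha, ?_⟩)
        simp [tensorLetter]
    | zero => simp
    | add y z _ _ hy hz => rw [mul_add]; exact add_mem hy hz
    | smul c y _ hy => rw [mul_smul_comm]; exact Submodule.smul_mem _ _ hy

variable {P κ : Type*} [Fintype P] [DecidableEq P] [Fintype κ] [DecidableEq κ]

/-- Ordered monomials in a basis of `L`, corrected by elements of `B`, form a basis of `U(L) ⊗ B`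
over `B`. -/
theorem monomialMap_bijective (e : Module.Basis (P ⊕ (P ⊕ κ)) ℂ L) (φ : L →ₗ⁅ℂ⁆ Matrix m m ℂ)
    (hφ : Function.Injective φ) (x : P ⊕ (P ⊕ κ) → UniversalEnvelopingAlgebra ℂ L ⊗[ℂ] B)
    (hx : ∀ i, ∃ r : B, x i = UniversalEnvelopingAlgebra.ι ℂ (e i) ⊗ₜ 1 + 1 ⊗ₜ r) :
    Function.Bijective (monomialMap x
      (TensorProduct.mk ℂ (UniversalEnvelopingAlgebra ℂ L) B 1)) := by
  let Ψ' : ModelSpace P κ B ≃ₗ[ℂ] UniversalEnvelopingAlgebra ℂ L ⊗[ℂ] B :=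
    TensorProduct.congr (pbwEquiv e φ hφ) (LinearEquiv.refl ℂ B)
  have hF := isRingFiltration_wordFiltration (tensorLetter (B := B) e)
    (Sum.elim (fun _ => 1) fun _ => 0)
  have hx1 : ∀ i, x i ∈ tensorFiltration B e 1 := by
    intro i
    obtain ⟨r, hr⟩ := hx i
    rw [hr]
    exact add_mem (ι_tmul_mem_tensorFiltration e _)
      (hF.mono zero_le_one (one_tmul_mem_tensorFiltration e r))
  -- The reference is the PBW isomorphism tensored with `B`. The corrections `1 ⊗ r` have filtration
  -- `0` and the letters have filtration `1`, so relative to the reference the map is unipotent.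
  have key : Function.Bijective ((monomialMap x
      (TensorProduct.mk ℂ (UniversalEnvelopingAlgebra ℂ L) B 1)) ∘ₗ Ψ'.symm.toLinearMap) := by
    refine bijective_of_unipotent (F := tensorFiltration B e) (wordFiltration_of_neg _ _ ?_ (by simp))
      (exists_mem_tensorFiltration e) _ fun p y hy => ?_
    · rintro (i | r)
      · exact zero_le_one
      · exact le_rfl
    have h := tensorFiltration_le e p hy
    clear hy
    induction h using Submodule.span_induction with
    | mem y hy =>
      obtain ⟨a, r, ha, rfl⟩ := hy
      have h1 : Ψ'.symm (orderedMonomial (fun i => UniversalEnvelopingAlgebra.ι ℂ (e i)) a ⊗ₜ[ℂ] r) =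
          pureTensor (monomial a 1) r := by
        rw [LinearEquiv.symm_apply_eq, ← pbwMap_monomial]
        rfl
      have h2 : orderedMonomial (fun i => UniversalEnvelopingAlgebra.ι ℂ (e i)) a ⊗ₜ[ℂ] r =
          orderedMonomial (fun i => UniversalEnvelopingAlgebra.ι ℂ (e i) ⊗ₜ[ℂ] (1 : B)) a *
            (1 ⊗ₜ[ℂ] r) := by
        have := map_orderedMonomial (Algebra.TensorProduct.includeLeft (R := ℂ) (S := ℂ) (B := B))
          (fun i => UniversalEnvelopingAlgebra.ι ℂ (e i)) a
        simp only [Algebra.TensorProduct.includeLeft_apply] at this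
        rw [← this, Algebra.TensorProduct.tmul_mul_tmul, mul_one, one_mul]
      rw [LinearMap.comp_apply, LinearEquiv.coe_coe, h1, monomialMap_pureTensor, orderedMap_monomial,
        h2, TensorProduct.mk_apply, ← sub_mul]
      refine hF.mul_mem_of_le (by linarith) (orderedMonomial_sub_mem (w := fun _ => 1) hF hx1
        (fun i => ι_tmul_mem_tensorFiltration e (e i)) (fun i => ?_) a)
        (one_tmul_mem_tensorFiltration e r)
      obtain ⟨r, hr⟩ := hx i
      rw [hr, add_sub_cancel_left]
      exact one_tmul_mem_tensorFiltration e r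
    | zero => simp
    | add y z _ _ hy hz => rw [map_add, add_sub_add_comm]; exact add_mem hy hz
    | smul c y _ hy => rw [map_smul, ← smul_sub]; exact Submodule.smul_mem _ _ hy
  have := key.comp Ψ'.bijective
  convert this using 1
  ext y
  simp

end TensorPBW

/-! ### The Clifford algebra as a fermionic space. -/

section CliffordModel

variable {n : ℕ} {μ : YoungDiagram} (v : Module.Basis (Cell μ) ℂ (Fin n → ℂ))

instance : DecidableEq (PosIdx μ) := inferInstance

/-- The ghosts and antighosts. -/
abbrev ghostLetter : PosIdx μ ⊕ PosIdx μ → Ghosts v := Sum.elim (ghost v) (antighost v)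

/-- The basis vector `t_α` as an element of `g_+`. -/
def tLowPlus (α : PosIdx μ) : gPlus v := ⟨tLow v α, Submodule.subset_span ⟨α, rfl⟩⟩

/-- The functionals that are dual to the ghosts and antighosts. -/
def letterDual : PosIdx μ ⊕ PosIdx μ → Module.Dual ℂ (Module.Dual ℂ (gPlus v) × gPlus v) :=
  Sum.elim (fun α => dualVec v α ∘ₗ LinearMap.snd ℂ _ _)
    fun γ => Module.Dual.eval ℂ _ (tLowPlus v γ) ∘ₗ LinearMap.fst ℂ _ _

/-- The annihilation operators of the Clifford algebra. -/
def ghostK (o : PosIdx μ ⊕ PosIdx μ) : Module.End ℂ (Ghosts v) :=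
  CliffordAlgebra.contractLeft (letterDual v o)

/-- The creation operators of the Clifford algebra. -/
def ghostW (o : PosIdx μ ⊕ PosIdx μ) : Module.End ℂ (Ghosts v) :=
  LinearMap.mulLeft ℂ (ghostLetter v o) - Sum.elim (fun _ => 0) (fun γ => ghostK v (Sum.inl γ)) o

theorem ghostK_mul_ghostK (i j : PosIdx μ ⊕ PosIdx μ) :
    ghostK v i * ghostK v j = -(ghostK v j * ghostK v i) :=
  LinearMap.ext fun x => CliffordAlgebra.contractLeft_comm _ _ x

theorem ghostK_letter_mul (i j : PosIdx μ ⊕ PosIdx μ) (x : Ghosts v) :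
    ghostK v i (ghostLetter v j * x) = (if i = j then x else 0) - ghostLetter v j * ghostK v i x := by
  have h : ∀ α β, dualVec v α (tLowPlus v β) = if α = β then 1 else 0 := tLow_tUp_trace v
  rcases i with α | α <;> rcases j with β | β
  · refine (CliffordAlgebra.contractLeft_ι_mul _ _ _).trans ?_
    congr 1
    change dualVec v α (tLowPlus v β) • x = _
    simp [h]
  · refine (CliffordAlgebra.contractLeft_ι_mul _ _ _).trans ?_
    congr 1
    change dualVec v α 0 • x = _
    simp
  · refine (CliffordAlgebra.contractLeft_ι_mul _ _ _).trans ?_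
    congr 1
    change (0 : Module.Dual ℂ (gPlus v)) (tLowPlus v α) • x = _
    simp
  · refine (CliffordAlgebra.contractLeft_ι_mul _ _ _).trans ?_
    congr 1
    change dualVec v β (tLowPlus v α) • x = _
    simp [h, eq_comm]

theorem ghostK_mul_ghostW (i j : PosIdx μ ⊕ PosIdx μ) :
    ghostK v i * ghostW v j = (if i = j then 1 else 0) - ghostW v j * ghostK v i := by
  have h1 : ghostK v i * LinearMap.mulLeft ℂ (ghostLetter v j) =
      (if i = j then 1 else 0) - LinearMap.mulLeft ℂ (ghostLetter v j) * ghostK v i := by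
    ext x
    have := ghostK_letter_mul v i j x
    split_ifs at this ⊢ <;> simpa using this
  rcases j with β | β
  · simpa [ghostW] using h1
  · change ghostK v i * (LinearMap.mulLeft ℂ (ghostLetter v (Sum.inr β)) - ghostK v (Sum.inl β)) =
      _ - (LinearMap.mulLeft ℂ (ghostLetter v (Sum.inr β)) - ghostK v (Sum.inl β)) * ghostK v i
    rw [mul_sub, h1, sub_mul, ghostK_mul_ghostK v i]
    abel

/-- Multiplication by an antighost and contraction against the conjugate ghost have the same
anticommutators with multiplication by ghosts, so their difference anticommutes with these. The
creation operators therefore generate an exterior algebra acting on `1`: this is normal ordering,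
without the choice of a basis. -/
theorem ghostW_mul_ghostW (i j : PosIdx μ ⊕ PosIdx μ) :
    ghostW v i * ghostW v j = -(ghostW v j * ghostW v i) := by
  ext x
  rcases i with α | α <;> rcases j with β | β
  · simp [ghostW, ← mul_assoc, ghost_mul_ghost v α β]
  · have h1 := ghostK_letter_mul v (Sum.inl β) (Sum.inl α) x
    have h2 := antighost_mul_ghost v β α
    simp only [Sum.elim_inl, Sum.inl.injEq] at h1
    simp only [ghostW, Sum.elim_inl, Sum.elim_inr, sub_zero, Module.End.mul_apply, LinearMap.sub_apply,
      LinearMap.neg_apply, LinearMap.mulLeft_apply, h1, ← mul_assoc, h2, mul_sub]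
    split_ifs <;> noncomm_ring
  · have h1 := ghostK_letter_mul v (Sum.inl α) (Sum.inl β) x
    have h2 := antighost_mul_ghost v α β
    simp only [Sum.elim_inl, Sum.inl.injEq] at h1
    simp only [ghostW, Sum.elim_inl, Sum.elim_inr, sub_zero, Module.End.mul_apply, LinearMap.sub_apply,
      LinearMap.neg_apply, LinearMap.mulLeft_apply, h1, ← mul_assoc, h2, mul_sub]
    split_ifs <;> noncomm_ring
  · have h1 := ghostK_letter_mul v (Sum.inl α) (Sum.inr β) x
    have h2 := ghostK_letter_mul v (Sum.inl β) (Sum.inr α) x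
    have h3 := LinearMap.congr_fun (ghostK_mul_ghostK v (Sum.inl α) (Sum.inl β)) x
    simp only [Sum.elim_inr, reduceCtorEq, if_false, zero_sub, Module.End.mul_apply,
      LinearMap.neg_apply] at h1 h2 h3
    simp only [ghostW, Sum.elim_inr, Module.End.mul_apply, LinearMap.sub_apply,
      LinearMap.neg_apply, LinearMap.mulLeft_apply, h1, h2, h3, ← mul_assoc, mul_sub,
      antighost_mul_antighost v α β]
    noncomm_ring

/-- The augmentation of the enveloping algebra, which kills `sl_n`, maps `Ω` onto the Clifford
algebra and carries over the generation of `Ω` by its graded parts. -/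
theorem span_ghostWord : Submodule.span ℂ (Set.range (ghostWord v)) = ⊤ := by
  let f : Omega v →ₗ[ℂ] Ghosts v := TensorProduct.lift ((LinearMap.lsmul ℂ (Ghosts v)) ∘ₗ
    (UniversalEnvelopingAlgebra.lift ℂ (0 : SL n →ₗ⁅ℂ⁆ ℂ)).toLinearMap)
  have hf : ∀ x, f x ∈ Submodule.span ℂ (Set.range (ghostWord v)) := by
    intro x
    have hx : x ∈ ⨆ k, OmegaDeg v k := by
      rw [(OmegaDeg_isInternal v).submodule_iSup_eq_top]
      trivial
    induction hx using Submodule.iSup_induction' with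
    | mem k x hx =>
      induction hx using Submodule.span_induction with
      | mem x hx =>
        obtain ⟨u, w, -, rfl⟩ := hx
        exact Submodule.smul_mem _ _ (Submodule.subset_span ⟨w, rfl⟩)
      | zero => simp
      | add x y _ _ hx hy => rw [map_add]; exact add_mem hx hy
      | smul r x _ hx => rw [map_smul]; exact Submodule.smul_mem _ _ hx
    | zero => simp
    | add x y _ _ hx hy => rw [map_add]; exact add_mem hx hy
  rw [eq_top_iff]
  intro x _
  have := hf (1 ⊗ₜ x)
  simpa [f] using this

/-- The Clifford algebra as a fermionic space with vacuum `1`. -/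
def ghostFermions : Fermions (PosIdx μ ⊕ PosIdx μ) (Ghosts v) where
  vac := 1
  W := ghostW v
  K := ghostK v
  W_mul_W := ghostW_mul_ghostW v
  K_mul_K := ghostK_mul_ghostK v
  K_mul_W := ghostK_mul_ghostW v
  K_vac _ := CliffordAlgebra.contractLeft_one _ _
  span_words := by
    set S := Submodule.span ℂ (Set.range fun l : List (PosIdx μ ⊕ PosIdx μ) =>
      (l.map (ghostW v)).prod 1) with hS
    have hW : ∀ o x, x ∈ S → ghostW v o x ∈ S := by
      intro o x hx
      induction hx using Submodule.span_induction with
      | mem x hx =>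
        obtain ⟨l, rfl⟩ := hx
        exact Submodule.subset_span ⟨o :: l, by simp⟩
      | zero => simp
      | add x y _ _ hx hy => rw [map_add]; exact add_mem hx hy
      | smul r x _ hx => rw [map_smul]; exact Submodule.smul_mem _ _ hx
    have hK : ∀ o x, x ∈ S → ghostK v o x ∈ S := by
      intro o x hx
      induction hx using Submodule.span_induction with
      | mem x hx =>
        obtain ⟨l, rfl⟩ := hx
        dsimp only
        induction l with
        | nil =>
          rw [List.map_nil, List.prod_nil, Module.End.one_apply, ghostK,
            CliffordAlgebra.contractLeft_one]
          exact zero_mem _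
        | cons o' l ih =>
          have h := LinearMap.congr_fun (ghostK_mul_ghostW v o o') ((l.map (ghostW v)).prod 1)
          rw [List.map_cons, List.prod_cons, Module.End.mul_apply, ← Module.End.mul_apply, h,
            LinearMap.sub_apply]
          refine sub_mem ?_ (hW _ _ ih)
          split_ifs
          · exact Submodule.subset_span ⟨l, rfl⟩
          · exact zero_mem _
      | zero => simp
      | add x y _ _ hx hy => rw [map_add]; exact add_mem hx hy
      | smul r x _ hx => rw [map_smul]; exact Submodule.smul_mem _ _ hx
    -- Left multiplication by a letter is a creation operator, plus an annihilation operator for an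
    -- antighost, so the span of the created states absorbs all ghost words.
    have hL : ∀ o x, x ∈ S → ghostLetter v o * x ∈ S := by
      intro o x hx
      rcases o with α | γ
      · have := hW (Sum.inl α) x hx
        simpa [ghostW] using this
      · have := add_mem (hW (Sum.inr γ) x hx) (hK (Sum.inl γ) x hx)
        simpa [ghostW] using this
    rw [← span_ghostWord, Submodule.span_le]
    rintro _ ⟨w, rfl⟩
    induction w with
    | nil => exact Submodule.subset_span ⟨[], by simp [ghostWord]⟩
    | cons o w ih =>
      have := hL o _ ih
      simpa [ghostWord] using this

theorem isCliffordAction_ghostFermions : (ghostFermions v).IsCliffordAction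
    (Sum.elim (fun α => (1 : UniversalEnvelopingAlgebra ℂ (SL n)) ⊗ₜ[ℂ] ghost v α)
      fun γ => 1 ⊗ₜ[ℂ] antighost v γ)
    (TensorProduct.mk ℂ (UniversalEnvelopingAlgebra ℂ (SL n)) (Ghosts v) 1) where
  vac := rfl
  ghost α c := by simp [ghostFermions, ghostW]
  antighost γ c := by simp [ghostFermions, ghostW, TensorProduct.tmul_sub]

/-- Decompose an element of `f k` along the family `g`. The part with indices other than `k` lies
both in `f k` and in the sum of the other `f j`, hence vanishes. -/
theorem eq_of_le_of_iSupIndep {ι V : Type*} [AddCommGroup V] [Module ℂ V] {f g : ι → Submodule ℂ V}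
    (hf : iSupIndep f) (hgf : g ≤ f) (hg : ⨆ i, g i = ⊤) : f = g := by
  funext k
  refine le_antisymm (fun x hx => ?_) (hgf k)
  have h : x ∈ g k ⊔ ⨆ j, ⨆ _ : j ≠ k, g j := by
    rw [← iSup_split_single, hg]
    trivial
  obtain ⟨a, ha, b, hb, rfl⟩ := Submodule.mem_sup.mp h
  have h1 : b ∈ f k := by
    have := sub_mem hx (hgf k ha)
    rwa [add_sub_cancel_left] at this
  have h2 : b ∈ ⨆ j, ⨆ _ : j ≠ k, f j := iSup₂_mono (fun j _ => hgf j) hb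
  rw [Submodule.disjoint_def.mp (hf k) b h1 h2, add_zero]
  exact ha

/-- Monomials in letters of degree `0` do not affect the degree, so each graded part of the model
lands in the corresponding `OmegaDeg`. By surjectivity the images exhaust `Ω`, and independence of
the `OmegaDeg` forces equality. -/
theorem OmegaDeg_eq_map {κ : Type*} [Fintype κ] [DecidableEq κ]
    {x : PosIdx μ ⊕ (PosIdx μ ⊕ κ) → Omega v} (hx : ∀ i, x i ∈ OmegaDeg v 0)
    (hbij : Function.Bijective (monomialMap x
      (TensorProduct.mk ℂ (UniversalEnvelopingAlgebra ℂ (SL n)) (Ghosts v) 1))) (k : ℤ) :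
    OmegaDeg v k = ((ghostFermions v).gradedPart k).map (monomialMap x
      (TensorProduct.mk ℂ (UniversalEnvelopingAlgebra ℂ (SL n)) (Ghosts v) 1)) := by
  have h1 : (1 : Omega v) ∈ OmegaDeg v 0 :=
    Submodule.subset_span ⟨1, [], by simp [wordDeg], by simp [ghostWord]; rfl⟩
  -- The part of degree `0` is viewed as a constant filtration, so that `orderedMonomial_mem`
  -- applies with weight `0`.
  have hF : IsRingFiltration fun _ : ℤ => OmegaDeg v 0 :=
    { mono := fun _ _ _ => le_rfl
      one_mem := h1
      mul_mem := fun hx hy => by simpa using OmegaDeg_mul v hx hy }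
  refine congrFun (eq_of_le_of_iSupIndep (g := fun k => ((ghostFermions v).gradedPart k).map
    (monomialMap x (TensorProduct.mk ℂ (UniversalEnvelopingAlgebra ℂ (SL n)) (Ghosts v) 1)))
    (OmegaDeg_isInternal v).submodule_iSupIndep ?_ ?_) k
  · rintro k _ ⟨y, hy, rfl⟩
    change y ∈ (ghostFermions v).gradedPart k at hy
    induction hy using Submodule.span_induction with
    | mem y hy =>
      obtain ⟨b, rfl, rfl⟩ := hy
      rw [monomialMap_basisVec]
      have h2 := orderedMonomial_mem (w := 0) hF hx b.1
      have h3 := (isCliffordAction_ghostFermions v).state_mem (OmegaDeg v) letterDeg h1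
        (fun o p y hy => ?_) (fun γ p => le_of_eq (by simp [letterDeg, sub_eq_add_neg])) b.2
      · have := OmegaDeg_mul v h2 h3
        rwa [zero_add] at this
      · rw [add_comm]
        refine OmegaDeg_mul v ?_ hy
        rcases o with α | γ
        · exact Submodule.subset_span ⟨1, [Sum.inl α], by simp [wordDeg, letterDeg],
            by simp [ghostWord]⟩
        · exact Submodule.subset_span ⟨1, [Sum.inr γ], by simp [wordDeg, letterDeg],
            by simp [ghostWord]⟩
    | zero => simp
    | add x y _ _ hx hy => rw [map_add]; exact add_mem hx hy
    | smul r x _ hx => rw [map_smul]; exact Submodule.smul_mem _ _ hx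
  · rw [← Submodule.map_iSup, eq_top_iff, ← LinearMap.range_eq_top.mpr hbij.2, LinearMap.range_eq_map]
    refine Submodule.map_mono ((ghostFermions v).span_basisVec.trans (Submodule.span_le.mpr ?_))
    rintro _ ⟨b, rfl⟩
    exact Submodule.mem_iSup_of_mem _ (Submodule.subset_span ⟨b, rfl, rfl⟩)

end CliffordModel

/-! ### Matrix units, the column grading and `t_±`. -/

section MatrixUnits

variable {n : ℕ} {μ : YoungDiagram} (v : Module.Basis (Cell μ) ℂ (Fin n → ℂ))

theorem trace_mul_matUnit (A : Matrix (Fin n) (Fin n) ℂ) (x y : Cell μ) :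
    (A * matUnit v y x).trace = v.coord x (A.mulVec (v y)) := by
  have h1 : A * matUnit v y x = LinearMap.toMatrix' ((v.coord x).smulRight (A.mulVec (v y))) := by
    conv_lhs => rw [← LinearMap.toMatrix'_toLin' A]
    rw [matUnit, ← LinearMap.toMatrix'_comp]
    congr 1
    refine LinearMap.ext fun u => ?_
    simp
  have h : (LinearMap.toMatrix' ((v.coord x).smulRight (A.mulVec (v y)))).trace =
      LinearMap.trace ℂ _ ((v.coord x).smulRight (A.mulVec (v y))) := by
    rw [← LinearMap.toMatrix_eq_toMatrix']
    exact (LinearMap.trace_eq_matrix_trace ℂ (Pi.basisFun ℂ (Fin n)) _).symm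
  rw [h1, h, LinearMap.trace_smulRight]

theorem sum_matUnit_self : ∑ x, matUnit v x x = 1 := by
  simp only [matUnit]
  rw [← map_sum, ← LinearMap.toMatrix'_id]
  congr 1
  refine LinearMap.ext fun u => ?_
  simpa using v.sum_repr u

theorem matUnit_mul_mul_matUnit (A : Matrix (Fin n) (Fin n) ℂ) (x y : Cell μ) :
    matUnit v x x * A * matUnit v y y = (A * matUnit v y x).trace • matUnit v x y := by
  rw [trace_mul_matUnit]
  conv_lhs => rw [← LinearMap.toMatrix'_toLin' A]
  simp only [matUnit]
  rw [← LinearMap.toMatrix'_comp, ← LinearMap.toMatrix'_comp, ← map_smul]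
  congr 1
  refine LinearMap.ext fun u => ?_
  simp [smul_smul, mul_comm]

/-- The expansion of a matrix in matrix units. -/
theorem sum_trace_smul_matUnit (A : Matrix (Fin n) (Fin n) ℂ) :
    ∑ p : Cell μ × Cell μ, (A * matUnit v p.2 p.1).trace • matUnit v p.1 p.2 = A := by
  conv_rhs => rw [← one_mul A, ← mul_one (1 * A), ← sum_matUnit_self v, Finset.sum_mul,
    Finset.sum_mul_sum]
  rw [Fintype.sum_prod_type]
  simp only [matUnit_mul_mul_matUnit]

theorem eq_sum_tUp {A : Matrix (Fin n) (Fin n) ℂ}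
    (h : ∀ x y : Cell μ, y.1.2 ≤ x.1.2 → (A * matUnit v x y).trace = 0) :
    A = ∑ γ, (A * (tLow v γ).1).trace • (tUp v γ).1 := by
  conv_lhs => rw [← sum_trace_smul_matUnit v A]
  rw [← (Equiv.prodComm (Cell μ) (Cell μ)).sum_comp]
  rw [← Finset.sum_filter_of_ne (p := fun p : Cell μ × Cell μ => p.1.1.2 < p.2.1.2)]
  · exact Finset.sum_subtype _ (fun p => by simp) _
  · intro p _ hp
    by_contra hlt
    exact hp (by simp [h p.1 p.2 (not_lt.mp hlt)])

theorem eq_sum_tLow {A : Matrix (Fin n) (Fin n) ℂ}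
    (h : ∀ x y : Cell μ, x.1.2 ≤ y.1.2 → (A * matUnit v x y).trace = 0) :
    A = ∑ α, (A * (tUp v α).1).trace • (tLow v α).1 := by
  conv_lhs => rw [← sum_trace_smul_matUnit v A]
  rw [← Finset.sum_filter_of_ne (p := fun p : Cell μ × Cell μ => p.1.1.2 < p.2.1.2)]
  · exact Finset.sum_subtype _ (fun p => by simp) _
  · intro p _ hp
    by_contra hlt
    exact hp (by simp [h p.2 p.1 (not_lt.mp hlt)])

theorem ext_trace {A B : Matrix (Fin n) (Fin n) ℂ}
    (h : ∀ x y : Cell μ, (A * matUnit v x y).trace = (B * matUnit v x y).trace) : A = B := by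
  rw [← sum_trace_smul_matUnit v A, ← sum_trace_smul_matUnit v B]
  simp only [h]

/-- The diagonal matrix of the columns. -/
def colMatrix : Matrix (Fin n) (Fin n) ℂ := ∑ x : Cell μ, (x.1.2 : ℂ) • matUnit v x x

theorem matUnit_mul_colMatrix (x y : Cell μ) :
    matUnit v x y * colMatrix v = (y.1.2 : ℂ) • matUnit v x y := by
  simp [colMatrix, Finset.mul_sum, matUnit_mul]

theorem colMatrix_mul_matUnit (x y : Cell μ) :
    colMatrix v * matUnit v x y = (x.1.2 : ℂ) • matUnit v x y := by
  simp [colMatrix, Finset.sum_mul, matUnit_mul]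

/-- `A` is a combination of matrix units `E_{xy}` for which the column of `y` exceeds that of `x`
by `j`. -/
def IsHomogeneous (A : Matrix (Fin n) (Fin n) ℂ) (j : ℤ) : Prop :=
  A * colMatrix v - colMatrix v * A = (j : ℂ) • A

variable {v}

theorem isHomogeneous_matUnit (x y : Cell μ) :
    IsHomogeneous v (matUnit v x y) ((y.1.2 : ℤ) - x.1.2) := by
  rw [IsHomogeneous, matUnit_mul_colMatrix, colMatrix_mul_matUnit, ← sub_smul]
  push_cast
  rfl

/-- The trace form is invariant under the commutator with `colMatrix`, so homogeneous matrices pair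
to zero unless their degrees are opposite. -/
theorem IsHomogeneous.trace_eq_zero {A : Matrix (Fin n) (Fin n) ℂ} {j : ℤ}
    (hA : IsHomogeneous v A j) {x y : Cell μ} (h : j ≠ (x.1.2 : ℤ) - y.1.2) :
    (A * matUnit v x y).trace = 0 := by
  have h1 : ((A * colMatrix v - colMatrix v * A) * matUnit v x y).trace =
      ((x.1.2 : ℂ) - y.1.2) * (A * matUnit v x y).trace := by
    rw [sub_mul, Matrix.trace_sub, mul_assoc, colMatrix_mul_matUnit, mul_assoc (colMatrix v),
      Matrix.trace_mul_comm (colMatrix v), mul_assoc A (matUnit v x y), matUnit_mul_colMatrix,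
      Matrix.mul_smul, Matrix.trace_smul, Matrix.mul_smul, Matrix.trace_smul, smul_eq_mul,
      smul_eq_mul, sub_mul]
  rw [hA, Matrix.smul_mul, Matrix.trace_smul, smul_eq_mul] at h1
  have h2 : ((j : ℂ) - ((x.1.2 : ℂ) - y.1.2)) * (A * matUnit v x y).trace = 0 := by
    rw [sub_mul, h1, sub_self]
  refine (mul_eq_zero.mp h2).resolve_left fun h3 => h ?_
  have h4 : (j : ℂ) = (((x.1.2 : ℤ) - y.1.2 : ℤ) : ℂ) := by
    push_cast
    exact sub_eq_zero.mp h3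
  exact_mod_cast h4

theorem IsHomogeneous.mul {A B : Matrix (Fin n) (Fin n) ℂ} {j k : ℤ} (hA : IsHomogeneous v A j)
    (hB : IsHomogeneous v B k) : IsHomogeneous v (A * B) (j + k) := by
  have e : A * B * colMatrix v - colMatrix v * (A * B) =
      A * (B * colMatrix v - colMatrix v * B) + (A * colMatrix v - colMatrix v * A) * B := by
    noncomm_ring
  rw [IsHomogeneous, e, hA, hB, Matrix.mul_smul, Matrix.smul_mul, ← add_smul, add_comm]
  push_cast
  rfl

theorem IsHomogeneous.add {A B : Matrix (Fin n) (Fin n) ℂ} {j : ℤ} (hA : IsHomogeneous v A j)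
    (hB : IsHomogeneous v B j) : IsHomogeneous v (A + B) j := by
  rw [IsHomogeneous, add_mul, mul_add, add_sub_add_comm, hA, hB, smul_add]

theorem IsHomogeneous.smul {A : Matrix (Fin n) (Fin n) ℂ} {j : ℤ} (hA : IsHomogeneous v A j)
    (r : ℂ) : IsHomogeneous v (r • A) j := by
  rw [IsHomogeneous, Matrix.smul_mul, Matrix.mul_smul, ← smul_sub, hA, smul_comm]

theorem isHomogeneous_zero (j : ℤ) : IsHomogeneous v (0 : Matrix (Fin n) (Fin n) ℂ) j := by
  simp [IsHomogeneous]

variable (v)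

/-- The matrix of `t_+`. -/
def raisingMatrix : Matrix (Fin n) (Fin n) ℂ :=
  ∑ x : Cell μ, ∑ y : Cell μ, (if IsNext x y then matUnit v x y else 0)

/-- The coefficients of `t_-`. -/
def lowerCoeff (y : Cell μ) : ℂ := (y.1.2 : ℂ) * ((μ.rowLen y.1.1 : ℂ) - (y.1.2 : ℂ))

/-- The matrix of `t_-`. -/
def loweringMatrix : Matrix (Fin n) (Fin n) ℂ :=
  ∑ x : Cell μ, ∑ y : Cell μ, (if IsNext x y then lowerCoeff y • matUnit v y x else 0)

theorem exists_isNext {y : Cell μ} (h : 0 < y.1.2) : ∃ x : Cell μ, IsNext x y :=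
  ⟨⟨(y.1.1, y.1.2 - 1), μ.up_left_mem le_rfl (Nat.sub_le _ _) y.2⟩, rfl,
    (Nat.sub_add_cancel h).symm⟩

theorem lowerCoeff_ne_zero {y : Cell μ} (h : 0 < y.1.2) : lowerCoeff y ≠ 0 := by
  have h1 : y.1.2 < μ.rowLen y.1.1 := YoungDiagram.mem_iff_lt_rowLen.mp y.2
  refine mul_ne_zero (by exact_mod_cast h.ne') (sub_ne_zero.mpr ?_)
  exact_mod_cast h1.ne'

theorem IsNext.eq_right {x y z : Cell μ} (h : IsNext x y) (h' : IsNext x z) : z = y :=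
  Subtype.ext (Prod.ext (h'.1.trans h.1.symm) (h'.2.trans h.2.symm))

theorem IsNext.eq_left {x y z : Cell μ} (h : IsNext x y) (h' : IsNext z y) : z = x :=
  Subtype.ext (Prod.ext (h'.1.symm.trans h.1) (by have := h.2; have := h'.2; omega))

theorem IsNext.sum_left {M : Type*} [AddCommMonoid M] {a b : Cell μ} (h : IsNext a b)
    (F : Cell μ → Cell μ → M) :
    ∑ x, ∑ y, (if IsNext x y then if a = x then F x y else 0 else 0) = F a b := by
  rw [Finset.sum_eq_single a, Finset.sum_eq_single b]
  · rw [if_pos h, if_pos rfl]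
  · intro y _ hy
    rw [if_neg fun h' => hy (h.eq_right h')]
  · simp
  · intro x _ hx
    simp [Ne.symm hx]
  · simp

theorem IsNext.sum_right {M : Type*} [AddCommMonoid M] {a b : Cell μ} (h : IsNext a b)
    (F : Cell μ → Cell μ → M) :
    ∑ x, ∑ y, (if IsNext x y then if y = b then F x y else 0 else 0) = F a b := by
  rw [Finset.sum_eq_single a, Finset.sum_eq_single b]
  · rw [if_pos h, if_pos rfl]
  · intro y _ hy
    simp [hy]
  · simp
  · intro x _ hx
    refine Finset.sum_eq_zero fun y _ => ?_
    split_ifs with h1 h2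
    · subst h2
      exact absurd (h.eq_left h1) hx
    · rfl
    · rfl
  · simp

theorem matUnit_mul_raising {x y z : Cell μ} (h : IsNext y z) :
    matUnit v x y * raisingMatrix v = matUnit v x z := by
  simp only [raisingMatrix, Finset.mul_sum, mul_ite, mul_zero, matUnit_mul]
  exact h.sum_left fun _ w => matUnit v x w

theorem raising_mul_matUnit {x y z : Cell μ} (h : IsNext z x) :
    raisingMatrix v * matUnit v x y = matUnit v z y := by
  simp only [raisingMatrix, Finset.sum_mul, ite_mul, zero_mul, matUnit_mul]
  exact h.sum_right fun w _ => matUnit v w y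

theorem raising_mul_matUnit_of_zero {x y : Cell μ} (h : x.1.2 = 0) :
    raisingMatrix v * matUnit v x y = 0 := by
  simp only [raisingMatrix, Finset.sum_mul, ite_mul, zero_mul, matUnit_mul]
  refine Finset.sum_eq_zero fun z _ => Finset.sum_eq_zero fun w _ => ?_
  split_ifs with h1 h2
  · subst h2
    have := h1.2
    omega
  · rfl
  · rfl

theorem lowering_mul_matUnit {x y z : Cell μ} (h : IsNext x z) :
    loweringMatrix v * matUnit v x y = lowerCoeff z • matUnit v z y := by
  simp only [loweringMatrix, Finset.sum_mul, ite_mul, zero_mul, Matrix.smul_mul, matUnit_mul,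
    smul_ite, smul_zero, eq_comm (b := x)]
  exact h.sum_left fun _ w => lowerCoeff w • matUnit v w y

theorem matUnit_mul_lowering {x y z : Cell μ} (h : IsNext z y) :
    matUnit v x y * loweringMatrix v = lowerCoeff y • matUnit v x z := by
  simp only [loweringMatrix, Finset.mul_sum, mul_ite, mul_zero, Matrix.mul_smul, matUnit_mul,
    smul_ite, smul_zero, eq_comm (a := y)]
  exact h.sum_right fun z w => lowerCoeff w • matUnit v x z

theorem matUnit_mul_lowering_of_zero {x y : Cell μ} (h : y.1.2 = 0) :
    matUnit v x y * loweringMatrix v = 0 := by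
  simp only [loweringMatrix, Finset.mul_sum, mul_ite, mul_zero, Matrix.mul_smul, matUnit_mul]
  refine Finset.sum_eq_zero fun z _ => Finset.sum_eq_zero fun w _ => ?_
  split_ifs with h1 h2
  · subst h2
    have := h1.2
    omega
  · simp
  · rfl

theorem isHomogeneous_raising : IsHomogeneous v (raisingMatrix v) 1 := by
  refine Finset.sum_induction _ (IsHomogeneous v · 1) (fun _ _ => IsHomogeneous.add)
    (isHomogeneous_zero 1) fun x _ => Finset.sum_induction _ (IsHomogeneous v · 1)
    (fun _ _ => IsHomogeneous.add) (isHomogeneous_zero 1) fun y _ => ?_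
  split_ifs with h
  · convert isHomogeneous_matUnit x y
    have := h.2
    omega
  · exact isHomogeneous_zero 1

theorem isHomogeneous_lowering : IsHomogeneous v (loweringMatrix v) (-1) := by
  refine Finset.sum_induction _ (IsHomogeneous v · (-1)) (fun _ _ => IsHomogeneous.add)
    (isHomogeneous_zero _) fun x _ => Finset.sum_induction _ (IsHomogeneous v · (-1))
    (fun _ _ => IsHomogeneous.add) (isHomogeneous_zero _) fun y _ => ?_
  split_ifs with h
  · refine IsHomogeneous.smul ?_ _
    convert isHomogeneous_matUnit y x
    have := h.2
    omega
  · exact isHomogeneous_zero _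

/-- With `x'` and `y'` the left neighbours of `x` and `y`, one has `[E_{xy'}, t_+] = E_{xy} -
E_{x'y'}`. The second term is absent when `x` is in column `0`, since all rows start there;
otherwise it is removed by recursion on the column of `x`. -/
theorem exists_raising_preimage (α : PosIdx μ) : ∃ X : Matrix (Fin n) (Fin n) ℂ,
    X * raisingMatrix v - raisingMatrix v * X = (tLow v α).1 ∧
      IsHomogeneous v X ((α.1.2.1.2 : ℤ) - α.1.1.1.2 - 1) := by
  have key : ∀ k : ℕ, ∀ x y : Cell μ, x.1.2 = k → x.1.2 < y.1.2 → ∃ X : Matrix (Fin n) (Fin n) ℂ,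
      X * raisingMatrix v - raisingMatrix v * X = matUnit v x y ∧
        IsHomogeneous v X ((y.1.2 : ℤ) - x.1.2 - 1) := by
    intro k
    induction k with
    | zero =>
      intro x y hx hxy
      obtain ⟨y', hy'⟩ := exists_isNext (Nat.zero_lt_of_lt hxy)
      refine ⟨matUnit v x y', by
        rw [matUnit_mul_raising v hy', raising_mul_matUnit_of_zero v hx, sub_zero], ?_⟩
      convert isHomogeneous_matUnit x y' using 1
      have := hy'.2
      omega
    | succ k ih =>
      intro x y hx hxy
      obtain ⟨y', hy'⟩ := exists_isNext (Nat.zero_lt_of_lt hxy)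
      obtain ⟨x', hx'⟩ := exists_isNext (y := x) (by omega)
      have h1 := hy'.2
      have h2 := hx'.2
      obtain ⟨X, hX, hX'⟩ := ih x' y' (by omega) (by omega)
      refine ⟨matUnit v x y' + X, ?_, ?_⟩
      · rw [add_mul, mul_add, add_sub_add_comm, hX, matUnit_mul_raising v hy',
          raising_mul_matUnit v hx', sub_add_cancel]
      · refine IsHomogeneous.add ?_ ?_
        · convert isHomogeneous_matUnit x y' using 1
          omega
        · convert hX' using 1
          omega
  exact key _ _ _ rfl α.2

/-- Again one recurses on the column of `x`, now with `[t_-, E_{y'x}] = lowerCoeff y • E_{yx} -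
lowerCoeff x • E_{y'x'}`, in which `lowerCoeff y` is invertible. Only units `E_{y'x}` with `x` not
to the right of `y'` are used; they pair to zero with every `t^γ`, which is the second claim. -/
theorem exists_lowering_preimage (α : PosIdx μ) : ∃ Y : Matrix (Fin n) (Fin n) ℂ,
    loweringMatrix v * Y - Y * loweringMatrix v = (tUp v α).1 ∧
      ∀ γ, ((tUp v γ).1 * Y).trace = 0 := by
  have key : ∀ k : ℕ, ∀ x y : Cell μ, x.1.2 = k → x.1.2 < y.1.2 → ∃ Y : Matrix (Fin n) (Fin n) ℂ,
      loweringMatrix v * Y - Y * loweringMatrix v = matUnit v y x ∧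
        ∀ γ, ((tUp v γ).1 * Y).trace = 0 := by
    have htr : ∀ (x y y' : Cell μ) (γ : PosIdx μ), x.1.2 < y.1.2 → IsNext y' y →
        ((tUp v γ).1 * matUnit v y' x).trace = 0 := by
      intro x y y' γ hxy hy'
      have h := γ.2
      have h1 := hy'.2
      simp only [tUp, matUnit_mul]
      split_ifs with h2
      · rw [trace_matUnit, if_neg]
        rintro h3
        rw [h2, h3] at h
        omega
      · simp
    intro k
    induction k with
    | zero =>
      intro x y hx hxy
      obtain ⟨y', hy'⟩ := exists_isNext (Nat.zero_lt_of_lt hxy)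
      have hk := lowerCoeff_ne_zero (Nat.zero_lt_of_lt hxy)
      refine ⟨(lowerCoeff y)⁻¹ • matUnit v y' x, ?_, fun γ => ?_⟩
      · rw [Matrix.mul_smul, Matrix.smul_mul, lowering_mul_matUnit v hy',
          matUnit_mul_lowering_of_zero v hx, smul_zero, sub_zero, smul_smul, inv_mul_cancel₀ hk,
          one_smul]
      · rw [Matrix.mul_smul, Matrix.trace_smul, htr x y y' γ hxy hy', smul_zero]
    | succ k ih =>
      intro x y hx hxy
      obtain ⟨y', hy'⟩ := exists_isNext (Nat.zero_lt_of_lt hxy)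
      obtain ⟨x', hx'⟩ := exists_isNext (y := x) (by omega)
      have hk := lowerCoeff_ne_zero (Nat.zero_lt_of_lt hxy)
      have h1 := hy'.2
      have h2 := hx'.2
      obtain ⟨Y, hY, hY'⟩ := ih x' y' (by omega) (by omega)
      refine ⟨(lowerCoeff y)⁻¹ • (matUnit v y' x + lowerCoeff x • Y), ?_, fun γ => ?_⟩
      · rw [Matrix.mul_smul, Matrix.smul_mul, ← smul_sub, mul_add, add_mul, add_sub_add_comm,
          lowering_mul_matUnit v hy', matUnit_mul_lowering v hx', Matrix.mul_smul, Matrix.smul_mul,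
          ← smul_sub (lowerCoeff x), hY, sub_add_cancel, smul_smul, inv_mul_cancel₀ hk, one_smul]
      · rw [Matrix.mul_smul, Matrix.trace_smul, mul_add, Matrix.trace_add, htr x y y' γ hxy hy',
          Matrix.mul_smul, Matrix.trace_smul, hY', smul_zero, add_zero, smul_zero]
  exact key _ _ _ rfl α.2

theorem exists_traceless (A : Matrix (Fin n) (Fin n) ℂ) :
    ∃ r : ℂ, (A - r • 1).trace = 0 ∧ (A.trace = 0 → r = 0) := by
  refine ⟨A.trace / n, ?_, fun h => by simp [h]⟩
  rcases Nat.eq_zero_or_pos n with rfl | hn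
  · simp [Matrix.trace]
  · have : (n : ℂ) ≠ 0 := by exact_mod_cast hn.ne'
    simp [Matrix.trace_sub, this]

theorem exists_raising_preimage_sl (α : PosIdx μ) : ∃ X : SL n,
    X.1 * raisingMatrix v - raisingMatrix v * X.1 = (tLow v α).1 ∧
      IsHomogeneous v X.1 ((α.1.2.1.2 : ℤ) - α.1.1.1.2 - 1) := by
  obtain ⟨X, h1, h2⟩ := exists_raising_preimage v α
  obtain ⟨r, hr, hr'⟩ := exists_traceless X
  refine ⟨⟨X - r • 1, hr⟩, ?_, ?_⟩
  · simp only [sub_mul, mul_sub, ← h1, Matrix.smul_mul, Matrix.mul_smul, one_mul, mul_one]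
    abel
  · have h3 : (((α.1.2.1.2 : ℤ) - α.1.1.1.2 - 1 : ℤ) : ℂ) * r = 0 := by
      have := congrArg Matrix.trace h2
      rw [Matrix.trace_sub, Matrix.trace_mul_comm, sub_self, Matrix.trace_smul, smul_eq_mul,
        eq_comm, mul_eq_zero] at this
      rcases this with h | h
      · rw [h, zero_mul]
      · rw [hr' h, mul_zero]
    simp only [IsHomogeneous, sub_mul, mul_sub, Matrix.smul_mul, Matrix.mul_smul, one_mul, mul_one,
      smul_sub, smul_smul, h3, zero_smul, sub_zero]
    rw [← h2]
    abel

theorem exists_lowering_preimage_sl (α : PosIdx μ) : ∃ Y : SL n,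
    loweringMatrix v * Y.1 - Y.1 * loweringMatrix v = (tUp v α).1 ∧
      ∀ γ, ((tUp v γ).1 * Y.1).trace = 0 := by
  obtain ⟨Y, h1, h2⟩ := exists_lowering_preimage v α
  obtain ⟨r, hr, -⟩ := exists_traceless Y
  refine ⟨⟨Y - r • 1, hr⟩, ?_, fun γ => ?_⟩
  · simp only [sub_mul, mul_sub, ← h1, Matrix.smul_mul, Matrix.mul_smul, one_mul, mul_one]
    abel
  · have h3 : (tUp v γ).1.trace = 0 := (tUp v γ).2
    simp only [mul_sub, Matrix.trace_sub, h2, Matrix.mul_smul, mul_one, Matrix.trace_smul, h3,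
      smul_zero, sub_zero]

end MatrixUnits

/-! ### A homogeneous basis of `sl_n` adapted to `t_+`. -/

section HomogeneousBasis

variable {n : ℕ} {μ : YoungDiagram} (v : Module.Basis (Cell μ) ℂ (Fin n → ℂ))

/-- The homogeneous parts of `sl_n`. -/
def slPart (j : ℤ) : Submodule ℂ (SL n) where
  carrier := {X | IsHomogeneous v X.1 j}
  add_mem' := IsHomogeneous.add
  zero_mem' := isHomogeneous_zero j
  smul_mem' r _ h := IsHomogeneous.smul h r

theorem mem_slPart {j : ℤ} {X : SL n} : X ∈ slPart v j ↔ IsHomogeneous v X.1 j := Iff.rfl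

theorem coe_lie (X Y : SL n) : ⁅X, Y⁆.1 = X.1 * Y.1 - Y.1 * X.1 := rfl

theorem lie_mem_slPart {i j : ℤ} {X Y : SL n} (hX : X ∈ slPart v i) (hY : Y ∈ slPart v j) :
    ⁅X, Y⁆ ∈ slPart v (i + j) := by
  rw [mem_slPart, coe_lie, sub_eq_add_neg, ← neg_one_smul ℂ]
  refine IsHomogeneous.add (IsHomogeneous.mul hX hY) (IsHomogeneous.smul ?_ _)
  rw [add_comm]
  exact IsHomogeneous.mul hY hX

/-- The degree of `t_α`. -/
def posDeg (α : PosIdx μ) : ℤ := (α.1.2.1.2 : ℤ) - α.1.1.1.2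

theorem one_le_posDeg (α : PosIdx μ) : 1 ≤ posDeg α := by
  have := α.2
  unfold posDeg
  omega

theorem tLow_mem (α : PosIdx μ) : tLow v α ∈ slPart v (posDeg α) := isHomogeneous_matUnit _ _

theorem tUp_mem (α : PosIdx μ) : tUp v α ∈ slPart v (-posDeg α) := by
  rw [posDeg, neg_sub]
  exact isHomogeneous_matUnit _ _

/-- The functional `X ↦ Tr(X t_α)`. -/
def lowCoord (α : PosIdx μ) : Module.Dual ℂ (SL n) where
  toFun X := (X.1 * (tLow v α).1).trace
  map_add' X Y := by simp [add_mul]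
  map_smul' r X := by simp

/-- The functional `X ↦ Tr(X t^α)`. -/
def upCoord (α : PosIdx μ) : Module.Dual ℂ (SL n) where
  toFun X := (X.1 * (tUp v α).1).trace
  map_add' X Y := by simp [add_mul]
  map_smul' r X := by simp

/-- The functional `X ↦ Tr(t_+ X)`. -/
def raisingChar : SL n →ₗ[ℂ] ℂ where
  toFun X := (raisingMatrix v * X.1).trace
  map_add' X Y := by simp [mul_add]
  map_smul' r X := by simp

theorem lowCoord_tUp (α β : PosIdx μ) : lowCoord v α (tUp v β) = if α = β then 1 else 0 :=
  (tLow_tUp_trace v β α).trans (by simp only [eq_comm])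

theorem upCoord_tLow (α β : PosIdx μ) : upCoord v α (tLow v β) = if α = β then 1 else 0 :=
  (Matrix.trace_mul_comm _ _).trans (tLow_tUp_trace v α β)

theorem lowCoord_eq_zero {j : ℤ} {X : SL n} (hX : X ∈ slPart v j) {γ : PosIdx μ}
    (h : j ≠ -posDeg γ) : lowCoord v γ X = 0 :=
  IsHomogeneous.trace_eq_zero hX (by rwa [posDeg, neg_sub] at h)

theorem raisingChar_eq_zero {j : ℤ} {X : SL n} (hX : X ∈ slPart v j) (h : j ≠ -1) :
    raisingChar v X = 0 := by
  change (raisingMatrix v * X.1).trace = 0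
  rw [Matrix.trace_mul_comm, raisingMatrix]
  simp only [Finset.mul_sum, Matrix.trace_sum]
  refine Finset.sum_eq_zero fun x _ => Finset.sum_eq_zero fun y _ => ?_
  split_ifs with h1
  · refine IsHomogeneous.trace_eq_zero hX ?_
    have := h1.2
    omega
  · simp

/-- Pairing with `E_{yx}` reads off the coefficient of `E_{xy}` in `t_+`. The character of the
charge thereby becomes an invariant pairing, to which `raisingChar_tUp_lie` applies. -/
theorem raisingChar_tUp (α : PosIdx μ) : raisingChar v (tUp v α) = chi α := by
  change (raisingMatrix v * (tUp v α).1).trace = chi α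
  have h1 := α.2
  by_cases h : IsNext α.1.1 α.1.2
  · rw [tUp, raising_mul_matUnit v h, trace_matUnit, if_pos rfl, chi, if_pos h]
  · obtain ⟨x, hx⟩ := exists_isNext (Nat.zero_lt_of_lt h1)
    rw [tUp, raising_mul_matUnit v hx, trace_matUnit, if_neg, chi, if_neg h]
    rintro rfl
    exact h hx

theorem eq_sum_tUp_of_neg {j : ℤ} {X : SL n} (hX : X ∈ slPart v j) (hj : j < 0) :
    X = ∑ γ, lowCoord v γ X • tUp v γ := by
  apply Subtype.ext
  have h := eq_sum_tUp v (A := X.1) fun x y hxy => IsHomogeneous.trace_eq_zero hX (by omega)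
  refine h.trans ?_
  simp only [AddSubmonoidClass.coe_finsetSum]
  rfl

theorem isHomogeneous_of_trace {A : Matrix (Fin n) (Fin n) ℂ} {j : ℤ}
    (h : ∀ x y : Cell μ, j ≠ (x.1.2 : ℤ) - y.1.2 → (A * matUnit v x y).trace = 0) :
    IsHomogeneous v A j := by
  rw [← sum_trace_smul_matUnit v A]
  refine Finset.sum_induction _ (IsHomogeneous v · j) (fun _ _ => IsHomogeneous.add)
    (isHomogeneous_zero j) fun p _ => ?_
  by_cases hp : j = (p.2.1.2 : ℤ) - p.1.1.2
  · rw [hp]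
    exact (isHomogeneous_matUnit _ _).smul _
  · rw [h _ _ hp, zero_smul]
    exact isHomogeneous_zero j

theorem iSup_slPart : ⨆ j, slPart v j = ⊤ := by
  rw [eq_top_iff]
  intro X _
  set X₁ := ∑ γ, lowCoord v γ X • tUp v γ with h1
  set X₂ := ∑ α, upCoord v α X • tLow v α with h2
  have hX₁ : X₁ ∈ ⨆ j, slPart v j := sum_mem fun γ _ =>
    Submodule.smul_mem _ _ (Submodule.mem_iSup_of_mem _ (tUp_mem v γ))
  have hX₂ : X₂ ∈ ⨆ j, slPart v j := sum_mem fun α _ =>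
    Submodule.smul_mem _ _ (Submodule.mem_iSup_of_mem _ (tLow_mem v α))
  have hX₀ : X - X₁ - X₂ ∈ slPart v 0 := by
    refine isHomogeneous_of_trace v fun x y hxy => ?_
    rcases lt_or_ge x.1.2 y.1.2 with h | h
    · change lowCoord v ⟨(x, y), h⟩ (X - X₁ - X₂) = 0
      have e : lowCoord v ⟨(x, y), h⟩ X₂ = 0 := by
        rw [h2, map_sum]
        refine Finset.sum_eq_zero fun α _ => ?_
        rw [map_smul, lowCoord_eq_zero v (tLow_mem v α), smul_zero]
        have h3 := one_le_posDeg α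
        have h4 := one_le_posDeg (⟨(x, y), h⟩ : PosIdx μ)
        omega
      rw [map_sub, map_sub, e, h1, map_sum]
      simp [lowCoord_tUp]
    · have h' : y.1.2 < x.1.2 := by omega
      change upCoord v ⟨(y, x), h'⟩ (X - X₁ - X₂) = 0
      have e : upCoord v ⟨(y, x), h'⟩ X₁ = 0 := by
        rw [h1, map_sum]
        refine Finset.sum_eq_zero fun γ _ => ?_
        have h3 := one_le_posDeg γ
        have h4 : ((tUp v γ).1 * matUnit v x y).trace = 0 :=
          IsHomogeneous.trace_eq_zero (tUp_mem v γ) (by omega)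
        rw [map_smul]
        exact (congrArg _ h4).trans (smul_zero _)
      rw [map_sub, map_sub, e, h2, map_sum]
      simp [upCoord_tLow]
  rw [← sub_add_cancel X X₁, ← sub_add_cancel (X - X₁) X₂]
  exact add_mem (add_mem (Submodule.mem_iSup_of_mem _ hX₀) hX₂) hX₁

/-- The operator `X ↦ [X, t_+]` with values in matrices. -/
def raisingOp : SL n →ₗ[ℂ] Matrix (Fin n) (Fin n) ℂ where
  toFun X := X.1 * raisingMatrix v - raisingMatrix v * X.1
  map_add' X Y := by
    change (X.1 + Y.1) * raisingMatrix v - raisingMatrix v * (X.1 + Y.1) = _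
    noncomm_ring
  map_smul' r X := by simp [smul_sub]

/-- The homogeneous parts of the centralizer of `t_+`. -/
def centralizerPart (j : ℤ) : Submodule ℂ (SL n) := LinearMap.ker (raisingOp v) ⊓ slPart v j

variable (μ) in
/-- The largest column. -/
def maxCol : ℕ := Finset.univ.sup fun x : Cell μ => x.1.2

theorem le_maxCol (x : Cell μ) : x.1.2 ≤ maxCol μ :=
  Finset.le_sup (f := fun x : Cell μ => x.1.2) (Finset.mem_univ x)

theorem posDeg_le (α : PosIdx μ) : posDeg α ≤ maxCol μ := by
  have := le_maxCol α.1.2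
  unfold posDeg
  omega

theorem eq_zero_of_maxCol_lt {j : ℤ} {X : SL n} (hX : X ∈ slPart v j) (h : maxCol μ < j) :
    X = 0 := by
  refine Subtype.ext (ext_trace v fun x y => ?_)
  rw [IsHomogeneous.trace_eq_zero hX]
  · simp
  · have := le_maxCol x
    omega

/-- The index set of a homogeneous basis of the centralizer of `t_+`. -/
abbrev CentralizerIdx : Type :=
  Σ j : Fin (maxCol μ + 1), Fin (Module.finrank ℂ (centralizerPart v j))

/-- A homogeneous basis of the centralizer of `t_+`. -/
def centralizerVec (k : CentralizerIdx v) : SL n :=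
  (Module.finBasis ℂ (centralizerPart v k.1) k.2).1

theorem centralizerVec_mem (k : CentralizerIdx v) : centralizerVec v k ∈ slPart v k.1 :=
  (Module.finBasis ℂ (centralizerPart v k.1) k.2).2.2

theorem raisingOp_centralizerVec (k : CentralizerIdx v) : raisingOp v (centralizerVec v k) = 0 :=
  (Module.finBasis ℂ (centralizerPart v k.1) k.2).2.1

/-- The solution `X` of `[X, t_+] = t_α`. -/
def raisingSol (α : PosIdx μ) : SL n := (exists_raising_preimage_sl v α).choose

theorem raisingOp_raisingSol (α : PosIdx μ) : raisingOp v (raisingSol v α) = (tLow v α).1 :=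
  (exists_raising_preimage_sl v α).choose_spec.1

theorem raisingSol_mem (α : PosIdx μ) : raisingSol v α ∈ slPart v (posDeg α - 1) :=
  (exists_raising_preimage_sl v α).choose_spec.2

/-- The homogeneous basis of `sl_n`. -/
def homogeneousVec : PosIdx μ ⊕ (PosIdx μ ⊕ CentralizerIdx v) → SL n :=
  Sum.elim (tUp v) (Sum.elim (raisingSol v) (centralizerVec v))

/-- The degrees of the homogeneous basis. -/
def homogeneousDeg : PosIdx μ ⊕ (PosIdx μ ⊕ CentralizerIdx v) → ℤ :=
  Sum.elim (fun γ => -posDeg γ) (Sum.elim (fun α => posDeg α - 1) fun k => (k.1 : ℕ))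

theorem homogeneousVec_mem (i) : homogeneousVec v i ∈ slPart v (homogeneousDeg v i) := by
  rcases i with γ | α | k
  · exact tUp_mem v γ
  · exact raisingSol_mem v α
  · exact centralizerVec_mem v k

theorem homogeneousVec_mem_span {i} {j : ℤ} (h : homogeneousDeg v i = j) : homogeneousVec v i ∈
    Submodule.span ℂ (homogeneousVec v '' {i | homogeneousDeg v i = j}) :=
  Submodule.subset_span ⟨i, h, rfl⟩

/-- In negative degree there are only the `t^γ`. In degree `j ≥ 0` the bracket with `t_+` has
positive degree, hence is a combination of the `t_α`; subtracting the same combination of the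
`raisingSol` leaves an element of the centralizer of the same degree. -/
theorem mem_span_homogeneousVec {j : ℤ} {X : SL n} (hX : X ∈ slPart v j) :
    X ∈ Submodule.span ℂ (homogeneousVec v '' {i | homogeneousDeg v i = j}) := by
  rcases lt_or_ge j 0 with hj | hj
  · rw [eq_sum_tUp_of_neg v hX hj]
    refine sum_mem fun γ _ => ?_
    by_cases h : j = -posDeg γ
    · exact Submodule.smul_mem _ _ (homogeneousVec_mem_span v (i := Sum.inl γ) h.symm)
    · rw [lowCoord_eq_zero v hX h, zero_smul]
      exact zero_mem _
  · have h1 : IsHomogeneous v (raisingOp v X) (j + 1) := by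
      change IsHomogeneous v (X.1 * raisingMatrix v - raisingMatrix v * X.1) (j + 1)
      rw [sub_eq_add_neg, ← neg_one_smul ℂ]
      refine IsHomogeneous.add (IsHomogeneous.mul hX (isHomogeneous_raising v))
        (IsHomogeneous.smul ?_ _)
      rw [add_comm]
      exact IsHomogeneous.mul (isHomogeneous_raising v) hX
    have h2 := eq_sum_tLow v (A := raisingOp v X) fun x y hxy => h1.trace_eq_zero (by omega)
    set S := ∑ α, (raisingOp v X * (tUp v α).1).trace • raisingSol v α with hS
    have h0 : ∀ α, posDeg α - 1 ≠ j → (raisingOp v X * (tUp v α).1).trace = 0 := fun α hα =>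
      h1.trace_eq_zero (by unfold posDeg at hα; omega)
    have hSm : S ∈ slPart v j := by
      refine sum_mem fun α _ => ?_
      by_cases h : posDeg α - 1 = j
      · exact Submodule.smul_mem _ _ (h ▸ raisingSol_mem v α)
      · rw [h0 α h, zero_smul]
        exact zero_mem _
    have hSs : S ∈ Submodule.span ℂ (homogeneousVec v '' {i | homogeneousDeg v i = j}) := by
      refine sum_mem fun α _ => ?_
      by_cases h : posDeg α - 1 = j
      · exact Submodule.smul_mem _ _ (homogeneousVec_mem_span v (i := Sum.inr (Sum.inl α)) h)
      · rw [h0 α h, zero_smul]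
        exact zero_mem _
    have hC : X - S ∈ centralizerPart v j := by
      refine ⟨?_, sub_mem hX hSm⟩
      change raisingOp v (X - S) = 0
      rw [map_sub, hS, map_sum]
      simp only [map_smul, raisingOp_raisingSol]
      exact sub_eq_zero.mpr h2
    rw [← sub_add_cancel X S]
    refine add_mem ?_ hSs
    -- No matrix unit has degree beyond the largest column, which is why finitely many degrees
    -- suffice in `CentralizerIdx`.
    rcases lt_or_ge (maxCol μ : ℤ) j with h | h
    · rw [eq_zero_of_maxCol_lt v hC.2 h]
      exact zero_mem _
    · obtain ⟨k, rfl⟩ := Int.eq_ofNat_of_zero_le hj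
      let k' : Fin (maxCol μ + 1) := ⟨k, by omega⟩
      have h3 := congrArg Subtype.val ((Module.finBasis ℂ (centralizerPart v k')).sum_repr ⟨X - S, hC⟩)
      rw [AddSubmonoidClass.coe_finsetSum] at h3
      rw [← show _ = X - S from h3]
      refine sum_mem fun l _ => Submodule.smul_mem _ _ ?_
      exact homogeneousVec_mem_span v (i := Sum.inr (Sum.inr ⟨k', l⟩)) rfl

/-- The system is triangular: `lowCoord` isolates the `t^γ`; `raisingOp` then kills the centralizer
and sends the `raisingSol` to the independent `t_α`; the centralizer vectors left over are separated
by degree. -/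
theorem linearIndependent_homogeneousVec : LinearIndependent ℂ (homogeneousVec v) := by
  rw [Fintype.linearIndependent_iff]
  intro g hg
  simp only [Fintype.sum_sum_type, homogeneousVec, Sum.elim_inl, Sum.elim_inr] at hg
  have hdeg : ∀ γ i, lowCoord v γ (homogeneousVec v (Sum.inr i)) = 0 := by
    intro γ i
    refine lowCoord_eq_zero v (homogeneousVec_mem v _) ?_
    have h1 := one_le_posDeg γ
    rcases i with α | k
    · have := one_le_posDeg α
      simp only [homogeneousDeg, Sum.elim_inr, Sum.elim_inl]
      omega
    · simp only [homogeneousDeg, Sum.elim_inr]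
      omega
  have h1 : ∀ γ, g (Sum.inl γ) = 0 := by
    intro γ
    have h := congrArg (lowCoord v γ) hg
    have e1 : ∀ α, lowCoord v γ (raisingSol v α) = 0 := fun α => hdeg γ (Sum.inl α)
    have e2 : ∀ k, lowCoord v γ (centralizerVec v k) = 0 := fun k => hdeg γ (Sum.inr k)
    simpa [lowCoord_tUp, e1, e2] using h
  simp only [h1, zero_smul, Finset.sum_const_zero, zero_add] at hg
  have h2 : ∀ α, g (Sum.inr (Sum.inl α)) = 0 := by
    intro β
    have h := congrArg (raisingOp v) hg
    simp only [map_add, map_sum, map_smul, raisingOp_raisingSol, raisingOp_centralizerVec, smul_zero,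
      Finset.sum_const_zero, add_zero, map_zero] at h
    have h' := congrArg (fun A => ((tUp v β).1 * A).trace) h
    simpa [Finset.mul_sum, Matrix.trace_sum, tLow_tUp_trace] using h'
  simp only [h2, zero_smul, Finset.sum_const_zero, zero_add] at hg
  have h3 : ∀ k, g (Sum.inr (Sum.inr k)) = 0 := by
    rw [Fintype.sum_sigma] at hg
    let S : Fin (maxCol μ + 1) → SL n := fun j => ∑ l, g (Sum.inr (Sum.inr ⟨j, l⟩)) •
      centralizerVec v ⟨j, l⟩
    have hSm : ∀ j : Fin (maxCol μ + 1), S j ∈ slPart v (j : ℕ) := fun j => sum_mem fun l _ =>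
      Submodule.smul_mem _ _ (centralizerVec_mem v ⟨j, l⟩)
    have hS : ∑ j, S j = 0 := hg
    have hS0 : ∀ j, S j = 0 := by
      intro j
      refine Subtype.ext (ext_trace v fun x y => ?_)
      by_cases hxy : ((j : ℕ) : ℤ) = (x.1.2 : ℤ) - y.1.2
      · have h4 : ((∑ j, S j).1 * matUnit v x y).trace = ((S j).1 * matUnit v x y).trace := by
          rw [AddSubmonoidClass.coe_finsetSum, Finset.sum_mul, Matrix.trace_sum]
          refine Finset.sum_eq_single j (fun j' _ hj' => ?_) (by simp)
          refine IsHomogeneous.trace_eq_zero (hSm j') ?_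
          intro h
          rw [← hxy] at h
          exact hj' (Fin.ext (by exact_mod_cast h))
        rw [← h4, hS]
      · rw [IsHomogeneous.trace_eq_zero (hSm j) hxy]
        simp
    rintro ⟨j, l⟩
    have hb := (Fintype.linearIndependent_iff.mp
      (Module.finBasis ℂ (centralizerPart v j)).linearIndependent)
      (fun l => g (Sum.inr (Sum.inr ⟨j, l⟩))) (Subtype.ext ?_) l
    · exact hb
    · rw [AddSubmonoidClass.coe_finsetSum]
      exact hS0 j
  rintro (γ | α | k)
  · exact h1 γ
  · exact h2 α
  · exact h3 k

/-- The homogeneous basis of `sl_n`. -/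
def homogeneousBasis : Module.Basis (PosIdx μ ⊕ (PosIdx μ ⊕ CentralizerIdx v)) ℂ (SL n) :=
  Module.Basis.mk (linearIndependent_homogeneousVec v) (by
    rw [← iSup_slPart v]
    refine iSup_le fun j X hX => ?_
    exact Submodule.span_mono (Set.image_subset_range _ _) (mem_span_homogeneousVec v hX))

theorem homogeneousBasis_apply (i) : homogeneousBasis v i = homogeneousVec v i :=
  Module.Basis.mk_apply _ _ _

/-- This is invariance of the trace form. It turns the solutions of `[X, t_+] = t_α` into the dual
family of the `t^β`, and the centralizer of `t_+` into its annihilator. -/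
theorem raisingChar_tUp_lie (β : PosIdx μ) (X : SL n) :
    raisingChar v ⁅tUp v β, X⁆ = ((tUp v β).1 * raisingOp v X).trace := by
  change (raisingMatrix v * ((tUp v β).1 * X.1 - X.1 * (tUp v β).1)).trace =
    ((tUp v β).1 * (X.1 * raisingMatrix v - raisingMatrix v * X.1)).trace
  rw [mul_sub, mul_sub, Matrix.trace_sub, Matrix.trace_sub, Matrix.trace_mul_comm (raisingMatrix v),
    ← mul_assoc (raisingMatrix v), Matrix.trace_mul_comm (raisingMatrix v * X.1), mul_assoc]

theorem isGradedReduction : IsGradedReduction (tUp v) (lowCoord v) (raisingChar v) (slPart v) posDeg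
    (homogeneousBasis v) (homogeneousDeg v) (maxCol μ) where
  lie_mem i j X Y hX hY := lie_mem_slPart v hX hY
  deg_pos := one_le_posDeg
  dg_le i := by
    rcases i with γ | α | k
    · have := one_le_posDeg γ
      simp only [homogeneousDeg, Sum.elim_inl]
      omega
    · have := posDeg_le α
      simp only [homogeneousDeg, Sum.elim_inl, Sum.elim_inr]
      omega
    · have := k.1.2
      simp only [homogeneousDeg, Sum.elim_inr]
      omega
  t_mem := tUp_mem v
  τ_eq j X γ hX h := lowCoord_eq_zero v hX h
  proj_eq j X hX hj := by
    rw [lowerProj_apply]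
    exact (eq_sum_tUp_of_neg v hX hj).symm
  χ_eq j X hX h := raisingChar_eq_zero v hX h
  e_mem i := by
    rw [homogeneousBasis_apply]
    exact homogeneousVec_mem v i
  mem_span j X hX := by
    rw [show ⇑(homogeneousBasis v) = homogeneousVec v from funext (homogeneousBasis_apply v)]
    exact mem_span_homogeneousVec v hX
  e_low γ := homogeneousBasis_apply v _
  dg_low γ := rfl
  dg_mid α := rfl
  χ_mid β α := by
    rw [homogeneousBasis_apply, raisingChar_tUp_lie]
    change ((tUp v β).1 * raisingOp v (raisingSol v α)).trace = _
    rw [raisingOp_raisingSol, tLow_tUp_trace]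
  χ_free β k := by
    rw [homogeneousBasis_apply, raisingChar_tUp_lie]
    change ((tUp v β).1 * raisingOp v (centralizerVec v k)).trace = _
    rw [raisingOp_centralizerVec, mul_zero, Matrix.trace_zero]

end HomogeneousBasis

/-! ### The BRST complex as a deformation, and the dimension count. -/

section Cohomology

variable {n : ℕ} {μ : YoungDiagram} (v : Module.Basis (Cell μ) ℂ (Fin n → ℂ))

theorem eq_sum_tUp_of_trace {X : SL n}
    (h : ∀ x y : Cell μ, y.1.2 ≤ x.1.2 → (X.1 * matUnit v x y).trace = 0) :
    X = ∑ γ, lowCoord v γ X • tUp v γ := by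
  apply Subtype.ext
  refine (eq_sum_tUp v h).trans ?_
  simp only [AddSubmonoidClass.coe_finsetSum]
  rfl

theorem trace_commutator_mul (A B C : Matrix (Fin n) (Fin n) ℂ) :
    ((A * B - B * A) * C).trace = -((A * C - C * A) * B).trace := by
  rw [sub_mul, sub_mul, Matrix.trace_sub, Matrix.trace_sub, Matrix.trace_mul_comm (A * C) B,
    mul_assoc C A B, Matrix.trace_mul_comm C (A * B), ← mul_assoc B A C]
  ring

/-- The dimension of the centralizer of `t_-`. -/
theorem finrank_adKer {s : SL n} (hs : s.1 = loweringMatrix v) :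
    Module.finrank ℂ (adKer s) + 2 * Fintype.card (PosIdx μ) = Module.finrank ℂ (SL n) := by
  have hY := exists_lowering_preimage_sl v
  choose Y hY hY' using hY
  rw [← hs] at hY
  have hsY : ∀ α, ⁅s, Y α⁆ = tUp v α := fun α => Subtype.ext (hY α)
  have htr : ∀ α β, (⁅s.1, (tLow v α).1⁆ * (Y β).1).trace = -if β = α then 1 else 0 := by
    intro α β
    rw [← tLow_tUp_trace, ← hsY]
    exact trace_commutator_mul s.1 (tLow v α).1 (Y β).1
  -- These vectors will be a basis of the image of `ad t_-`: the whole negative part, and the images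
  -- of the positive basis vectors.
  let f : PosIdx μ ⊕ PosIdx μ → SL n := Sum.elim (tUp v) fun α => ⁅s, tLow v α⁆
  have hf : LinearIndependent ℂ f := by
    rw [Fintype.linearIndependent_iff]
    intro g hg
    simp only [Fintype.sum_sum_type, f, Sum.elim_inl, Sum.elim_inr] at hg
    -- Pairing with `Y β` kills all the `t^γ` by `hY'` and, by invariance of the trace, takes the
    -- value `-1` on `⁅s, tLow v β⁆` and `0` on the others.
    have h1 : ∀ α, g (Sum.inr α) = 0 := by
      intro β
      have h := congrArg (fun X : SL n => (X.1 * (Y β).1).trace) hg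
      simpa [add_mul, Finset.sum_mul, Matrix.trace_sum, hY', htr, Matrix.trace_add] using h
    simp only [h1, zero_smul, Finset.sum_const_zero, add_zero] at hg
    have h2 : ∀ γ, g (Sum.inl γ) = 0 := by
      intro γ
      have h := congrArg (lowCoord v γ) hg
      simpa [lowCoord_tUp] using h
    rintro (γ | α)
    · exact h2 γ
    · exact h1 α
  have hrange : LinearMap.range (LieAlgebra.ad ℂ (SL n) s : SL n →ₗ[ℂ] SL n) =
      Submodule.span ℂ (Set.range f) := by
    apply le_antisymm
    · rintro _ ⟨X, rfl⟩
      set X₁ := ∑ α, upCoord v α X • tLow v α with h1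
      have e1 : ⁅s, X₁⁆ ∈ Submodule.span ℂ (Set.range f) := by
        rw [h1, lie_sum]
        refine sum_mem fun α _ => ?_
        rw [lie_smul]
        exact Submodule.smul_mem _ _ (Submodule.subset_span ⟨Sum.inr α, rfl⟩)
      -- Removing `X₁` leaves no component of positive degree, and `t_-` lowers the degree, so the
      -- bracket is a combination of the `t^γ`.
      have e2 : ⁅s, X - X₁⁆ ∈ Submodule.span ℂ (Set.range f) := by
        have h0 : ∀ γ, ((X - X₁).1 * (tUp v γ).1).trace = 0 := by
          intro γ
          change upCoord v γ (X - X₁) = 0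
          rw [map_sub, h1, map_sum]
          simp [upCoord_tLow]
        rw [eq_sum_tUp_of_trace v (X := ⁅s, X - X₁⁆) fun x y hxy => ?_]
        · exact sum_mem fun γ _ => Submodule.smul_mem _ _ (Submodule.subset_span ⟨Sum.inl γ, rfl⟩)
        · have h2 : IsHomogeneous v (matUnit v x y * s.1 - s.1 * matUnit v x y)
              ((y.1.2 : ℤ) - x.1.2 - 1) := by
            rw [hs, sub_eq_add_neg _ (_ * _), ← neg_one_smul ℂ]
            refine IsHomogeneous.add (IsHomogeneous.mul (isHomogeneous_matUnit x y)
              (isHomogeneous_lowering v)) (IsHomogeneous.smul ?_ _)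
            rw [sub_eq_neg_add _ 1]
            exact IsHomogeneous.mul (isHomogeneous_lowering v) (isHomogeneous_matUnit x y)
          have h3 := eq_sum_tUp v (A := matUnit v x y * s.1 - s.1 * matUnit v x y)
            fun z w hzw => h2.trace_eq_zero (by omega)
          have h4 : (⁅s, X - X₁⁆.1 * matUnit v x y).trace =
              ((X - X₁).1 * (matUnit v x y * s.1 - s.1 * matUnit v x y)).trace := by
            rw [coe_lie, sub_mul, mul_sub, Matrix.trace_sub, Matrix.trace_sub, mul_assoc s.1,
              Matrix.trace_mul_comm s.1, mul_assoc, mul_assoc]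
          rw [h4, h3, Finset.mul_sum, Matrix.trace_sum]
          refine Finset.sum_eq_zero fun γ _ => ?_
          rw [Matrix.mul_smul, Matrix.trace_smul, h0, smul_zero]
      have := add_mem e2 e1
      rwa [← lie_add, sub_add_cancel] at this
    · rw [Submodule.span_le]
      rintro _ ⟨γ | α, rfl⟩
      · exact ⟨Y γ, hsY γ⟩
      · exact ⟨tLow v α, rfl⟩
  have h1 := LinearMap.finrank_range_add_finrank_ker (LieAlgebra.ad ℂ (SL n) s : SL n →ₗ[ℂ] SL n)
  rw [hrange, finrank_span_eq_card hf, Fintype.card_sum] at h1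
  have h2 : Module.finrank ℂ (adKer s) =
      Module.finrank ℂ (LinearMap.ker (LieAlgebra.ad ℂ (SL n) s : SL n →ₗ[ℂ] SL n)) := rfl
  omega

/-- The currents `J`. -/
def slCurrent : SL n →ₗ[ℂ] Omega v :=
  (TensorProduct.mk ℂ (UniversalEnvelopingAlgebra ℂ (SL n)) (Ghosts v)).flip 1 ∘ₗ
    (UniversalEnvelopingAlgebra.ι ℂ : SL n →ₗ⁅ℂ⁆ UniversalEnvelopingAlgebra ℂ (SL n)).toLinearMap

theorem slCurrent_apply (X : SL n) :
    slCurrent v X = UniversalEnvelopingAlgebra.ι ℂ X ⊗ₜ[ℂ] 1 := rfl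

/-- The ghosts in `Ω`. -/
def omegaGhost (α : PosIdx μ) : Omega v :=
  (1 : UniversalEnvelopingAlgebra ℂ (SL n)) ⊗ₜ[ℂ] ghost v α

/-- The antighosts in `Ω`. -/
def omegaAntighost (α : PosIdx μ) : Omega v :=
  (1 : UniversalEnvelopingAlgebra ℂ (SL n)) ⊗ₜ[ℂ] antighost v α

theorem ghostSystem :
    GhostSystem (slCurrent v) (omegaGhost v) (omegaAntighost v) (tUp v) (lowCoord v) where
  J_lie X Y := by
    simp only [slCurrent_apply, Algebra.TensorProduct.tmul_mul_tmul, mul_one,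
      ← TensorProduct.sub_tmul, ι_mul_sub_ι_mul]
  J_c X α := by simp [slCurrent_apply, omegaGhost]
  J_b X α := by simp [slCurrent_apply, omegaAntighost]
  c_c α β := by
    simp only [omegaGhost, Algebra.TensorProduct.tmul_mul_tmul, mul_one]
    rw [ghost_mul_ghost, TensorProduct.tmul_neg]
  b_b α β := by
    simp only [omegaAntighost, Algebra.TensorProduct.tmul_mul_tmul, mul_one]
    rw [antighost_mul_antighost, TensorProduct.tmul_neg]
  b_c α β := by
    simp only [omegaGhost, omegaAntighost, Algebra.TensorProduct.tmul_mul_tmul, mul_one]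
    rw [antighost_mul_ghost, TensorProduct.tmul_sub]
    split_ifs <;> simp [Algebra.TensorProduct.one_def]
  τ_t := lowCoord_tUp v
  t_lie := tUp_bracket v

/-- The ghost current puts the inner ghost before the outer one. Exchanging them accounts for the
minus sign of the cubic term. -/
theorem charge_eq_Q : charge (slCurrent v) (omegaGhost v) (omegaAntighost v) (tUp v) (lowCoord v)
    (raisingChar v) = Q v := by
  have h1 : ∀ α, ghostCurrent (omegaGhost v) (omegaAntighost v) (tUp v) (lowCoord v) (tUp v α) *
      omegaGhost v α = -∑ β, ∑ γ, structConst v α β γ •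
        ((1 : UniversalEnvelopingAlgebra ℂ (SL n)) ⊗ₜ[ℂ] (antighost v γ * ghost v α * ghost v β)) := by
    intro α
    rw [ghostCurrent_apply, Finset.sum_mul, ← Finset.sum_neg_distrib]
    refine Finset.sum_congr rfl fun β _ => ?_
    rw [antighostOf_apply, Finset.sum_mul, Finset.sum_mul, ← Finset.sum_neg_distrib]
    refine Finset.sum_congr rfl fun γ _ => ?_
    change (structConst v α β γ • omegaAntighost v γ) * omegaGhost v β * omegaGhost v α = _
    rw [smul_mul_assoc, smul_mul_assoc, mul_assoc, (ghostSystem v).c_c β α, ← smul_neg]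
    simp only [omegaGhost, omegaAntighost, Algebra.TensorProduct.tmul_mul_tmul, mul_one, mul_neg,
      mul_assoc]
  rw [charge, Q]
  simp only [add_mul, smul_mul_assoc, h1, smul_neg, ← sub_eq_add_neg]
  rw [Finset.sum_sub_distrib, ← Finset.smul_sum]
  congr 1
  refine Finset.sum_congr rfl fun α _ => ?_
  rw [raisingChar_tUp, slCurrent_apply, Algebra.TensorProduct.algebraMap_apply,
    ← TensorProduct.sub_tmul, omegaGhost, Algebra.TensorProduct.tmul_mul_tmul, mul_one, one_mul]
  rfl

/-- This gives the total currents the shape, a generator plus a Clifford element, that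
`monomialMap_bijective` requires. -/
theorem ghostCurrent_eq_tmul (X : SL n) : ∃ r : Ghosts v,
    ghostCurrent (omegaGhost v) (omegaAntighost v) (tUp v) (lowCoord v) X = 1 ⊗ₜ[ℂ] r := by
  refine ⟨∑ β, (∑ γ, lowCoord v γ ⁅X, tUp v β⁆ • antighost v γ) * ghost v β, ?_⟩
  simp only [ghostCurrent_apply, antighostOf_apply, omegaGhost, omegaAntighost,
    TensorProduct.tmul_sum, Finset.sum_mul, smul_mul_assoc, TensorProduct.tmul_smul,
    Algebra.TensorProduct.tmul_mul_tmul, mul_one]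

/-- The letters of the homogeneous basis. -/
def omegaCurrent (i : PosIdx μ ⊕ (PosIdx μ ⊕ CentralizerIdx v)) : Omega v :=
  totalCurrent (slCurrent v) (omegaGhost v) (omegaAntighost v) (tUp v) (lowCoord v)
    (homogeneousBasis v i)

theorem omegaCurrent_mem (i) : omegaCurrent v i ∈ OmegaDeg v 0 := by
  rw [omegaCurrent, totalCurrent, LinearMap.add_apply]
  refine add_mem (Submodule.subset_span ⟨UniversalEnvelopingAlgebra.ι ℂ _, [], by simp [wordDeg],
    by simp [ghostWord, slCurrent_apply]; rfl⟩) ?_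
  rw [ghostCurrent_apply]
  refine sum_mem fun β _ => ?_
  rw [antighostOf_apply, Finset.sum_mul]
  refine sum_mem fun γ _ => ?_
  rw [smul_mul_assoc]
  exact Submodule.smul_mem _ _ (Submodule.subset_span ⟨1, [Sum.inr γ, Sum.inl β], by simp [wordDeg],
    by simp [ghostWord, omegaGhost, omegaAntighost]⟩)

theorem omegaMonomials_bijective : Function.Bijective (monomialMap (omegaCurrent v)
    (TensorProduct.mk ℂ (UniversalEnvelopingAlgebra ℂ (SL n)) (Ghosts v) 1)) := by
  refine monomialMap_bijective (homogeneousBasis v) (LieAlgebra.SpecialLinear.sl (Fin n) ℂ).incl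
    Subtype.val_injective (omegaCurrent v) fun i => ?_
  obtain ⟨r, hr⟩ := ghostCurrent_eq_tmul v (homogeneousBasis v i)
  exact ⟨r, by rw [omegaCurrent, totalCurrent, LinearMap.add_apply, hr, slCurrent_apply]⟩

theorem exists_filteredContraction_brst : ∃ F : ℤ → Submodule ℂ (Omega v),
    ∃ d h e : Module.End ℂ (Omega v), FilteredContraction F (OmegaDeg v) (brst v) d h e ∧
      Nonempty (LinearMap.range e ≃ₗ[ℂ] MvPolynomial (CentralizerIdx v) ℂ) := by
  have hD := (isGradedReduction v).isDeformation (ghostSystem v) (isCliffordAction_ghostFermions v)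
    (parity v) (fun X => by simp [slCurrent_apply, parity])
    (fun α => by simp [omegaGhost, parity, ghost, TensorProduct.tmul_neg])
    (fun α => by simp [omegaAntighost, parity, antighost, TensorProduct.tmul_neg])
    (d := brst v) (fun y => by rw [charge_eq_Q]; rfl)
  refine hD.exists_filteredContraction ?_ (omegaMonomials_bijective v)
    (OmegaDeg_eq_map v (omegaCurrent_mem v) (omegaMonomials_bijective v)) (brst_brst v)
    fun k y hy => brst_mem v hy
  exact one_ne_zero (α := Ghosts v)

/-- Only vector spaces are compared, so it suffices to count. The homogeneous basis has twice as
many elements as `PosIdx μ` besides those of the centralizer of `t_+`, and `finrank_adKer` gives the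
same count for `t_-`. -/
theorem nonempty_polynomial_equiv_enveloping {s : SL n} (hs : s.1 = loweringMatrix v) :
    Nonempty (MvPolynomial (CentralizerIdx v) ℂ ≃ₗ[ℂ] UniversalEnvelopingAlgebra ℂ (adKer s)) := by
  have hdim := finrank_adKer v hs
  have hbasis := Module.finrank_eq_card_basis (homogeneousBasis v)
  rw [Fintype.card_sum, Fintype.card_sum] at hbasis
  let ε : CentralizerIdx v ≃ Fin (Module.finrank ℂ (adKer s)) := Fintype.equivFinOfCardEq (by omega)
  have hinj : Function.Injective ((LieAlgebra.SpecialLinear.sl (Fin n) ℂ).incl.comp (adKer s).incl) :=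
    Subtype.val_injective.comp Subtype.val_injective
  exact ⟨(MvPolynomial.renameEquiv ℂ ε).toLinearEquiv ≪≫ₗ
    pbwEquiv (Module.finBasis ℂ (adKer s)) _ hinj⟩

end Cohomology

end FiniteW

end

/-! ### The main theorem. -/

theorem mainTheorem7 {n : ℕ} (i : FiniteW.SL 2 →ₗ⁅ℂ⁆ FiniteW.SL n) (μ : YoungDiagram)
    (v : Module.Basis (FiniteW.Cell μ) ℂ (Fin n → ℂ)) (hv : FiniteW.IsAdapted v i) :
    Nonempty (FiniteW.BRSTCohomology v 0 ≃ₗ[ℂ]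
      UniversalEnvelopingAlgebra ℂ (FiniteW.adKer (i FiniteW.sl2F))) ∧
    ∀ k : ℤ, k ≠ 0 → Subsingleton (FiniteW.BRSTCohomology v k) := by
  obtain ⟨F, d, h, e, hC, ⟨f⟩⟩ := FiniteW.exists_filteredContraction_brst v
  refine ⟨?_, fun k hk => ?_⟩
  · obtain ⟨g⟩ := hC.cohomology_zero
    obtain ⟨g'⟩ := FiniteW.nonempty_polynomial_equiv_enveloping v (s := i FiniteW.sl2F) hv.2
    exact ⟨g ≪≫ₗ f ≪≫ₗ g'⟩
  · refine ⟨fun x y => ?_⟩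
    have key : ∀ z : FiniteW.BRSTCohomology v k, z = 0 := by
      intro z
      obtain ⟨⟨z, hz1, hz2⟩, rfl⟩ := Submodule.Quotient.mk_surjective _ z
      obtain ⟨y, hy, hyz⟩ := hC.exact_of_ne_zero hk z hz1 hz2
      exact (Submodule.Quotient.mk_eq_zero _).mpr ⟨y, hy, hyz⟩
    rw [key x, key y]
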